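/- Let $r_1,r_2\in(0,1)$, $\Lambda=\{1,2\}^{\mathbb Z}$ with the two-sided shift $\theta$, $E=\{1,2\}$, and $E^\infty=E^{\mathbb N}$ with the one-sided shift $\sigma$ (sequences $\omega=(\omega_1,\omega_2,\dots)$). For $\lambda=(\dots,\lambda_{-1},\lambda_0,\lambda_1,\dots)\in\Lambda$ let $$\phi_1^\lambda(x)=r_{\lambda_0}x+1,\qquad \phi_2^\lambda(x)=r_{\lambda_0}x-1 ,$$ and let $X=[a,b]$, $a<b$, be a compact interval that all these maps send into itself. Put $\pi_\lambda(\omega)=\bigcap_{n\ge1}\phi_{\omega_1}^{\lambda}\circ\phi_{\omega_2}^{\theta\lambda}\circ\dots\circ\phi_{\omega_n}^{\theta^{n-1}\lambda}(X)$, which is a single point, and $\pi(\lambda,\omega)=\pi_\lambda(\omega)$. Let $P=(p_1,p_2)$ and $Q=(q_1,q_2)$ be probability vectors, $m_P$ and $\nu_Q$ the corresponding Bernoulli measures on $\Lambda$ and on $E^\infty$, $\mu=m_P\times\nu_Q$, and $(\mu_\lambda)_{\lambda\in\Lambda}$ the disintegration of $\mu$ over $\Lambda$. Let $\xi$ be the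 partition of $\Lambda\times E^\infty$ according to the value of $\omega_1$, let $\mathcal A$ be the $\sigma$-algebra generated by $(\lambda,\omega)\mapsto\lambda$, let $\mathcal B$ be the Borel $\sigma$-algebra of $\mathbb R$, and define $$h_\mu(\mathcal S)=H_\mu\big(\xi\,\big|\,\mathcal A\vee(\theta\times\sigma)^{-1}\pi^{-1}\mathcal B\big)-H_\mu\big(\xi\,\big|\,\mathcal A\vee\pi^{-1}\mathcal B\big),\qquad \chi_\mu=\int-\log\big|(\phi_{\omega_1}^\lambda)'(\pi_{\theta\lambda}(\sigma\omega))\big|\,d\mu(\lambda,\omega).$$ Then for $\mu$-almost every $(\lambda,\omega)$ the pointwise dimension of the projection measure $\mu_\lambda\circ\pi_\lambda^{-1}$ at $\pi_\lambda(\omega)$ exists and equals $h_\mu(\mathcal S)/\chi_\mu$, that is, $$\lim_{\varepsilon\to0^+}\frac{\log\big(\mu_\lambda\circ\pi_\lambda^{-1}\big)\big(B(\pi_\lambda(\omega),\varepsilon)\big)}{\log\varepsilon}=\frac{h_\mu(\mathcal S)}{\chi_\mu};$$ for $m_P$-almost every $\lambda$ the Hausdorff dimension and the packing dimension of the measure $\mu_\lambda\circ\pi_\lambda^{-1}$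 exist and are both equal to $h_\mu(\mathcal S)/\chi_\mu$. (The Hausdorff dimension of a measure $\nu$ exists if $\inf\{\dim_H Y:\nu(Y)>0\}=\inf\{\dim_H Y:\nu(Y^c)=0\}$, with $Y$ Borel, and is then this common value; likewise for packing.) Moreover $$\frac{h_\mu(\mathcal S)}{\chi_\mu}\le\frac{h(m_P)+h(\nu_Q)}{-p_1\log r_1-p_2\log r_2}=\frac{p_1\log p_1+p_2\log p_2+q_1\log q_1+q_2\log q_2}{p_1\log r_1+p_2\log r_2},$$ where $h(m_P)$ and $h(\nu_Q)$, which are finite, are the measure-theoretic (Kolmogorov–Sinai) entropies of $\theta$ and of $\sigma$, and $0\log0=0$. -/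

import Mathlib

open MeasureTheory ProbabilityTheory Filter Topology Set
open scoped ENNReal NNReal

noncomputable section

namespace RandomIFS

/-! Dimensions of measures. -/

/-- The finite Borel measure `ν` has pointwise dimension `d` at `x`. -/
def HasPointwiseDim {X : Type*} [PseudoMetricSpace X] [MeasurableSpace X]
    (ν : Measure X) (x : X) (d : ℝ) : Prop :=
  Tendsto (fun ε : ℝ => Real.log (ν.real (Metric.ball x ε)) / Real.log ε) (𝓝[>] 0) (𝓝 d)

/-- The `d`-dimensional `δ`-packing premeasure: the supremum of `∑ (2 ρ i) ^ d` over families of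
pairwise disjoint closed balls with centres in `s` and radii at most `δ`. -/
def packingPreDelta {X : Type*} [PseudoMetricSpace X] (d : ℝ≥0) (δ : ℝ) (s : Set X) : ℝ≥0∞ :=
  ⨆ (t : Finset X) (ρ : X → ℝ) (_ : (t : Set X) ⊆ s) (_ : ∀ x ∈ t, 0 < ρ x ∧ ρ x ≤ δ)
    (_ : (t : Set X).PairwiseDisjoint fun x => Metric.closedBall x (ρ x)),
    ∑ x ∈ t, ENNReal.ofReal (2 * ρ x) ^ (d : ℝ)

/-- The `d`-dimensional packing premeasure. -/
def packingPre {X : Type*} [PseudoMetricSpace X] (d : ℝ≥0) (s : Set X) : ℝ≥0∞ :=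
  ⨅ (δ : ℝ) (_ : 0 < δ), packingPreDelta d δ s

/-- The `d`-dimensional packing (outer) measure. -/
def packingMeasure {X : Type*} [PseudoMetricSpace X] (d : ℝ≥0) (s : Set X) : ℝ≥0∞ :=
  ⨅ (t : ℕ → Set X) (_ : s ⊆ ⋃ n, t n), ∑' n, packingPre d (t n)

/-- Packing dimension of a set, in the same format as Mathlib's Hausdorff dimension `dimH`. -/
def dimPack {X : Type*} [PseudoMetricSpace X] (s : Set X) : ℝ≥0∞ :=
  ⨆ (d : ℝ≥0) (_ : packingMeasure d s = ∞), (d : ℝ≥0∞)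

/-- Given a dimension `D` of sets, the infimum of `D Y` over the sets `Y` of positive measure. -/
def lowerDim (D : Set ℝ → ℝ≥0∞) (ν : Measure ℝ) : ℝ≥0∞ :=
  ⨅ (Y : Set ℝ) (_ : MeasurableSet Y) (_ : 0 < ν Y), D Y

/-- Given a dimension `D` of sets, the infimum of `D Y` over the sets `Y` of full measure. -/
def upperDim (D : Set ℝ → ℝ≥0∞) (ν : Measure ℝ) : ℝ≥0∞ :=
  ⨅ (Y : Set ℝ) (_ : MeasurableSet Y) (_ : ν Yᶜ = 0), D Y

/-- `ν` has a Hausdorff dimension and it is `d`: the lower and the upper Hausdorff dimension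
agree, with common value `d`. -/
def HasHausdorffDim (ν : Measure ℝ) (d : ℝ≥0∞) : Prop :=
  lowerDim dimH ν = d ∧ upperDim dimH ν = d

/-- `ν` has a packing dimension and it is `d`. -/
def HasPackingDim (ν : Measure ℝ) (d : ℝ≥0∞) : Prop :=
  lowerDim dimPack ν = d ∧ upperDim dimPack ν = d

/-! Entropies. -/

/-- Shannon entropy of the finite partition of `Ω` into the fibres of `f`. -/
def partitionEntropy {Ω ι : Type*} [MeasurableSpace Ω] [Fintype ι] (μ : Measure Ω)
    (f : Ω → ι) : ℝ :=
  ∑ i, Real.negMulLog (μ.real (f ⁻¹' {i}))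

/-- Measure-theoretic (Kolmogorov-Sinai) entropy `h(μ)` of a transformation `T` preserving `μ`:
the supremum over finite measurable partitions (written as measurable labellings `f`) of
`lim (1/n) H(f ∨ f ∘ T ∨ ... ∨ f ∘ T^(n-1))`. -/
def ksEntropy {Ω : Type*} [MeasurableSpace Ω] (μ : Measure Ω) (T : Ω → Ω) : ℝ≥0∞ :=
  ⨆ (k : ℕ) (f : Ω → Fin k) (_ : Measurable f),
    limsup (fun n : ℕ => ENNReal.ofReal
      (partitionEntropy μ (fun (x : Ω) (j : Fin n) => f (T^[j] x)) / n)) atTop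

/-- Conditional entropy of the finite partition into the fibres of `f` given the sub-σ-algebra
`𝒢`: the integral of the information function `-∑ 1_A log E(1_A | 𝒢)`. -/
def condPartitionEntropy {Ω ι : Type*} [mΩ : MeasurableSpace Ω] [Fintype ι] (μ : Measure Ω)
    (f : Ω → ι) (𝒢 : MeasurableSpace Ω) : ℝ :=
  ∫ x, -∑ i, (f ⁻¹' {i}).indicator
    (fun y => Real.log ((μ[(f ⁻¹' {i}).indicator (fun _ => (1 : ℝ)) | 𝒢]) y)) x ∂μ

/-! Random iterated function systems on the line: `θ : Λ → Λ` is the base transformation, `E` the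
alphabet, `φ l e` the map with index `e` at the parameter `l`, and `X` the compact phase space.
A one-sided sequence `ω 0, ω 1, ...` stands for `ω₁, ω₂, ...`. -/

/-- The one-sided shift. -/
def shiftN {E : Type*} (ω : ℕ → E) : ℕ → E := fun n => ω (n + 1)

/-- The two-sided shift. -/
def shiftZ {A : Type*} (l : ℤ → A) : ℤ → A := fun n => l (n + 1)

/-- `φ_{ω₁}^l ∘ φ_{ω₂}^{θ l} ∘ ... ∘ φ_{ω_n}^{θ^(n-1) l}`. -/
def cylinderMap {Λ E : Type*} (θ : Λ → Λ) (φ : Λ → E → ℝ → ℝ) : ℕ → Λ → (ℕ → E) → ℝ → ℝ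
  | 0, _, _ => id
  | n + 1, l, ω => φ l (ω 0) ∘ cylinderMap θ φ n (θ l) (shiftN ω)

/-- The point `π_l(ω)`: the point of `⋂ n ≥ 1, φ_{ω|n}^l (X)`. -/
def codingMap {Λ E : Type*} (θ : Λ → Λ) (φ : Λ → E → ℝ → ℝ) (X : Set ℝ) (l : Λ)
    (ω : ℕ → E) : ℝ :=
  Classical.epsilon fun x => x ∈ ⋂ n : ℕ, cylinderMap θ φ (n + 1) l ω '' X

/-- The projection measure `μ_l ∘ π_l⁻¹`, with `(μ_l)` the disintegration of `μ` over `Λ`. -/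
def projMeasure {Λ E : Type*} [MeasurableSpace Λ] [MeasurableSpace E] [StandardBorelSpace E]
    [Nonempty E] (θ : Λ → Λ) (φ : Λ → E → ℝ → ℝ) (X : Set ℝ) (μ : Measure (Λ × (ℕ → E)))
    [IsFiniteMeasure μ] (l : Λ) : Measure ℝ :=
  (μ.condKernel l).map (codingMap θ φ X l)

/-- Random projectional entropy `h_μ(𝒮)`: with `ξ` the partition according to the first letter,
`H_μ(ξ | σ(l) ∨ (θ × σ)⁻¹ σ(π)) - H_μ(ξ | σ(l) ∨ σ(π))`. -/
def projEntropy {Λ E : Type*} [MeasurableSpace Λ] [MeasurableSpace E] [Fintype E]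
    (θ : Λ → Λ) (φ : Λ → E → ℝ → ℝ) (X : Set ℝ) (μ : Measure (Λ × (ℕ → E))) : ℝ :=
  condPartitionEntropy μ (fun x => x.2 0)
      (MeasurableSpace.comap (Prod.fst : Λ × (ℕ → E) → Λ) inferInstance ⊔
        MeasurableSpace.comap (fun x : Λ × (ℕ → E) => codingMap θ φ X (θ x.1) (shiftN x.2))
          (borel ℝ)) -
    condPartitionEntropy μ (fun x => x.2 0)
      (MeasurableSpace.comap (Prod.fst : Λ × (ℕ → E) → Λ) inferInstance ⊔
        MeasurableSpace.comap (fun x : Λ × (ℕ → E) => codingMap θ φ X x.1 x.2) (borel ℝ))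

/-- Lyapunov exponent `χ_μ`. -/
def lyapunovExponent {Λ E : Type*} [MeasurableSpace Λ] [MeasurableSpace E]
    (θ : Λ → Λ) (φ : Λ → E → ℝ → ℝ) (X : Set ℝ) (μ : Measure (Λ × (ℕ → E))) : ℝ :=
  ∫ x, -Real.log |deriv (φ x.1 (x.2 0)) (codingMap θ φ X (θ x.1) (shiftN x.2))| ∂μ

/-! The system `x ↦ r_{l₀} x ± 1`; the symbols `0, 1 : Fin 2` stand for `1, 2`. -/

/-- `φ_1^l (x) = r_{l₀} x + 1` and `φ_2^l (x) = r_{l₀} x - 1`. -/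
def affineMap (r : Fin 2 → ℝ) (l : ℤ → Fin 2) (e : Fin 2) (x : ℝ) : ℝ :=
  r (l 0) * x + (if e = 0 then 1 else -1)

/-- The Bernoulli measure on `A ^ I` with marginal `P`. -/
def bernoulliMeasure (I : Type*) {A : Type*} [MeasurableSpace A] (P : PMF A) :
    Measure (I → A) :=
  Measure.infinitePi fun _ : I => P.toMeasure

instance (I : Type*) {A : Type*} [MeasurableSpace A] (P : PMF A) :
    IsProbabilityMeasure (bernoulliMeasure I P) := by
  unfold bernoulliMeasure; infer_instance

/-! For uniformly contracting maps of a compact set the coding point is well defined. -/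

theorem mapsTo_cylinderMap {Λ E : Type*} {θ : Λ → Λ} {φ : Λ → E → ℝ → ℝ} {X : Set ℝ}
    (hm : ∀ l e, MapsTo (φ l e) X X) (n : ℕ) (l : Λ) (ω : ℕ → E) :
    MapsTo (cylinderMap θ φ n l ω) X X := by
  induction n generalizing l ω with
  | zero => exact mapsTo_id X
  | succ n ih => exact (hm _ _).comp (ih _ _)

theorem lipschitzOnWith_cylinderMap {Λ E : Type*} {θ : Λ → Λ} {φ : Λ → E → ℝ → ℝ} {X : Set ℝ}
    {s : ℝ≥0} (hm : ∀ l e, MapsTo (φ l e) X X) (hl : ∀ l e, LipschitzOnWith s (φ l e) X)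
    (n : ℕ) (l : Λ) (ω : ℕ → E) : LipschitzOnWith (s ^ n) (cylinderMap θ φ n l ω) X := by
  induction n generalizing l ω with
  | zero => simpa [cylinderMap] using (LipschitzWith.id.lipschitzOnWith (s := X))
  | succ n ih =>
    have := (hl l (ω 0)).comp (ih (θ l) (shiftN ω)) (mapsTo_cylinderMap hm n _ _)
    rw [pow_succ']
    exact this

theorem cylinderMap_succ_subset {Λ E : Type*} {θ : Λ → Λ} {φ : Λ → E → ℝ → ℝ} {X : Set ℝ}
    (hm : ∀ l e, MapsTo (φ l e) X X) (n : ℕ) (l : Λ) (ω : ℕ → E) :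
    cylinderMap θ φ (n + 1) l ω '' X ⊆ cylinderMap θ φ n l ω '' X := by
  induction n generalizing l ω with
  | zero =>
    simpa [cylinderMap] using (hm l (ω 0)).image_subset
  | succ n ih =>
    change (φ l (ω 0) ∘ cylinderMap θ φ (n + 1) (θ l) (shiftN ω)) '' X ⊆
      (φ l (ω 0) ∘ cylinderMap θ φ n (θ l) (shiftN ω)) '' X
    rw [image_comp, image_comp]
    exact image_mono (ih _ _)

theorem iInter_eq_singleton_codingMap {Λ E : Type*} {θ : Λ → Λ} {φ : Λ → E → ℝ → ℝ} {X : Set ℝ}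
    {s : ℝ≥0} (hs : s < 1) (hX : IsCompact X) (hne : X.Nonempty)
    (hm : ∀ l e, MapsTo (φ l e) X X) (hl : ∀ l e, LipschitzOnWith s (φ l e) X)
    (l : Λ) (ω : ℕ → E) :
    ⋂ n : ℕ, cylinderMap θ φ (n + 1) l ω '' X = {codingMap θ φ X l ω} := by
  have hc : ∀ n, IsCompact (cylinderMap θ φ (n + 1) l ω '' X) := fun n =>
    hX.image_of_continuousOn (lipschitzOnWith_cylinderMap hm hl _ l ω).continuousOn
  have h1 : (⋂ n : ℕ, cylinderMap θ φ (n + 1) l ω '' X).Nonempty :=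
    IsCompact.nonempty_iInter_of_sequence_nonempty_isCompact_isClosed _
      (fun n => cylinderMap_succ_subset hm (n + 1) l ω) (fun n => hne.image _) (hc 0)
      (fun n => (hc n).isClosed)
  have h2 : codingMap θ φ X l ω ∈ ⋂ n : ℕ, cylinderMap θ φ (n + 1) l ω '' X :=
    Classical.epsilon_spec (p := fun x => x ∈ ⋂ n : ℕ, cylinderMap θ φ (n + 1) l ω '' X) h1
  refine Subset.antisymm (fun x hx => ?_) (singleton_subset_iff.2 h2)
  rw [mem_singleton_iff, ← dist_le_zero]
  have hb : ∀ n : ℕ, dist x (codingMap θ φ X l ω) ≤ (s : ℝ) ^ (n + 1) * Metric.diam X := by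
    intro n
    obtain ⟨y, hy, hyx⟩ := mem_iInter.1 hx n
    obtain ⟨z, hz, hzx⟩ := mem_iInter.1 h2 n
    rw [← hyx, ← hzx]
    refine ((lipschitzOnWith_cylinderMap hm hl (n + 1) l ω).dist_le_mul y hy z hz).trans ?_
    push_cast
    gcongr
    exact Metric.dist_le_diam_of_mem hX.isBounded hy hz
  have ht : Tendsto (fun n : ℕ => (s : ℝ) ^ (n + 1) * Metric.diam X) atTop (𝓝 0) := by
    have := ((tendsto_add_atTop_iff_nat 1).2
      (tendsto_pow_atTop_nhds_zero_of_lt_one s.coe_nonneg (by exact_mod_cast hs))).mul_const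
        (Metric.diam X)
    simpa using this
  exact ge_of_tendsto' ht hb

end RandomIFS

end

/-! Since μ is a product, its conditional measures are ν_Q for almost every λ
(`ae_condKernel_prod`), so the measures in question are the laws of π_λ under ν_Q. Both maps at a
given parameter contract by the same ratio. Put R_n(λ) = (b - a) r_{λ_0} ⋯ r_{λ_{n-1}} and T = θ ×
σ. Among the sequences with first letter ω_1, those coded into the ball of radius R_{n+1}(λ) around
π_λ(ω) are exactly those whose tail is coded by π_{θλ} into the ball of radius R_n(θλ) around
π_{θλ}(σω), and the masses differ by the factor q_{ω_1} (`fibreLaw_headSet_closedBall`). Iterating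
down to radius b - a, where the mass is 1, expresses the logarithm of the mass of the n-th ball as a
Birkhoff sum of log q_{ω_1} plus ∑_{k<n} I_{n-k}(T^k x), where I_n is the information of the first
letter given that the coding point lies in the ball of radius R_n (`log_ballMass`).

Differentiation of measures shows that I_n converges almost everywhere to the conditional
information I given λ and π_λ(ω), and a Besicovitch weak type inequality (`exists_measure_ratio_le`)
makes sup_n I_n integrable. The summand changes along the orbit, so Birkhoff's theorem is not enough
and Maker's theorem (`tendsto_maker`) is used; the ergodicity of T that it needs comes from mixing
of the two shifts. Hence (1/n) log(mass) → ∫ I - H(Q). As ω_1 is independent of (λ, σω), the first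
conditional entropy in h_μ equals H(Q), so the limit is -h_μ. Also (1/n) log R_n → -χ_μ, and
interpolation between consecutive radii (`tendsto_log_div_log`) gives the pointwise dimension.

A constant pointwise dimension forces both dimensions of the measure, by mass distribution and
covering arguments (`hasDim_of_hasPointwiseDim`). The inequality holds because h_μ = H(Q) - ∫ I ≤
H(Q), while the Kolmogorov–Sinai entropies are H(P) and H(Q) (`ksEntropy_reindex`). -/

noncomputable section

namespace RandomIFS

/-! ### The pointwise ergodic theorem and Maker's theorem -/

section Ergodic

variable {Ω : Type*}

/-- The running maximum `max (0, S₁, ..., S_n)` of the Birkhoff sums of `g`. -/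
def birkhoffMax (T : Ω → Ω) (g : Ω → ℝ) : ℕ → Ω → ℝ
  | 0, _ => 0
  | n + 1, x => max 0 (g x + birkhoffMax T g n (T x))

theorem birkhoffSum_le_birkhoffMax (T : Ω → Ω) (g : Ω → ℝ) (n : ℕ) (x : Ω) :
    birkhoffSum T g n x ≤ birkhoffMax T g n x := by
  induction n generalizing x with
  | zero => simp [birkhoffMax]
  | succ n ih =>
    rw [birkhoffSum_succ']
    exact (add_le_add_right (ih (T x)) _).trans (le_max_right _ _)

theorem monotone_birkhoffMax (T : Ω → Ω) (g : Ω → ℝ) (x : Ω) :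
    Monotone fun n => birkhoffMax T g n x := by
  refine monotone_nat_of_le_succ fun n => ?_
  induction n generalizing x with
  | zero => exact le_max_left _ _
  | succ n ih => exact max_le_max le_rfl (add_le_add_right (ih (T x)) _)

variable [MeasurableSpace Ω] {μ : Measure Ω} {T : Ω → Ω}

theorem measurable_birkhoffMax (hT : Measurable T) {g : Ω → ℝ} (hg : Measurable g) (n : ℕ) :
    Measurable (birkhoffMax T g n) := by
  induction n with
  | zero => exact measurable_const
  | succ n ih => exact measurable_const.max (hg.add (ih.comp hT))

theorem integrable_birkhoffMax (hT : MeasurePreserving T μ μ) {g : Ω → ℝ} (hg : Integrable g μ)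
    (n : ℕ) : Integrable (birkhoffMax T g n) μ := by
  induction n with
  | zero => exact integrable_zero _ _ _
  | succ n ih => exact (integrable_zero _ _ _).sup (hg.add (hT.integrable_comp_of_integrable ih))

/-- If `∫ g < 0` then the Birkhoff sums of `g` are almost surely bounded above. -/
theorem ae_birkhoffSum_bddAbove_of_integral_neg (hT : Ergodic T μ)
    {g : Ω → ℝ} (hgm : Measurable g) (hg : Integrable g μ) (hneg : ∫ x, g x ∂μ < 0) :
    ∀ᵐ x ∂μ, ∃ C : ℝ, ∀ n, birkhoffSum T g n x ≤ C := by
  set M := birkhoffMax T g with hM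
  -- `D` is the invariant set where the running maxima are unbounded. The plan is to show ∫_D g ≥ 0;
  -- by ergodicity `D` is null or full, and full contradicts ∫ g < 0.
  set D : Set Ω := {x | ∀ k : ℕ, ∃ n, (k : ℝ) < M n x} with hD
  have hMm := measurable_birkhoffMax hT.measurable hgm
  have hDm : MeasurableSet D := by
    simp only [hD, ofPred_forall, ofPred_exists]
    exact .iInter fun k => .iUnion fun n => measurableSet_lt measurable_const (hMm n)
  have hDinv : T ⁻¹' D = D := by
    ext x
    constructor
    · intro hx k
      obtain ⟨j, hj⟩ := exists_nat_gt ((k : ℝ) - g x)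
      obtain ⟨n, hn⟩ := hx j
      exact ⟨n + 1, lt_max_of_lt_right (by linarith)⟩
    · intro hx k
      obtain ⟨j, hj⟩ := exists_nat_gt (max 0 (g x + k))
      obtain ⟨n, hn⟩ := hx j
      cases n with
      | zero =>
        have : (0 : ℝ) ≤ j := j.cast_nonneg
        exact absurd hn (not_lt.2 this)
      | succ n =>
        refine ⟨n, ?_⟩
        rcases lt_max_iff.1 (hj.trans hn) with h | h
        · exact absurd h (not_lt.2 (le_max_left _ _))
        · have := (le_max_right (0 : ℝ) (g x + k)).trans_lt h
          linarith
  have hMi := integrable_birkhoffMax hT.toMeasurePreserving hg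
  -- Invariance of `D` and of μ replaces `M n (T x)` by `M n x` under the integral; what remains is
  -- monotonicity in `n`.
  have hint : ∀ n, 0 ≤ ∫ x in D, (M (n + 1) x - M n (T x)) ∂μ := by
    intro n
    have h1 : Integrable (fun x => M n (T x)) μ :=
      hT.toMeasurePreserving.integrable_comp_of_integrable (hMi n)
    rw [integral_sub (hMi (n + 1)).integrableOn h1.integrableOn]
    have h2 : ∫ x in D, M n (T x) ∂μ = ∫ x in D, M n x ∂μ := by
      have := integral_map (μ := μ.restrict D) (φ := T) hT.measurable.aemeasurable
        (f := M n) (hMm n).aestronglyMeasurable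
      have h3 : (μ.restrict D).map T = μ.restrict D := by
        have := hT.toMeasurePreserving.restrict_preimage hDm
        rw [hDinv] at this
        exact this.map_eq
      rw [← this, h3]
    rw [h2, sub_nonneg]
    exact setIntegral_mono (hMi n).integrableOn (hMi (n + 1)).integrableOn
      fun x => monotone_birkhoffMax T g x n.le_succ
  have hlim : Tendsto (fun n => ∫ x in D, (M (n + 1) x - M n (T x)) ∂μ) atTop
      (𝓝 (∫ x in D, g x ∂μ)) := by
    -- The integrand is max(-M_n(Tx), g x). Since M_n ≥ 0, it is bounded by |g x|, and on `D` it
    -- eventually equals g x.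
    refine tendsto_integral_of_dominated_convergence (fun x => |g x|)
      (fun n => ((hMm (n + 1)).sub ((hMm n).comp hT.measurable)).aestronglyMeasurable)
      hg.abs.integrableOn (fun n => ae_of_all _ fun x => ?_) ?_
    · have h0 : 0 ≤ M n (T x) := monotone_birkhoffMax T g (T x) n.zero_le
      have h1 : M (n + 1) x = max 0 (g x + M n (T x)) := rfl
      rw [Real.norm_eq_abs, h1]
      rcases max_cases 0 (g x + M n (T x)) with ⟨h, h'⟩ | ⟨h, h'⟩
      · rw [h, abs_le]
        constructor <;> [skip; skip] <;> cases abs_cases (g x) <;> linarith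
      · rw [h]; simp
    · filter_upwards [ae_restrict_mem hDm] with x hx
      have hx' : T x ∈ D := by rw [← hDinv] at hx; exact hx
      obtain ⟨k, hk⟩ := exists_nat_gt (-g x)
      obtain ⟨n, hn⟩ := hx' k
      refine tendsto_const_nhds.congr' ?_
      filter_upwards [eventually_ge_atTop n] with m hm
      have h1 : M (m + 1) x = max 0 (g x + M m (T x)) := rfl
      have h2 : M n (T x) ≤ M m (T x) := monotone_birkhoffMax T g (T x) hm
      rw [h1, max_eq_right (by linarith)]
      ring
  have hnn : 0 ≤ ∫ x in D, g x ∂μ := ge_of_tendsto' hlim hint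
  have hD0 : μ D = 0 := by
    rcases hT.toPreErgodic.measure_self_or_compl_eq_zero hDm hDinv with h | h
    · exact h
    · rw [setIntegral_congr_set (ae_eq_univ.2 h), setIntegral_univ] at hnn
      linarith
  have : ∀ᵐ x ∂μ, x ∉ D := measure_eq_zero_iff_ae_notMem.1 hD0
  filter_upwards [this] with x hx
  simp only [hD, mem_ofPred_eq, not_forall, not_exists, not_lt] at hx
  obtain ⟨k, hk⟩ := hx
  exact ⟨k, fun n => (birkhoffSum_le_birkhoffMax T g n x).trans (hk n)⟩

/-- Subtracting slightly more than the mean makes the integral negative, so the modified sums are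
bounded above and disappear after division by n. The countable family of margins 1/(k+1) yields one
null set for all ε. -/
theorem ae_eventually_birkhoffAverage_le [IsProbabilityMeasure μ] (hT : Ergodic T μ) {g : Ω → ℝ}
    (hgm : Measurable g) (hg : Integrable g μ) :
    ∀ᵐ x ∂μ, ∀ ε > 0, ∀ᶠ n : ℕ in atTop, birkhoffSum T g n x / n ≤ ∫ y, g y ∂μ + ε := by
  set I := ∫ y, g y ∂μ with hI
  have h1 : ∀ k : ℕ, ∀ᵐ x ∂μ, ∃ C : ℝ, ∀ n,
      birkhoffSum T (fun y => g y - (I + 1 / (k + 1 : ℝ))) n x ≤ C := by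
    intro k
    refine ae_birkhoffSum_bddAbove_of_integral_neg hT (hgm.sub_const _)
      (hg.sub (integrable_const _)) ?_
    rw [integral_sub hg (integrable_const _)]
    simp only [integral_const, probReal_univ, smul_eq_mul, one_mul, ← hI]
    have : 0 < 1 / (k + 1 : ℝ) := by positivity
    linarith
  filter_upwards [ae_all_iff.2 h1] with x hx ε hε
  obtain ⟨k, hk⟩ := exists_nat_one_div_lt (half_pos hε)
  obtain ⟨C, hC⟩ := hx k
  have h2 : ∀ᶠ n : ℕ in atTop, C / n < ε / 2 :=
    (tendsto_const_div_atTop_nhds_zero_nat C).eventually (gt_mem_nhds (half_pos hε))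
  filter_upwards [h2, eventually_gt_atTop 0] with n hn hn0
  have hn1 : (0 : ℝ) < n := by exact_mod_cast hn0
  have h3 : birkhoffSum T (fun y => g y - (I + 1 / (k + 1 : ℝ))) n x =
      birkhoffSum T g n x - n * (I + 1 / (k + 1 : ℝ)) := by
    simp [birkhoffSum, Finset.sum_sub_distrib]
    ring
  have h4 := hC n
  rw [h3] at h4
  have h5 : birkhoffSum T g n x / n ≤ (C + n * (I + 1 / (k + 1 : ℝ))) / n := by
    gcongr; linarith
  have h6 : (C + n * (I + 1 / (k + 1 : ℝ))) / n = C / n + (I + 1 / (k + 1 : ℝ)) := by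
    field_simp
  linarith

/-- Birkhoff's pointwise ergodic theorem for ergodic transformations. -/
theorem tendsto_birkhoffSum_div [IsProbabilityMeasure μ] (hT : Ergodic T μ) {g : Ω → ℝ}
    (hgm : Measurable g) (hg : Integrable g μ) :
    ∀ᵐ x ∂μ, Tendsto (fun n : ℕ => birkhoffSum T g n x / n) atTop (𝓝 (∫ y, g y ∂μ)) := by
  filter_upwards [ae_eventually_birkhoffAverage_le hT hgm hg,
    ae_eventually_birkhoffAverage_le hT hgm.neg hg.neg] with x h1 h2
  rw [Metric.tendsto_atTop']
  intro ε hε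
  have := (h1 (ε / 2) (half_pos hε)).and (h2 (ε / 2) (half_pos hε))
  obtain ⟨N, hN⟩ := eventually_atTop.1 this
  refine ⟨N, fun n hn => ?_⟩
  obtain ⟨h3, h4⟩ := hN n hn.le
  rw [show birkhoffSum T (-g) n x = -birkhoffSum T g n x from by simp [birkhoffSum],
    show ∫ y, (-g) y ∂μ = -∫ y, g y ∂μ from integral_neg g, neg_div] at h4
  rw [Real.dist_eq, abs_lt]
  constructor <;> linarith

/-- Maker's ergodic theorem. -/
theorem tendsto_maker [IsProbabilityMeasure μ] (hT : Ergodic T μ) {g : ℕ → Ω → ℝ} {f G : Ω → ℝ}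
    (hgm : ∀ n, Measurable (g n)) (hfm : Measurable f) (hG : Integrable G μ)
    (hb : ∀ᵐ x ∂μ, ∀ n, |g n x| ≤ G x)
    (hlim : ∀ᵐ x ∂μ, Tendsto (fun n => g n x) atTop (𝓝 (f x))) :
    ∀ᵐ x ∂μ, Tendsto (fun n : ℕ => (∑ k ∈ Finset.range n, g (n - k) (T^[k] x)) / n) atTop
      (𝓝 (∫ y, f y ∂μ)) := by
  have hfb : ∀ᵐ x ∂μ, |f x| ≤ G x := by
    filter_upwards [hb, hlim] with x h1 h2
    exact le_of_tendsto' h2.abs h1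
  have hf : Integrable f μ := hG.mono' hfm.aestronglyMeasurable hfb
  -- `F N` bounds every error of index at least `N`, and its integral tends to 0 by dominated
  -- convergence.
  set F : ℕ → Ω → ℝ := fun N x => ⨆ m : ℕ, |g (N + m) x - f x| with hF
  have hbdd : ∀ᵐ x ∂μ, ∀ m, |g m x - f x| ≤ 2 * G x := by
    filter_upwards [hb, hfb] with x h1 h2 m
    have := abs_sub (g m x) (f x)
    have := h1 m
    linarith
  have hFm : ∀ N, Measurable (F N) := fun N => Measurable.iSup fun m => ((hgm _).sub hfm).abs
  have hF0 : ∀ N x, 0 ≤ F N x := fun N x => Real.iSup_nonneg fun _ => abs_nonneg _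
  have hFb : ∀ᵐ x ∂μ, ∀ N, F N x ≤ 2 * G x := by
    filter_upwards [hbdd] with x hx N
    exact ciSup_le fun m => hx _
  have hFi : ∀ N, Integrable (F N) μ := fun N =>
    (hG.const_mul 2).mono' (hFm N).aestronglyMeasurable (by
      filter_upwards [hFb] with x hx
      rw [Real.norm_eq_abs, abs_of_nonneg (hF0 N x)]
      exact hx N)
  have hFlim : Tendsto (fun N => ∫ x, F N x ∂μ) atTop (𝓝 0) := by
    rw [← integral_zero Ω ℝ (μ := μ)]
    refine tendsto_integral_of_dominated_convergence (fun x => 2 * G x)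
      (fun N => (hFm N).aestronglyMeasurable) (hG.const_mul 2) (fun N => ?_) ?_
    · filter_upwards [hFb] with x hx
      rw [Real.norm_eq_abs, abs_of_nonneg (hF0 N x)]
      exact hx N
    · filter_upwards [hlim] with x hx
      rw [Metric.tendsto_atTop] at hx ⊢
      intro ε hε
      obtain ⟨N, hN⟩ := hx (ε / 2) (half_pos hε)
      refine ⟨N, fun n hn => ?_⟩
      rw [Real.dist_eq, sub_zero, abs_of_nonneg (hF0 n x)]
      refine lt_of_le_of_lt (ciSup_le fun m => ?_) (half_lt_self hε)
      have := hN (n + m) (by omega)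
      rw [Real.dist_eq] at this
      exact this.le
  have horb : ∀ᵐ x ∂μ, ∀ k m, |g m (T^[k] x) - f (T^[k] x)| ≤ 2 * G (T^[k] x) :=
    ae_all_iff.2 fun k => (hT.toMeasurePreserving.iterate k).quasiMeasurePreserving.ae hbdd
  filter_upwards [tendsto_birkhoffSum_div hT hfm hf,
    ae_all_iff.2 fun N => tendsto_birkhoffSum_div hT (hFm N) (hFi N), horb] with x h1 h2 h3
  have hle : ∀ N k m, N ≤ m → |g m (T^[k] x) - f (T^[k] x)| ≤ F N (T^[k] x) := by
    intro N k m hm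
    obtain ⟨j, rfl⟩ := Nat.exists_eq_add_of_le hm
    refine le_ciSup (f := fun j => |g (N + j) (T^[k] x) - f (T^[k] x)|) ⟨2 * G (T^[k] x), ?_⟩ j
    rintro _ ⟨j, rfl⟩
    exact h3 k _
  -- The last `N` terms of the sum have small index n - k and are controlled only by `F 0`; their
  -- total is a difference of two Birkhoff sums of an integrable function, hence o(n).
  have htail : ∀ N : ℕ, Tendsto (fun n : ℕ => birkhoffSum T (F 0) n x / n -
      birkhoffSum T (F 0) (n - N) x / n) atTop (𝓝 0) := by
    intro N
    have h4 : Tendsto (fun n : ℕ => birkhoffSum T (F 0) (n - N) x / (n - N : ℕ) *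
        (((n - N : ℕ) : ℝ) / n)) atTop (𝓝 ((∫ y, F 0 y ∂μ) * 1)) := by
      refine ((h2 0).comp (tendsto_sub_atTop_nat N)).mul ?_
      have : Tendsto (fun n : ℕ => 1 - (N : ℝ) / n) atTop (𝓝 (1 - 0)) :=
        tendsto_const_nhds.sub (tendsto_const_div_atTop_nhds_zero_nat _)
      rw [sub_zero] at this
      refine this.congr' ?_
      filter_upwards [eventually_gt_atTop N] with n hn
      have : (0 : ℝ) < n := by exact_mod_cast (Nat.zero_le N).trans_lt hn
      rw [Nat.cast_sub hn.le]
      field_simp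
    have h5 := (h2 0).sub h4
    rw [mul_one, sub_self] at h5
    refine h5.congr' ?_
    filter_upwards [eventually_gt_atTop N] with n hn
    have : (0 : ℝ) < (n - N : ℕ) := by exact_mod_cast Nat.sub_pos_of_lt hn
    have : (0 : ℝ) < n := by exact_mod_cast (Nat.zero_le N).trans_lt hn
    field_simp
  have hmain : ∀ N n : ℕ, N ≤ n →
      |∑ k ∈ Finset.range n, g (n - k) (T^[k] x) - birkhoffSum T f n x| ≤
        birkhoffSum T (F N) n x +
          (birkhoffSum T (F 0) n x - birkhoffSum T (F 0) (n - N) x) := by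
    intro N n hNn
    rw [birkhoffSum, ← Finset.sum_sub_distrib]
    refine (Finset.abs_sum_le_sum_abs _ _).trans ?_
    have hn : n = (n - N) + N := by omega
    have h4 : birkhoffSum T (F 0) n x - birkhoffSum T (F 0) (n - N) x =
        ∑ k ∈ Finset.range N, F 0 (T^[n - N + k] x) := by
      conv_lhs => rw [hn]
      simp only [birkhoffSum, Finset.sum_range_add, Nat.add_sub_cancel]
      ring
    have h5 : birkhoffSum T (F N) n x = ∑ k ∈ Finset.range (n - N), F N (T^[k] x) +
        ∑ k ∈ Finset.range N, F N (T^[n - N + k] x) := by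
      conv_lhs => rw [hn]
      simp only [birkhoffSum, Finset.sum_range_add]
    have h6 : ∑ k ∈ Finset.range n, |g (n - k) (T^[k] x) - f (T^[k] x)| =
        ∑ k ∈ Finset.range (n - N), |g (n - k) (T^[k] x) - f (T^[k] x)| +
        ∑ k ∈ Finset.range N, |g (n - (n - N + k)) (T^[n - N + k] x) - f (T^[n - N + k] x)| := by
      rw [← Finset.sum_range_add, ← hn]
    rw [h4, h5, h6]
    have h7 : ∑ k ∈ Finset.range (n - N), |g (n - k) (T^[k] x) - f (T^[k] x)| ≤
        ∑ k ∈ Finset.range (n - N), F N (T^[k] x) :=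
      Finset.sum_le_sum fun k hk => hle N k _ (by have := Finset.mem_range.1 hk; omega)
    have h8 : ∑ k ∈ Finset.range N, |g (n - (n - N + k)) (T^[n - N + k] x) -
        f (T^[n - N + k] x)| ≤ ∑ k ∈ Finset.range N, F 0 (T^[n - N + k] x) :=
      Finset.sum_le_sum fun k hk => hle 0 _ _ (Nat.zero_le _)
    have h9 : 0 ≤ ∑ k ∈ Finset.range N, F N (T^[n - N + k] x) :=
      Finset.sum_nonneg fun k _ => hF0 _ _
    linarith
  have hdiff : Tendsto (fun n : ℕ => (∑ k ∈ Finset.range n, g (n - k) (T^[k] x)) / n -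
      birkhoffSum T f n x / n) atTop (𝓝 0) := by
    rw [Metric.tendsto_atTop']
    intro ε hε
    obtain ⟨N, hN⟩ := (hFlim.eventually (gt_mem_nhds (half_pos hε))).exists
    have h4 := ((h2 N).add (htail N)).eventually (gt_mem_nhds (by simpa using hN.trans (half_lt_self hε)))
    obtain ⟨n₀, hn₀⟩ := eventually_atTop.1 h4
    refine ⟨max n₀ N, fun n hn => ?_⟩
    have h5 := hn₀ n ((le_max_left _ _).trans hn.le)
    have h6 := hmain N n ((le_max_right _ _).trans hn.le)
    have hn1 : (0 : ℝ) < n := by exact_mod_cast (Nat.zero_le _).trans_lt hn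
    rw [dist_zero_right, Real.norm_eq_abs, ← sub_div, abs_div, abs_of_pos hn1]
    refine lt_of_le_of_lt (div_le_div_of_nonneg_right h6 hn1.le) ?_
    rwa [← sub_div, ← add_div] at h5
  simpa using hdiff.add h1

end Ergodic

/-! ### Bernoulli shifts are mixing -/

section Mixing

/-- `T` is (strongly) mixing for `μ`. -/
def IsMixing {Ω : Type*} [MeasurableSpace Ω] (μ : Measure Ω) (T : Ω → Ω) : Prop :=
  ∀ A B, MeasurableSet A → MeasurableSet B →
    Tendsto (fun n : ℕ => μ.real (A ∩ T^[n] ⁻¹' B)) atTop (𝓝 (μ.real A * μ.real B))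

/-- Setwise convergence of a dominated sequence of finite measures can be checked on a generating
`π`-system. -/
theorem tendsto_measureReal_of_isPiSystem {Ω : Type*} [mΩ : MeasurableSpace Ω] {C : Set (Set Ω)}
    (hgen : mΩ = MeasurableSpace.generateFrom C) (hpi : IsPiSystem C) {m : ℕ → Measure Ω}
    {m' κ : Measure Ω} [IsFiniteMeasure κ] [IsFiniteMeasure m'] (hle : ∀ n, m n ≤ κ)
    (huniv : Tendsto (fun n => (m n).real univ) atTop (𝓝 (m'.real univ)))
    (hC : ∀ A ∈ C, Tendsto (fun n => (m n).real A) atTop (𝓝 (m'.real A)))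
    {A : Set Ω} (hA : MeasurableSet A) :
    Tendsto (fun n => (m n).real A) atTop (𝓝 (m'.real A)) := by
  have hfin : ∀ n, IsFiniteMeasure (m n) := fun n => isFiniteMeasure_of_le κ (hle n)
  have hsum : ∀ (ν : Measure Ω) [IsFiniteMeasure ν] (f : ℕ → Set Ω), Pairwise (Function.onFun Disjoint f) →
      (∀ i, MeasurableSet (f i)) → ν.real (⋃ i, f i) = ∑' i, ν.real (f i) := by
    intro ν _ f hd hf
    simp only [Measure.real]
    rw [measure_iUnion hd hf, ENNReal.tsum_toReal_eq fun i => measure_ne_top _ _]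
  induction A, hA using MeasurableSpace.induction_on_inter hgen hpi with
  | empty => simp
  | basic t ht => exact hC t ht
  | compl t ht ih =>
    rw [measureReal_compl ht]
    simp_rw [measureReal_compl ht]
    exact huniv.sub ih
  | iUnion f hd hf ih =>
    rw [hsum m' f hd hf]
    simp_rw [fun n => hsum (m n) f hd hf]
    refine tendsto_tsum_of_dominated_convergence (bound := fun i => κ.real (f i)) ?_ ih ?_
    · refine ENNReal.summable_toReal ?_
      rw [← measure_iUnion hd hf]
      exact measure_ne_top _ _
    · refine Eventually.of_forall fun n i => ?_
      rw [Real.norm_eq_abs, abs_of_nonneg measureReal_nonneg]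
      exact ENNReal.toReal_mono (measure_ne_top _ _) (hle n _)

/-- Setwise convergence is extended in one variable at a time: first in A, for the measures μ
restricted to T^{-n}B, then in B, for the images under T^n of μ restricted to A. Both sequences are
dominated by μ, the second because μ is invariant. -/
theorem isMixing_of_isPiSystem {Ω : Type*} [mΩ : MeasurableSpace Ω] {μ : Measure Ω}
    [IsProbabilityMeasure μ] {T : Ω → Ω} (hT : MeasurePreserving T μ μ) {C : Set (Set Ω)}
    (hgen : mΩ = MeasurableSpace.generateFrom C) (hpi : IsPiSystem C)
    (hC : ∀ A ∈ C, ∀ B ∈ C,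
      Tendsto (fun n : ℕ => μ.real (A ∩ T^[n] ⁻¹' B)) atTop (𝓝 (μ.real A * μ.real B))) :
    IsMixing μ T := by
  have hCm : ∀ A ∈ C, MeasurableSet A := fun A hA => by
    rw [hgen]; exact MeasurableSpace.measurableSet_generateFrom hA
  have hpre : ∀ (n : ℕ) {B : Set Ω}, MeasurableSet B → μ.real (T^[n] ⁻¹' B) = μ.real B :=
    fun n B hB => by
      simp only [Measure.real, (hT.iterate n).measure_preimage hB.nullMeasurableSet]
  have h1 : ∀ B ∈ C, ∀ A, MeasurableSet A →
      Tendsto (fun n : ℕ => μ.real (A ∩ T^[n] ⁻¹' B)) atTop (𝓝 (μ.real A * μ.real B)) := by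
    intro B hB A hA
    have := Measure.smul_finite μ (measure_ne_top μ B)
    have := tendsto_measureReal_of_isPiSystem hgen hpi
      (m := fun n => μ.restrict (T^[n] ⁻¹' B)) (m' := (μ B) • μ) (κ := μ)
      (fun n => Measure.restrict_le_self) ?_ ?_ hA
    · simpa [Measure.real, Measure.restrict_apply hA, mul_comm] using this
    · simp only [measureReal_restrict_apply_univ, hpre _ (hCm B hB)]
      simp [measureReal_def]
    · intro A' hA'
      simpa [Measure.real, Measure.restrict_apply (hCm A' hA'), mul_comm] using hC A' hA' B hB
  intro A B hA hB
  have := Measure.smul_finite μ (measure_ne_top μ A)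
  have hmap : ∀ {B : Set Ω}, MeasurableSet B → ∀ n : ℕ,
      ((μ.restrict A).map T^[n]).real B = μ.real (A ∩ T^[n] ⁻¹' B) := fun {B} hB n => by
    rw [Measure.real, Measure.map_apply (hT.iterate n).measurable hB,
      Measure.restrict_apply ((hT.iterate n).measurable hB), inter_comm, Measure.real]
  have := tendsto_measureReal_of_isPiSystem hgen hpi
    (m := fun n => (μ.restrict A).map T^[n]) (m' := (μ A) • μ) (κ := μ)
    (fun n => ?_) ?_ ?_ hB
  · simpa [hmap hB, measureReal_def] using this
  · calc (μ.restrict A).map T^[n] ≤ μ.map T^[n] :=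
        Measure.map_mono Measure.restrict_le_self (hT.iterate n).measurable
      _ = μ := (hT.iterate n).map_eq
  · simp [hmap .univ, measureReal_def]
  · intro B' hB'
    simpa [hmap (hCm B' hB'), measureReal_def] using h1 B' hB' A hA

/-- Mixing of an invariant set with itself gives μ(s) = μ(s)². -/
theorem IsMixing.ergodic {Ω : Type*} [MeasurableSpace Ω] {μ : Measure Ω}
    [IsProbabilityMeasure μ] {T : Ω → Ω} (hT : MeasurePreserving T μ μ) (h : IsMixing μ T) :
    Ergodic T μ := by
  refine ⟨hT, ⟨fun {s} hs hinv => ?_⟩⟩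
  have hn : ∀ n : ℕ, T^[n] ⁻¹' s = s := by
    intro n
    induction n with
    | zero => rfl
    | succ n ih => rw [Function.iterate_succ, preimage_comp, ih, hinv]
  have h1 := h s s hs hs
  simp only [hn, inter_self] at h1
  have h2 : μ.real s = μ.real s * μ.real s := tendsto_nhds_unique tendsto_const_nhds h1
  have h3 : μ.real s * (1 - μ.real s) = 0 := by linarith
  rw [eventuallyConst_set']
  rcases mul_eq_zero.1 h3 with h4 | h4
  · left
    rw [ae_eq_empty]
    exact (measureReal_eq_zero_iff).1 h4
  · right
    rw [ae_eq_univ, ← measureReal_eq_zero_iff, measureReal_compl hs, probReal_univ, h4]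

/-- The correlations factor on rectangles. This is the reason for passing through mixing: ergodicity
alone is not inherited by products. -/
theorem IsMixing.prod {Ω Ω' : Type*} [MeasurableSpace Ω] [MeasurableSpace Ω'] {μ : Measure Ω}
    {ν : Measure Ω'} [IsProbabilityMeasure μ] [IsProbabilityMeasure ν] {T : Ω → Ω} {S : Ω' → Ω'}
    (hT : MeasurePreserving T μ μ) (hS : MeasurePreserving S ν ν)
    (h : IsMixing μ T) (h' : IsMixing ν S) : IsMixing (μ.prod ν) (Prod.map T S) := by
  refine isMixing_of_isPiSystem (hT.prod hS) generateFrom_prod.symm isPiSystem_prod ?_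
  rintro _ ⟨A, hA, A', hA', rfl⟩ _ ⟨B, hB, B', hB', rfl⟩
  simp only [Prod.map_iterate, measureReal_prod_prod]
  have h1 : ∀ n, Prod.map T^[n] S^[n] ⁻¹' B ×ˢ B' = (T^[n] ⁻¹' B) ×ˢ (S^[n] ⁻¹' B') :=
    fun n => rfl
  simp only [h1, prod_inter_prod, measureReal_prod_prod]
  convert (h A B hA hB).mul (h' A' B' hA' hB') using 2
  ring

variable {I A : Type*} [MeasurableSpace A] (P : PMF A)

theorem iterate_reindex {I A : Type*} (τ : I → I) (n : ℕ) (x : I → A) :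
    (fun (y : I → A) i => y (τ i))^[n] x = fun i => x (τ^[n] i) := by
  induction n generalizing x with
  | zero => rfl
  | succ n ih => simp only [Function.iterate_succ_apply, ih, ← Function.iterate_succ_apply']

theorem measurePreserving_reindex {J : Type*} {τ : J → I} (hτ : Function.Injective τ) :
    MeasurePreserving (fun (x : I → A) j => x (τ j)) (bernoulliMeasure I P)
      (bernoulliMeasure J P) :=
  ⟨by fun_prop, Measure.map_infinitePi_infinitePi_of_inj (P := fun _ : I => P.toMeasure) hτ⟩

/-- Once the two windows of coordinates are disjoint, the cylinders are exactly independent, so the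
correlations are eventually constant. The disjoint windows are encoded as one injection of `S ⊕ S'`
into `I`. -/
theorem isMixing_reindex {τ : I → I} (hτ : Function.Injective τ)
    (hfar : ∀ S S' : Finset I, ∀ᶠ n : ℕ in atTop, ∀ i ∈ S, ∀ j ∈ S', i ≠ τ^[n] j) :
    IsMixing (bernoulliMeasure I P) (fun x i => x (τ i)) := by
  refine isMixing_of_isPiSystem (measurePreserving_reindex P hτ)
    generateFrom_squareCylinders.symm
    (isPiSystem_squareCylinders (fun _ => MeasurableSpace.isPiSystem_measurableSet) fun _ => MeasurableSet.univ) ?_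
  rintro _ ⟨S, t, ht, rfl⟩ _ ⟨S', t', ht', rfl⟩
  simp only [Set.mem_pi, mem_univ, forall_true_left, mem_ofPred_eq] at ht ht'
  refine tendsto_const_nhds.congr' ?_
  filter_upwards [hfar S S'] with n hn
  let g : S ⊕ S' → I := Sum.elim (fun i => i) fun j => τ^[n] j
  have hg : Function.Injective g := by
    rintro (i | i) (j | j) hij
    · exact congrArg _ (Subtype.ext hij)
    · exact absurd hij (hn i i.2 j j.2)
    · exact absurd hij.symm (hn j j.2 i i.2)
    · exact congrArg _ (Subtype.ext (hτ.iterate n hij))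
  let u : S ⊕ S' → Set A := Sum.elim (fun i => t i) fun j => t' j
  have hu : ∀ j, MeasurableSet (u j) := by
    rintro (i | i)
    · exact ht _
    · exact ht' _
  have h1 : (S : Set I).pi t ∩ (fun (x : I → A) i => x (τ i))^[n] ⁻¹' (S' : Set I).pi t' =
      (fun (x : I → A) j => x (g j)) ⁻¹' ((Finset.univ : Finset (S ⊕ S')) : Set (S ⊕ S')).pi u := by
    ext x
    simp only [mem_inter_iff, mem_preimage, iterate_reindex, Set.mem_pi, Finset.coe_univ, mem_univ,
      forall_true_left, Sum.forall, g, u, Sum.elim_inl, Sum.elim_inr, Subtype.forall,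
      Finset.mem_coe]
  have h2 : MeasurableSet (((Finset.univ : Finset (S ⊕ S')) : Set (S ⊕ S')).pi u) :=
    MeasurableSet.pi (Finset.countable_toSet _) fun j _ => hu j
  simp only [Measure.real]
  rw [h1, (measurePreserving_reindex P hg).measure_preimage h2.nullMeasurableSet,
    bernoulliMeasure, bernoulliMeasure, Measure.infinitePi_pi _ fun i _ => hu i,
    Measure.infinitePi_pi _ fun i _ => ht i,
    Measure.infinitePi_pi _ fun i _ => ht' i, Fintype.prod_sum_type, ENNReal.toReal_mul]
  simp only [u, Sum.elim_inl, Sum.elim_inr]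
  rw [Finset.prod_coe_sort S fun i => P.toMeasure (t i),
    Finset.prod_coe_sort S' fun i => P.toMeasure (t' i)]

theorem measurePreserving_shiftZ :
    MeasurePreserving shiftZ (bernoulliMeasure ℤ P) (bernoulliMeasure ℤ P) :=
  measurePreserving_reindex P (add_left_injective 1)

theorem measurePreserving_shiftN :
    MeasurePreserving shiftN (bernoulliMeasure ℕ P) (bernoulliMeasure ℕ P) :=
  measurePreserving_reindex P (add_left_injective 1)

theorem isMixing_shiftZ : IsMixing (bernoulliMeasure ℤ P) shiftZ := by
  refine isMixing_reindex P (add_left_injective 1) fun S S' => ?_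
  obtain ⟨a, ha⟩ := S.bddAbove
  obtain ⟨b, hb⟩ := S'.bddBelow
  filter_upwards [eventually_gt_atTop (a - b).toNat] with n hn i hi j hj h
  have h1 := ha hi
  have h2 := hb hj
  simp only [add_right_iterate] at h
  simp at h
  omega

theorem isMixing_shiftN : IsMixing (bernoulliMeasure ℕ P) shiftN := by
  refine isMixing_reindex P (add_left_injective 1) fun S S' => ?_
  obtain ⟨a, ha⟩ := S.bddAbove
  filter_upwards [eventually_gt_atTop a] with n hn i hi j hj h
  have h1 := ha hi
  simp only [add_right_iterate] at h
  simp at h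
  omega

theorem ergodic_shiftZ_prod_shiftN (Q : PMF A) :
    Ergodic (Prod.map shiftZ shiftN) ((bernoulliMeasure ℤ P).prod (bernoulliMeasure ℕ Q)) :=
  IsMixing.ergodic ((measurePreserving_shiftZ P).prod (measurePreserving_shiftN Q))
    (IsMixing.prod (measurePreserving_shiftZ P) (measurePreserving_shiftN Q) (isMixing_shiftZ P)
      (isMixing_shiftN Q))

/-- The first letter and the shifted sequence are independent. -/
theorem map_head_shiftN_bernoulliMeasure :
    (bernoulliMeasure ℕ P).map (fun ω => (ω 0, shiftN ω)) =
      P.toMeasure.prod (bernoulliMeasure ℕ P) := by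
  let c : A × (ℕ → A) → ℕ → A := fun y n => Nat.casesOn n y.1 y.2
  have hc : Measurable c := by
    refine measurable_pi_lambda _ fun n => ?_
    cases n with
    | zero => exact measurable_fst
    | succ n => exact (measurable_pi_apply n).comp measurable_snd
  have h : (P.toMeasure.prod (bernoulliMeasure ℕ P)).map c = bernoulliMeasure ℕ P := by
    refine Measure.eq_infinitePi _ fun s t ht => ?_
    obtain ⟨N, hN⟩ := s.exists_nat_subset_range
    classical
    -- Padding with `univ` turns the box into one over an initial segment, which splits into a
    -- condition on the head and a box for the tail.
    let u : ℕ → Set A := fun i => if i ∈ s then t i else univ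
    have hu : ∀ i, MeasurableSet (u i) := fun i => by
      simp only [u]; split_ifs <;> simp [ht]
    have h1 : (s : Set ℕ).pi t = ((Finset.range (N + 1) : Finset ℕ) : Set ℕ).pi u := by
      ext x
      simp only [Set.mem_pi, Finset.mem_coe, u]
      constructor
      · intro h i _
        split_ifs with hi
        · exact h i hi
        · trivial
      · intro h i hi
        have := h i (Finset.range_mono N.le_succ (hN hi))
        simpa [hi] using this
    have h2 : ∏ i ∈ s, P.toMeasure (t i) = ∏ i ∈ Finset.range (N + 1), P.toMeasure (u i) := by
      rw [← Finset.prod_subset (hN.trans (Finset.range_mono N.le_succ))]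
      · exact Finset.prod_congr rfl fun i hi => by simp [u, hi]
      · intro i _ hi
        simp [u, hi]
    have h3 : c ⁻¹' ((Finset.range (N + 1) : Finset ℕ) : Set ℕ).pi u =
        u 0 ×ˢ ((Finset.range N : Finset ℕ) : Set ℕ).pi fun i => u (i + 1) := by
      ext ⟨e, x⟩
      simp only [mem_preimage, Set.mem_pi, Finset.mem_coe, Finset.mem_range, mem_prod, c]
      constructor
      · exact fun h => ⟨h 0 N.succ_pos, fun i hi => h (i + 1) (by omega)⟩
      · rintro ⟨h, h'⟩ i hi
        cases i with
        | zero => exact h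
        | succ i => exact h' i (by omega)
    rw [h1, h2, Measure.map_apply hc (MeasurableSet.pi (Finset.countable_toSet _) fun j _ => hu j),
      h3, Measure.prod_prod, bernoulliMeasure, Measure.infinitePi_pi _ fun i _ => hu (i + 1),
      Finset.prod_range_succ', mul_comm]
  have hm : Measurable fun ω : ℕ → A => (ω 0, shiftN ω) :=
    (measurable_pi_apply 0).prodMk (measurePreserving_shiftN P).measurable
  conv_lhs => rw [← h]
  rw [Measure.map_map hm hc]
  exact Measure.map_id

end Mixing

/-! ### Entropy of Bernoulli shifts -/

section Entropy

theorem integral_comp_eq_sum {Ω ι : Type*} [MeasurableSpace Ω] [Fintype ι] [MeasurableSpace ι]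
    [MeasurableSingletonClass ι] (μ : Measure Ω) [IsFiniteMeasure μ] {f : Ω → ι}
    (hf : Measurable f) (g : ι → ℝ) :
    ∫ x, g (f x) ∂μ = ∑ i, μ.real (f ⁻¹' {i}) * g i := by
  rw [← integral_map (f := g) hf.aemeasurable (Measurable.of_discrete).aestronglyMeasurable,
    integral_fintype .of_finite]
  simp [map_measureReal_apply hf (measurableSet_singleton _)]

/-- Gibbs' inequality. -/
theorem sum_negMulLog_le {ι : Type*} [Fintype ι] {p w : ι → ℝ} (hp : ∀ i, 0 ≤ p i)
    (hw : ∀ i, 0 ≤ w i) (hp1 : ∑ i, p i = 1) (hw1 : ∑ i, w i ≤ 1)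
    (hpw : ∀ i, 0 < p i → 0 < w i) :
    ∑ i, Real.negMulLog (p i) ≤ ∑ i, p i * -Real.log (w i) := by
  have h : ∀ i, Real.negMulLog (p i) ≤ p i * -Real.log (w i) + (w i - p i) := by
    intro i
    rcases (hp i).eq_or_lt with h0 | h0
    · simp [← h0, hw i]
    · have h1 := hpw i h0
      have h2 := Real.log_le_sub_one_of_pos (div_pos h1 h0)
      rw [Real.log_div h1.ne' h0.ne'] at h2
      have h3 := mul_le_mul_of_nonneg_left h2 h0.le
      have h4 : p i * (w i / p i - 1) = w i - p i := by field_simp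
      rw [Real.negMulLog]
      linarith
  calc ∑ i, Real.negMulLog (p i) ≤ ∑ i, (p i * -Real.log (w i) + (w i - p i)) :=
        Finset.sum_le_sum fun i _ => h i
    _ ≤ ∑ i, p i * -Real.log (w i) := by
        rw [Finset.sum_add_distrib, Finset.sum_sub_distrib, hp1]
        linarith

theorem sum_measureReal_fibre {Ω ι : Type*} [MeasurableSpace Ω] [Fintype ι] [MeasurableSpace ι]
    [MeasurableSingletonClass ι] (μ : Measure Ω) [IsProbabilityMeasure μ] {f : Ω → ι}
    (hf : Measurable f) : ∑ i, μ.real (f ⁻¹' {i}) = 1 := by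
  simpa using (integral_comp_eq_sum μ hf fun _ => (1 : ℝ)).symm

/-- The entropy of a partition is at most its cross entropy relative to any subprobability. -/
theorem partitionEntropy_le_integral {Ω ι : Type*} [MeasurableSpace Ω] [Fintype ι]
    [MeasurableSpace ι] [MeasurableSingletonClass ι] (μ : Measure Ω) [IsProbabilityMeasure μ]
    {f : Ω → ι} (hf : Measurable f) {w : ι → ℝ} (hw : ∀ i, 0 ≤ w i) (hw1 : ∑ i, w i ≤ 1)
    (hpos : ∀ᵐ x ∂μ, 0 < w (f x)) :
    partitionEntropy μ f ≤ ∫ x, -Real.log (w (f x)) ∂μ := by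
  rw [integral_comp_eq_sum μ hf fun i => -Real.log (w i)]
  refine sum_negMulLog_le (fun i => measureReal_nonneg) hw (sum_measureReal_fibre μ hf) hw1 ?_
  intro i hi
  by_contra h
  refine hi.ne' ((measureReal_eq_zero_iff (by finiteness)).2 (measure_mono_null ?_ hpos))
  rintro x rfl
  exact h

theorem partitionEntropy_eq_integral {Ω ι : Type*} [MeasurableSpace Ω] [Fintype ι]
    [MeasurableSpace ι] [MeasurableSingletonClass ι] (μ : Measure Ω) [IsProbabilityMeasure μ]
    {f : Ω → ι} (hf : Measurable f) :
    partitionEntropy μ f = ∫ x, -Real.log (μ.real (f ⁻¹' {f x})) ∂μ := by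
  rw [integral_comp_eq_sum μ hf fun i => -Real.log (μ.real (f ⁻¹' {i}))]
  refine Finset.sum_congr rfl fun i _ => ?_
  rw [Real.negMulLog]
  ring

variable {d : ℕ} (P : PMF (Fin d)) {I : Type*}

theorem measurePreserving_eval_bernoulliMeasure {A : Type*} [MeasurableSpace A] (P : PMF A)
    (i : I) : MeasurePreserving (fun x : I → A => x i) (bernoulliMeasure I P) P.toMeasure :=
  measurePreserving_eval_infinitePi (fun _ : I => P.toMeasure) i

theorem ae_bernoulliMeasure_pos (i : I) : ∀ᵐ x ∂bernoulliMeasure I P, 0 < (P (x i)).toReal := by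
  refine (measurePreserving_eval_bernoulliMeasure P i).quasiMeasurePreserving.ae
    (p := fun a => 0 < (P a).toReal) ?_
  rw [ae_iff_of_countable]
  intro a ha
  rw [PMF.toMeasure_apply_singleton _ _ (measurableSet_singleton _)] at ha
  exact ENNReal.toReal_pos ha (P.apply_ne_top a)

theorem measureReal_eval_bernoulliMeasure (i : I) (a : Fin d) :
    (bernoulliMeasure I P).real ((fun x : I → Fin d => x i) ⁻¹' {a}) = (P a).toReal := by
  rw [(measurePreserving_eval_bernoulliMeasure P i).measureReal_preimage
    (measurableSet_singleton _).nullMeasurableSet, measureReal_def,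
    PMF.toMeasure_apply_singleton _ _ (measurableSet_singleton _)]

theorem integral_eval_bernoulliMeasure (i : I) (g : Fin d → ℝ) :
    ∫ x, g (x i) ∂bernoulliMeasure I P = ∑ a, (P a).toReal * g a := by
  rw [integral_comp_eq_sum _ (f := fun x : I → Fin d => x i) (measurable_pi_apply i) g]
  simp_rw [measureReal_eval_bernoulliMeasure]

theorem integrable_eval_bernoulliMeasure (i : I) (g : Fin d → ℝ) :
    Integrable (fun x => g (x i)) (bernoulliMeasure I P) :=
  (measurePreserving_eval_bernoulliMeasure P i).integrable_comp_of_integrable .of_finite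

theorem integral_neg_log_bernoulliMeasure (i : I) :
    ∫ x, -Real.log (P (x i)).toReal ∂bernoulliMeasure I P =
      ∑ a, Real.negMulLog (P a).toReal := by
  rw [integral_eval_bernoulliMeasure P i fun a => -Real.log (P a).toReal]
  refine Finset.sum_congr rfl fun a _ => ?_
  rw [Real.negMulLog]
  ring

/-- Entropy of finitely many coordinates. -/
theorem partitionEntropy_coordinates {n : ℕ} {g : Fin n → I} (hg : Function.Injective g) :
    partitionEntropy (bernoulliMeasure I P) (fun x j => x (g j)) =
      n * ∑ a, Real.negMulLog (P a).toReal := by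
  have hf : Measurable fun (x : I → Fin d) j => x (g j) := by fun_prop
  rw [partitionEntropy_eq_integral _ hf]
  have h : ∀ v : Fin n → Fin d, (bernoulliMeasure I P).real ((fun x j => x (g j)) ⁻¹' {v}) =
      ∏ j, (P (v j)).toReal := by
    intro v
    rw [(measurePreserving_reindex P hg).measureReal_preimage
      (measurableSet_singleton _).nullMeasurableSet, measureReal_def, bernoulliMeasure,
      ← Set.univ_pi_singleton, ← Finset.coe_univ,
      Measure.infinitePi_pi _ fun i _ => measurableSet_singleton _, ENNReal.toReal_prod]
    simp
  simp_rw [h]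
  have h2 : ∫ x, -Real.log (∏ j, (P (x (g j))).toReal) ∂bernoulliMeasure I P =
      ∫ x, ∑ j, -Real.log (P (x (g j))).toReal ∂bernoulliMeasure I P := by
    refine integral_congr_ae ?_
    filter_upwards [ae_all_iff.2 fun j => ae_bernoulliMeasure_pos P (g j)] with x hx
    rw [Real.log_prod fun j _ => (hx j).ne', Finset.sum_neg_distrib]
  rw [h2, integral_finsetSum _ fun j _ =>
    integrable_eval_bernoulliMeasure P (g j) fun a => -Real.log (P a).toReal]
  simp [integral_neg_log_bernoulliMeasure]

/-- Approximation of a finite labelling by one that depends on finitely many coordinates. -/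
theorem exists_dependsOn_measure_ne_le {X : I → Type*} [∀ i, MeasurableSpace (X i)]
    (μ : Measure (∀ i, X i)) [IsProbabilityMeasure μ] {k : ℕ} {f : (∀ i, X i) → Fin k}
    (hf : Measurable f) {δ : ℝ} (hδ : 0 < δ) :
    ∃ (S : Finset I) (g : (∀ i, X i) → Fin k), Measurable g ∧ DependsOn g (S : Set I) ∧
      μ.real {x | f x ≠ g x} ≤ δ := by
  classical
  obtain ⟨x₀⟩ : Nonempty (∀ i, X i) := nonempty_of_isProbabilityMeasure μ
  have hk : 0 < k := (Nat.zero_le _).trans_lt (f x₀).2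
  have happ : ∀ i : Fin k, ∃ t ∈ measurableCylinders X,
      μ (symmDiff t (f ⁻¹' {i})) < ENNReal.ofReal (δ / k) := fun i =>
    exists_measure_symmDiff_lt_of_generateFrom_isSetRing isSetRing_measurableCylinders
      ⟨{univ}, countable_singleton _, singleton_subset_iff.2 (univ_mem_measurableCylinders X),
        by simp⟩
      generateFrom_measurableCylinders.symm (hf (measurableSet_singleton i))
      (by simp; positivity)
  choose C hC hCδ using happ
  choose s T hT hCs using fun i => (mem_measurableCylinders (C i)).1 (hC i)
  -- Off the symmetric differences exactly one cylinder contains the point, so the choice is forced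
  -- there; elsewhere any value will do.
  let G : (Fin k → Prop) → Fin k := fun v => if h : ∃ i, v i then h.choose else f x₀
  let g : (∀ i, X i) → Fin k := fun x => G fun i => x ∈ C i
  refine ⟨Finset.univ.biUnion s, g, ?_, ?_, ?_⟩
  · refine (Measurable.of_discrete (f := G)).comp (measurable_pi_lambda _ fun i => ?_)
    exact measurableSet_setOfPred.1 (MeasurableSet.of_mem_measurableCylinders (hC i))
  · intro x y hxy
    refine congrArg G (funext fun i => ?_)
    have : (s i).restrict x = (s i).restrict y := funext fun j =>
      hxy j (by simp only [Finset.coe_biUnion, mem_iUnion]; exact ⟨i, by simp, j.2⟩)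
    rw [hCs i, mem_cylinder, mem_cylinder, this]
  · have hsub : {x | f x ≠ g x} ⊆ ⋃ i, symmDiff (C i) (f ⁻¹' {i}) := by
      intro x hx
      by_contra hcon
      simp only [mem_iUnion, not_exists] at hcon
      have h1 : ∀ i, x ∈ C i ↔ f x = i := by
        intro i
        have := hcon i
        simp only [mem_symmDiff, mem_preimage, mem_singleton_iff] at this
        tauto
      have h2 : ∃ i, x ∈ C i := ⟨f x, (h1 _).2 rfl⟩
      refine hx ?_
      have h3 : g x = h2.choose := dif_pos h2
      rw [h3]
      exact (h1 _).1 h2.choose_spec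
    have h4 : μ {x | f x ≠ g x} ≤ ENNReal.ofReal δ :=
      calc μ {x | f x ≠ g x} ≤ ∑ i, μ (symmDiff (C i) (f ⁻¹' {i})) :=
            (measure_mono hsub).trans (measure_iUnion_fintype_le _ _)
        _ ≤ ∑ _i : Fin k, ENNReal.ofReal (δ / k) := Finset.sum_le_sum fun i _ => (hCδ i).le
        _ = ENNReal.ofReal δ := by
            rw [Finset.sum_const, Finset.card_univ, Fintype.card_fin, nsmul_eq_mul,
              ← ENNReal.ofReal_natCast, ← ENNReal.ofReal_mul (by positivity)]
            congr 1
            field_simp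
    exact ENNReal.toReal_le_of_le_ofReal hδ.le h4

/-- Iterated partitions of a Bernoulli shift have entropy at most that of a window of coordinates,
up to an error due to the approximation of the partition by cylinders. -/
theorem partitionEntropy_iterate_le {τ : I → I} (hτ : Function.Injective τ) {k : ℕ}
    {f g : (I → Fin d) → Fin k} (hf : Measurable f) (hg : Measurable g) {S : Finset I}
    (hgS : DependsOn g (S : Set I)) {ε δ : ℝ} (hε : 0 < ε) (hε1 : ε < 1)
    (hδ : (bernoulliMeasure I P).real {x | f x ≠ g x} ≤ δ) {n : ℕ} {W : Finset I}
    (hW : ∀ j < n, ∀ i ∈ S, τ^[j] i ∈ W) :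
    partitionEntropy (bernoulliMeasure I P)
        (fun x (j : Fin n) => f ((fun (y : I → Fin d) i => y (τ i))^[j] x)) ≤
      W.card * ∑ a, Real.negMulLog (P a).toReal +
        n * (-Real.log (1 - ε) + δ * Real.log (k / ε)) := by
  classical
  set μ := bernoulliMeasure I P with hμ
  set T : (I → Fin d) → I → Fin d := fun y i => y (τ i) with hTdef
  have hT : MeasurePreserving T μ μ := measurePreserving_reindex P hτ
  obtain ⟨a₀, -⟩ := P.support_nonempty
  obtain ⟨x₀⟩ : Nonempty (I → Fin d) := ⟨fun _ => a₀⟩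
  have hk : (0 : ℝ) < k := by exact_mod_cast (Nat.zero_le _).trans_lt (f x₀).2
  have hk1 : (1 : ℝ) ≤ k := by exact_mod_cast (Nat.zero_le _).trans_lt (f x₀).2
  have hlogk : 0 ≤ Real.log (k / ε) :=
    Real.log_nonneg (by rw [le_div_iff₀ hε]; linarith)
  -- A noisy channel that keeps a label with weight 1 - ε. Off-diagonal weights are positive, so
  -- that disagreement of `f` and `g` costs only log(k/ε).
  let K : Fin k → Fin k → ℝ := fun a b => if b = a then 1 - ε else ε / k
  have hK : ∀ a b, 0 < K a b := fun a b => by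
    simp only [K]; split_ifs
    · linarith
    · positivity
  have hK1 : ∀ a, ∑ b, K a b ≤ 1 := by
    intro a
    have h1 : ∀ b, K a b ≤ (if b = a then 1 - ε else 0) + ε / k := fun b => by
      simp only [K]; split_ifs
      · have : 0 < ε / k := by positivity
        linarith
      · linarith
    calc ∑ b, K a b ≤ ∑ b, ((if b = a then 1 - ε else 0) + ε / k) :=
          Finset.sum_le_sum fun b _ => h1 b
      _ = 1 := by
          rw [Finset.sum_add_distrib, Finset.sum_ite_eq' Finset.univ a]
          simp
          field_simp
          ring
  -- The filler `a₀` is never seen: the labels of `g` up to time n depend only on coordinates in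
  -- `W`.
  let ext : (W → Fin d) → I → Fin d := fun z i => if h : i ∈ W then z ⟨i, h⟩ else a₀
  -- The reference weights for Gibbs' inequality: draw the coordinates in `W` from `P`, read the
  -- `g`-itinerary, and pass each label independently through `K`. The cross entropy is then bounded
  -- by keeping the single summand of the actual point.
  let w : (Fin n → Fin k) → ℝ := fun v =>
    ∑ z : W → Fin d, (∏ i, (P (z i)).toReal) * ∏ j : Fin n, K (g (T^[j] (ext z))) (v j)
  have hterm : ∀ (v : Fin n → Fin k) (z : W → Fin d), 0 ≤ (∏ i : W, (P (z i)).toReal) *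
      ∏ j : Fin n, K (g (T^[j] (ext z))) (v j) := fun v z =>
    mul_nonneg (Finset.prod_nonneg fun i _ => ENNReal.toReal_nonneg)
      (Finset.prod_nonneg fun j _ => (hK _ _).le)
  have hw0 : ∀ v, 0 ≤ w v := fun v => Finset.sum_nonneg fun z _ => hterm v z
  have hw1 : ∑ v, w v ≤ 1 := by
    have hP1 : ∑ a, (P a).toReal = 1 := by
      rw [← ENNReal.toReal_sum fun a _ => P.apply_ne_top a, show ∑ a, P a = 1 by
        simpa [tsum_fintype] using P.tsum_coe, ENNReal.toReal_one]
    calc ∑ v, w v = ∑ z : W → Fin d, (∏ i, (P (z i)).toReal) *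
          ∑ v : Fin n → Fin k, ∏ j : Fin n, K (g (T^[j] (ext z))) (v j) := by
          simp only [w]
          rw [Finset.sum_comm]
          simp only [Finset.mul_sum]
      _ ≤ ∑ z : W → Fin d, ∏ i, (P (z i)).toReal := by
          refine Finset.sum_le_sum fun z _ => ?_
          refine mul_le_of_le_one_right (Finset.prod_nonneg fun i _ => ENNReal.toReal_nonneg) ?_
          have := Finset.prod_univ_sum (fun _ : Fin n => (Finset.univ : Finset (Fin k)))
            fun j b => K (g (T^[j] (ext z))) b
          rw [Fintype.piFinset_univ] at this
          rw [← this]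
          exact Finset.prod_le_one (fun j _ => Finset.sum_nonneg fun b _ => (hK _ _).le)
            fun j _ => hK1 _
      _ = 1 := by
          have := Finset.prod_univ_sum (fun _ : W => (Finset.univ : Finset (Fin d)))
            fun _ a => (P a).toReal
          rw [Fintype.piFinset_univ] at this
          rw [← this]
          simp [hP1]
  have hfm : Measurable fun x (j : Fin n) => f (T^[j] x) :=
    measurable_pi_lambda _ fun j => hf.comp (hT.iterate j).measurable
  have hgext : ∀ (x : I → Fin d) (j : Fin n), g (T^[j] (ext (W.restrict x))) = g (T^[j] x) := by
    intro x j
    refine hgS fun i hi => ?_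
    simp only [hTdef, iterate_reindex]
    exact dif_pos (hW j j.2 i hi)
  have hpos : ∀ᵐ x ∂μ, ∀ i : W, 0 < (P (x i)).toReal :=
    ae_all_iff.2 fun i : W => ae_bernoulliMeasure_pos P (i : I)
  have hlow : ∀ᵐ x ∂μ, 0 < w (fun j => f (T^[j] x)) ∧ -Real.log (w fun j => f (T^[j] x)) ≤
      ∑ i : W, -Real.log (P (x i)).toReal +
        ∑ j : Fin n, -Real.log (K (g (T^[j] x)) (f (T^[j] x))) := by
    filter_upwards [hpos] with x hx
    have h1 : (∏ i : W, (P (x i)).toReal) * ∏ j : Fin n, K (g (T^[j] x)) (f (T^[j] x)) ≤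
        w fun j => f (T^[j] x) := by
      have := Finset.single_le_sum (f := fun z : W → Fin d => (∏ i : W, (P (z i)).toReal) *
        ∏ j : Fin n, K (g (T^[j] (ext z))) (f (T^[j] x))) (fun z _ => hterm _ z)
        (Finset.mem_univ (W.restrict x))
      simp only [hgext] at this
      exact this
    have h2 : 0 < ∏ i : W, (P (x i)).toReal := Finset.prod_pos fun i _ => hx i
    have h3 : 0 < ∏ j : Fin n, K (g (T^[j] x)) (f (T^[j] x)) := Finset.prod_pos fun j _ => hK _ _
    refine ⟨(mul_pos h2 h3).trans_le h1, ?_⟩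
    have h4 := Real.log_le_log (mul_pos h2 h3) h1
    rw [Real.log_mul h2.ne' h3.ne', Real.log_prod fun i _ => (hx i).ne',
      Real.log_prod fun j _ => (hK _ _).ne'] at h4
    rw [Finset.sum_neg_distrib, Finset.sum_neg_distrib]
    linarith
  have hKm : Measurable fun x => -Real.log (K (g x) (f x)) :=
    (Measurable.of_discrete (f := fun y : Fin k × Fin k => -Real.log (K y.1 y.2))).comp
      (hg.prodMk hf)
  have hKi : Integrable (fun x => -Real.log (K (g x) (f x))) μ := by
    refine Integrable.mono' (integrable_const (∑ y : Fin k × Fin k, |(-Real.log (K y.1 y.2))|))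
      hKm.aestronglyMeasurable (ae_of_all _ fun x => ?_)
    exact Finset.single_le_sum (f := fun y : Fin k × Fin k => |(-Real.log (K y.1 y.2))|)
      (fun _ _ => abs_nonneg _) (Finset.mem_univ (g x, f x))
  have hKj : ∀ j : Fin n, Integrable (fun x => -Real.log (K (g (T^[j] x)) (f (T^[j] x)))) μ :=
    fun j => (hT.iterate j).integrable_comp_of_integrable hKi
  have hPi : ∀ i : W, Integrable (fun x : I → Fin d => -Real.log (P (x i)).toReal) μ :=
    fun i => integrable_eval_bernoulliMeasure P (i : I) fun a => -Real.log (P a).toReal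
  have hKint : ∫ x, -Real.log (K (g x) (f x)) ∂μ ≤ -Real.log (1 - ε) + δ * Real.log (k / ε) := by
    have hset : MeasurableSet {x | f x ≠ g x} := (measurableSet_eq_fun hf hg).compl
    calc ∫ x, -Real.log (K (g x) (f x)) ∂μ ≤
          ∫ x, (-Real.log (1 - ε) +
            {x | f x ≠ g x}.indicator (fun _ => Real.log (k / ε)) x) ∂μ := by
          refine integral_mono hKi
            ((integrable_const _).add ((integrable_const _).indicator hset)) fun x => ?_
          have hlog : 0 ≤ -Real.log (1 - ε) := by
            have := Real.log_nonpos (by linarith : 0 ≤ 1 - ε) (by linarith)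
            linarith
          by_cases h : f x = g x
          · simp [K, h]
          · have : -Real.log (ε / k) = Real.log (k / ε) := by
              rw [← Real.log_inv, inv_div]
            simp only [K, h, if_false, this]
            rw [indicator_of_mem (by exact h)]
            linarith
      _ = -Real.log (1 - ε) + μ.real {x | f x ≠ g x} * Real.log (k / ε) := by
          rw [integral_add (integrable_const _) ((integrable_const _).indicator hset),
            integral_indicator hset]
          simp
      _ ≤ _ := by gcongr
  calc partitionEntropy μ (fun x (j : Fin n) => f (T^[j] x)) ≤
        ∫ x, -Real.log (w fun j => f (T^[j] x)) ∂μ :=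
        partitionEntropy_le_integral μ hfm hw0 hw1 (hlow.mono fun x hx => hx.1)
    _ ≤ ∫ x, (∑ i : W, -Real.log (P (x i)).toReal +
          ∑ j : Fin n, -Real.log (K (g (T^[j] x)) (f (T^[j] x)))) ∂μ := by
        refine integral_mono_ae ?_ ?_ (hlow.mono fun x hx => hx.2)
        · refine Integrable.mono' (integrable_const (∑ v, |(-Real.log (w v))|))
            ((Measurable.of_discrete (f := fun v => -Real.log (w v))).comp hfm).aestronglyMeasurable
            (ae_of_all _ fun x => ?_)
          exact Finset.single_le_sum (f := fun v => |(-Real.log (w v))|)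
            (fun _ _ => abs_nonneg _) (Finset.mem_univ fun j : Fin n => f (T^[j] x))
        · exact (integrable_finsetSum _ fun i _ => hPi i).add
            (integrable_finsetSum _ fun j _ => hKj j)
    _ = W.card * ∑ a, Real.negMulLog (P a).toReal +
          n * ∫ x, -Real.log (K (g x) (f x)) ∂μ := by
        rw [integral_add (integrable_finsetSum _ fun i _ => hPi i)
            (integrable_finsetSum _ fun j _ => hKj j), integral_finsetSum _ fun i _ => hPi i,
          integral_finsetSum _ fun j _ => hKj j]
        have : ∀ j : ℕ, ∫ x, -Real.log (K (g (T^[j] x)) (f (T^[j] x))) ∂μ =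
            ∫ x, -Real.log (K (g x) (f x)) ∂μ := by
          intro j
          have h := integral_map (μ := μ) (φ := T^[j]) (hT.iterate j).measurable.aemeasurable
            (f := fun x => -Real.log (K (g x) (f x))) hKm.aestronglyMeasurable
          rw [(hT.iterate j).map_eq] at h
          exact h.symm
        have h2 : ∀ i : W, ∫ x, -Real.log (P (x i)).toReal ∂μ =
            ∑ a, Real.negMulLog (P a).toReal := fun i => integral_neg_log_bernoulliMeasure P (i : I)
        simp only [this, h2, Finset.sum_const, Finset.card_univ, Fintype.card_coe,
          Fintype.card_fin, nsmul_eq_mul]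
    _ ≤ _ := by gcongr

/-- The entropy of a Bernoulli shift. -/
theorem ksEntropy_reindex {τ : I → I} (hτ : Function.Injective τ) {i₀ : I}
    (horb : Function.Injective fun n : ℕ => τ^[n] i₀)
    (hwin : ∀ S : Finset I, ∃ c : ℕ, ∀ n : ℕ, ∃ W : Finset I, W.card ≤ n + c ∧
      ∀ j < n, ∀ i ∈ S, τ^[j] i ∈ W) :
    ksEntropy (bernoulliMeasure I P) (fun x i => x (τ i)) =
      ENNReal.ofReal (∑ a, Real.negMulLog (P a).toReal) := by
  set H := ∑ a, Real.negMulLog (P a).toReal with hH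
  have hH0 : 0 ≤ H := Finset.sum_nonneg fun a _ => Real.negMulLog_nonneg ENNReal.toReal_nonneg
    (ENNReal.toReal_mono ENNReal.one_ne_top (P.coe_le_one a))
  refine le_antisymm ?_ ?_
  · refine iSup_le fun k => iSup_le fun f => iSup_le fun hf => ?_
    refine ENNReal.le_of_forall_pos_le_add fun η hη _ => ?_
    have hη' : (0 : ℝ) < η := hη
    obtain ⟨a₀, -⟩ := P.support_nonempty
    have hk : (0 : ℝ) < k := by exact_mod_cast (Nat.zero_le _).trans_lt (f fun _ => a₀).2
    have hk1 : (1 : ℝ) ≤ k := by exact_mod_cast (Nat.zero_le _).trans_lt (f fun _ => a₀).2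
    -- Chosen so that -log(1 - ε) = η/2; `δ` below makes the disagreement term at most η/2 as well,
    -- its `+ 1` keeping the denominator positive.
    set ε : ℝ := 1 - Real.exp (-(η / 2)) with hε
    have hε0 : 0 < ε := by
      have : Real.exp (-((η : ℝ) / 2)) < 1 := Real.exp_lt_one_iff.2 (by linarith)
      linarith
    have hε1 : ε < 1 := by
      have := Real.exp_pos (-((η : ℝ) / 2))
      linarith
    have hlogk : 0 ≤ Real.log (k / ε) :=
      Real.log_nonneg (by rw [le_div_iff₀ hε0]; linarith)
    set δ : ℝ := η / 2 / (Real.log (k / ε) + 1) with hδ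
    have hδ0 : 0 < δ := by positivity
    obtain ⟨S, g, hg, hgS, hfg⟩ := exists_dependsOn_measure_ne_le (bernoulliMeasure I P) hf hδ0
    obtain ⟨c, hc⟩ := hwin S
    have herr : -Real.log (1 - ε) + δ * Real.log (k / ε) ≤ η := by
      have h1 : -Real.log (1 - ε) = η / 2 := by
        rw [hε, sub_sub_cancel, Real.log_exp, neg_neg]
      have h2 : δ * Real.log (k / ε) ≤ η / 2 := by
        rw [hδ, div_mul_eq_mul_div, div_le_iff₀ (by linarith)]
        nlinarith
      linarith
    have hbound : ∀ᶠ n : ℕ in atTop, ENNReal.ofReal (partitionEntropy (bernoulliMeasure I P)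
        (fun x (j : Fin n) => f ((fun (y : I → Fin d) i => y (τ i))^[j] x)) / n) ≤
        ENNReal.ofReal (H + c * H / n + η) := by
      filter_upwards [eventually_gt_atTop 0] with n hn
      have hn' : (0 : ℝ) < n := by exact_mod_cast hn
      obtain ⟨W, hWc, hW⟩ := hc n
      refine ENNReal.ofReal_le_ofReal ?_
      rw [div_le_iff₀ hn']
      refine (partitionEntropy_iterate_le P hτ hf hg hgS hε0 hε1 hfg hW).trans ?_
      have h1 : (W.card : ℝ) ≤ n + c := by exact_mod_cast hWc
      calc W.card * H + n * (-Real.log (1 - ε) + δ * Real.log (k / ε)) ≤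
            (n + c) * H + n * η := by gcongr
        _ = (H + c * H / n + η) * n := by field_simp
    refine (limsup_le_limsup hbound).trans ?_
    have hlim : Tendsto (fun n : ℕ => ENNReal.ofReal (H + c * H / n + η)) atTop
        (𝓝 (ENNReal.ofReal (H + 0 + η))) := by
      refine ENNReal.tendsto_ofReal ?_
      exact (tendsto_const_nhds.add (tendsto_const_div_atTop_nhds_zero_nat _)).add
        tendsto_const_nhds
    rw [hlim.limsup_eq, add_zero, ENNReal.ofReal_add hH0 η.coe_nonneg, ENNReal.ofReal_coe_nnreal]
  -- The partition by the coordinate `i₀` attains the bound: its iterates read n distinct, hence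
  -- independent, coordinates.
  · refine le_iSup_of_le d (le_iSup_of_le (fun x => x i₀) (le_iSup_of_le
      (measurable_pi_apply i₀) ?_))
    have hlim : Tendsto (fun n : ℕ => ENNReal.ofReal (partitionEntropy (bernoulliMeasure I P)
        (fun (x : I → Fin d) (j : Fin n) =>
          (fun (y : I → Fin d) i => y (τ i))^[j] x i₀) / n)) atTop (𝓝 (ENNReal.ofReal H)) := by
      refine tendsto_const_nhds.congr' ?_
      filter_upwards [eventually_gt_atTop 0] with n hn
      have hn' : (0 : ℝ) < n := by exact_mod_cast hn
      simp only [iterate_reindex]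
      rw [partitionEntropy_coordinates P (g := fun j : Fin n => τ^[j] i₀)
        fun i j hij => Fin.ext (horb hij), mul_div_cancel_left₀ _ hn'.ne']
    exact hlim.limsup_eq.ge

theorem ksEntropy_shiftZ : ksEntropy (bernoulliMeasure ℤ P) shiftZ =
    ENNReal.ofReal (∑ a, Real.negMulLog (P a).toReal) := by
  refine ksEntropy_reindex P (add_left_injective 1) (i₀ := 0) ?_ ?_
  · intro m n h
    simpa [add_right_iterate] using h
  · intro S
    obtain ⟨a, ha⟩ := S.bddAbove
    obtain ⟨b, hb⟩ := S.bddBelow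
    refine ⟨(a + 1 - b).toNat, fun n => ⟨Finset.Ico b (a + 1 + n), ?_, fun j hj i hi => ?_⟩⟩
    · rw [Int.card_Ico]; omega
    · have h1 := ha hi
      have h2 := hb hi
      simp only [add_right_iterate, Finset.mem_Ico]
      simp
      omega

theorem ksEntropy_shiftN : ksEntropy (bernoulliMeasure ℕ P) shiftN =
    ENNReal.ofReal (∑ a, Real.negMulLog (P a).toReal) := by
  refine ksEntropy_reindex P (add_left_injective 1) (i₀ := 0) ?_ ?_
  · intro m n h
    simpa [add_right_iterate] using h
  · intro S
    obtain ⟨a, ha⟩ := S.bddAbove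
    refine ⟨a + 1, fun n => ⟨Finset.range (n + (a + 1)), by simp, fun j hj i hi => ?_⟩⟩
    have h1 := ha hi
    simp only [add_right_iterate, Finset.mem_range]
    simp
    omega

end Entropy

/-! ### From pointwise dimension to Hausdorff and packing dimension -/

section Dimension

/-- The points `y` with `ν (B(y, ε)) ≤ ε ^ s` for all `ε < 1 / (n + 1)`. -/
def ballUpperSet (ν : Measure ℝ) (s : ℝ) (n : ℕ) : Set ℝ :=
  {y | ∀ ε ∈ Ioo (0 : ℝ) (1 / (n + 1)), ν (Metric.ball y ε) ≤ ENNReal.ofReal (ε ^ s)}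

/-- The points `y` with `ε ^ s ≤ ν (B(y, ε))` for all `ε < 1 / (n + 1)`. -/
def ballLowerSet (ν : Measure ℝ) (s : ℝ) (n : ℕ) : Set ℝ :=
  {y | ∀ ε ∈ Ioo (0 : ℝ) (1 / (n + 1)), ENNReal.ofReal (ε ^ s) ≤ ν (Metric.closedBall y ε)}

/-- Continuity from below along smaller concentric open balls. It makes `ballUpperSet` closed, hence
measurable, which is needed to carry almost sure statements through a push-forward. -/
theorem isOpen_lt_measure_ball (ν : Measure ℝ) (ε : ℝ) (c : ℝ≥0∞) :
    IsOpen {y | c < ν (Metric.ball y ε)} := by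
  rw [Metric.isOpen_iff]
  intro y hy
  have hmono : Monotone fun n : ℕ => Metric.ball y (ε - 1 / (n + 1 : ℝ)) := fun m n hmn =>
    Metric.ball_subset_ball (by gcongr)
  have hU : Metric.ball y ε = ⋃ n : ℕ, Metric.ball y (ε - 1 / (n + 1 : ℝ)) := by
    ext z
    simp only [Metric.mem_ball, mem_iUnion]
    constructor
    · intro hz
      obtain ⟨n, hn⟩ := exists_nat_one_div_lt (sub_pos.2 hz)
      exact ⟨n, by linarith⟩
    · rintro ⟨n, hn⟩
      have : 0 < 1 / (n + 1 : ℝ) := by positivity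
      linarith
  rw [mem_ofPred_eq, hU, hmono.measure_iUnion, lt_iSup_iff] at hy
  obtain ⟨n, hn⟩ := hy
  refine ⟨1 / (n + 1 : ℝ), by positivity, fun z hz => ?_⟩
  refine hn.trans_le (measure_mono (Metric.ball_subset_ball' ?_))
  rw [Metric.mem_ball, dist_comm] at hz
  linarith

/-- Continuity from above along larger concentric closed balls; it serves `ballLowerSet` in the same
way. -/
theorem isOpen_measure_closedBall_lt (ν : Measure ℝ) [IsFiniteMeasure ν] (ε : ℝ) (c : ℝ≥0∞) :
    IsOpen {y | ν (Metric.closedBall y ε) < c} := by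
  rw [Metric.isOpen_iff]
  intro y hy
  have hanti : Antitone fun n : ℕ => Metric.closedBall y (ε + 1 / (n + 1 : ℝ)) := fun m n hmn =>
    Metric.closedBall_subset_closedBall (by gcongr)
  have hI : Metric.closedBall y ε = ⋂ n : ℕ, Metric.closedBall y (ε + 1 / (n + 1 : ℝ)) := by
    ext z
    simp only [Metric.mem_closedBall, mem_iInter]
    constructor
    · intro hz n
      have : 0 < 1 / (n + 1 : ℝ) := by positivity
      linarith
    · intro h
      refine le_of_forall_pos_le_add fun δ hδ => ?_
      obtain ⟨n, hn⟩ := exists_nat_one_div_lt hδ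
      linarith [h n]
  rw [mem_ofPred_eq, hI, hanti.measure_iInter
    (fun n => Metric.isClosed_closedBall.measurableSet.nullMeasurableSet)
    ⟨0, measure_ne_top _ _⟩, iInf_lt_iff] at hy
  obtain ⟨n, hn⟩ := hy
  refine ⟨1 / (n + 1 : ℝ), by positivity, fun z hz => ?_⟩
  refine (measure_mono (Metric.closedBall_subset_closedBall' ?_)).trans_lt hn
  rw [Metric.mem_ball] at hz
  linarith

theorem measurableSet_ballUpperSet (ν : Measure ℝ) (s : ℝ) (n : ℕ) :
    MeasurableSet (ballUpperSet ν s n) := by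
  have : ballUpperSet ν s n = ⋂ ε ∈ Ioo (0 : ℝ) (1 / (n + 1)),
      {y | ENNReal.ofReal (ε ^ s) < ν (Metric.ball y ε)}ᶜ := by
    ext y; simp [ballUpperSet]
  rw [this]
  exact (isClosed_biInter fun ε _ => (isOpen_lt_measure_ball ν ε _).isClosed_compl).measurableSet

theorem measurableSet_ballLowerSet (ν : Measure ℝ) [IsFiniteMeasure ν] (s : ℝ) (n : ℕ) :
    MeasurableSet (ballLowerSet ν s n) := by
  have : ballLowerSet ν s n = ⋂ ε ∈ Ioo (0 : ℝ) (1 / (n + 1)),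
      {y | ν (Metric.closedBall y ε) < ENNReal.ofReal (ε ^ s)}ᶜ := by
    ext y; simp [ballLowerSet]
  rw [this]
  exact (isClosed_biInter fun ε _ =>
    (isOpen_measure_closedBall_lt ν ε _).isClosed_compl).measurableSet

theorem exists_one_div_of_eventually {p : ℝ → Prop} (h : ∀ᶠ ε in 𝓝[>] (0 : ℝ), p ε) :
    ∃ n : ℕ, ∀ ε ∈ Ioo (0 : ℝ) (1 / (n + 1)), p ε := by
  obtain ⟨u, hu, hu'⟩ := mem_nhdsGT_iff_exists_Ioo_subset.1 h
  obtain ⟨n, hn⟩ := exists_nat_one_div_lt (mem_Ioi.1 hu)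
  exact ⟨n, fun ε hε => hu' ⟨hε.1, hε.2.trans hn⟩⟩

theorem eventually_log_neg : ∀ᶠ ε : ℝ in 𝓝[>] 0, 0 < ε ∧ Real.log ε < 0 := by
  filter_upwards [Ioo_mem_nhdsGT (zero_lt_one (α := ℝ))] with ε hε
  exact ⟨hε.1, Real.log_neg hε.1 hε.2⟩

theorem HasPointwiseDim.exists_mem_ballUpperSet {ν : Measure ℝ} [IsFiniteMeasure ν] {y d s : ℝ}
    (h : HasPointwiseDim ν y d) (hs : s < d) : ∃ n, y ∈ ballUpperSet ν s n := by
  refine exists_one_div_of_eventually ?_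
  filter_upwards [h.eventually (lt_mem_nhds hs), eventually_log_neg] with ε h1 h2
  rw [lt_div_iff_of_neg h2.2] at h1
  rw [← ENNReal.ofReal_toReal (measure_ne_top ν (Metric.ball y ε))]
  refine ENNReal.ofReal_le_ofReal ?_
  -- With `Real.log 0 = 0` the quotient says nothing about a ball of mass zero, but there the upper
  -- bound is trivial.
  rcases measureReal_nonneg (μ := ν) (s := Metric.ball y ε) |>.eq_or_lt with h0 | h0
  · rw [← measureReal_def, ← h0]
    exact Real.rpow_nonneg h2.1.le _
  · rw [← measureReal_def, ← Real.log_le_log_iff h0 (Real.rpow_pos_of_pos h2.1 _),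
      Real.log_rpow h2.1]
    exact h1.le

/-- Membership in the support is essential: outside it small balls have mass zero, and the
convention `Real.log 0 = 0` would simulate dimension 0. -/
theorem HasPointwiseDim.exists_mem_ballLowerSet {ν : Measure ℝ} [IsFiniteMeasure ν] {y d s : ℝ}
    (h : HasPointwiseDim ν y d) (hy : y ∈ ν.support) (hs : d < s) :
    ∃ n, y ∈ ballLowerSet ν s n := by
  refine exists_one_div_of_eventually ?_
  filter_upwards [h.eventually (gt_mem_nhds hs), eventually_log_neg] with ε h1 h2
  rw [div_lt_iff_of_neg h2.2] at h1
  refine le_trans ?_ (measure_mono Metric.ball_subset_closedBall)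
  have h0 : 0 < ν.real (Metric.ball y ε) := ENNReal.toReal_pos
    (Measure.mem_support_iff_forall y |>.1 hy _ (Metric.ball_mem_nhds y h2.1)).ne'
    (measure_ne_top _ _)
  refine ENNReal.ofReal_le_of_le_toReal ?_
  rw [← measureReal_def, ← Real.log_le_log_iff (Real.rpow_pos_of_pos h2.1 _) h0,
    Real.log_rpow h2.1]
  exact h1.le

theorem HasPointwiseDim.nonneg {ν : Measure ℝ} [IsProbabilityMeasure ν] {y d : ℝ}
    (h : HasPointwiseDim ν y d) : 0 ≤ d := by
  refine ge_of_tendsto h ?_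
  filter_upwards [eventually_log_neg] with ε hε
  exact div_nonneg_of_nonpos (Real.log_nonpos measureReal_nonneg measureReal_le_one) hε.2.le

/-- A set in which families of disjoint balls of radius `δ` have bounded cardinality is covered by
the doubles of such a family. -/
theorem exists_maximal_disjoint_closedBall {X : Type*} [PseudoMetricSpace X] {Z : Set X} {δ : ℝ}
    (hδ : 0 ≤ δ) {K : ℕ} (hK : ∀ t : Finset X, (t : Set X) ⊆ Z →
      ((t : Set X).PairwiseDisjoint fun x => Metric.closedBall x δ) → t.card ≤ K) :
    ∃ t : Finset X, (t : Set X) ⊆ Z ∧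
      ((t : Set X).PairwiseDisjoint fun x => Metric.closedBall x δ) ∧
      Z ⊆ ⋃ x ∈ t, Metric.closedBall x (2 * δ) := by
  classical
  let C : Set ℕ := {m | ∃ t : Finset X, (t : Set X) ⊆ Z ∧
    ((t : Set X).PairwiseDisjoint fun x => Metric.closedBall x δ) ∧ t.card = m}
  have hne : C.Nonempty := ⟨0, ∅, by simp⟩
  have hbdd : BddAbove C := ⟨K, by rintro m ⟨t, h1, h2, rfl⟩; exact hK t h1 h2⟩
  obtain ⟨t, h1, h2, h3⟩ := Nat.sSup_mem hne hbdd
  refine ⟨t, h1, h2, fun z hz => ?_⟩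
  by_contra hcon
  simp only [mem_iUnion, not_exists, Metric.mem_closedBall, not_le] at hcon
  have hzt : z ∉ t := fun h => by
    have := hcon z h
    rw [dist_self] at this
    linarith
  have h4 : (insert z t).card ≤ sSup C := by
    refine le_csSup hbdd ⟨insert z t, ?_, ?_, rfl⟩
    · rw [Finset.coe_insert]; exact insert_subset hz h1
    · rw [Finset.coe_insert]
      refine h2.insert fun x hx _ => ?_
      have h6 : Disjoint (Metric.closedBall z δ) (Metric.closedBall x δ) :=
        Metric.closedBall_disjoint_closedBall (by have := hcon x hx; linarith)
      exact h6
  rw [Finset.card_insert_of_notMem hzt] at h4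
  omega

/-- If every disjoint family were too small, cardinalities would be bounded, so a maximal family
would exist; its doubled balls cover `Z` and contradict the smallness. -/
theorem exists_disjoint_closedBall_measure_le (ν : Measure ℝ) [IsFiniteMeasure ν] {Z : Set ℝ}
    {δ : ℝ} (hδ : 0 ≤ δ) {c : ℝ≥0∞} (hc0 : c ≠ 0)
    (hc : ∀ x ∈ Z, ν (Metric.closedBall x (2 * δ)) ≤ c) :
    ∃ t : Finset ℝ, (t : Set ℝ) ⊆ Z ∧
      ((t : Set ℝ).PairwiseDisjoint fun x => Metric.closedBall x δ) ∧ ν Z ≤ t.card * c := by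
  by_contra hcon
  push Not at hcon
  obtain ⟨K, hK⟩ := ENNReal.exists_nat_gt (ENNReal.div_ne_top (measure_ne_top ν Z) hc0)
  obtain ⟨t, h1, h2, h3⟩ := exists_maximal_disjoint_closedBall hδ (Z := Z) (K := K)
    fun t h1 h2 => by
      have h3 := (hcon t h1 h2).le
      have h4 : (t.card : ℝ≥0∞) ≤ ν Z / c := ENNReal.le_div_iff_mul_le (Or.inl hc0)
        (Or.inr (measure_ne_top ν Z)) |>.2 h3
      exact_mod_cast (h4.trans_lt hK).le
  refine absurd (hcon t h1 h2) (not_lt.2 ?_)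
  calc ν Z ≤ ν (⋃ x ∈ t, Metric.closedBall x (2 * δ)) := measure_mono h3
    _ ≤ ∑ x ∈ t, ν (Metric.closedBall x (2 * δ)) := measure_biUnion_finset_le _ _
    _ ≤ ∑ x ∈ t, c := Finset.sum_le_sum fun x hx => hc x (h1 hx)
    _ = t.card * c := by rw [Finset.sum_const, nsmul_eq_mul]

theorem packingPre_mono {X : Type*} [PseudoMetricSpace X] (d : ℝ≥0) {A B : Set X} (h : A ⊆ B) :
    packingPre d A ≤ packingPre d B := by
  refine iInf_mono fun δ => iInf_mono fun _ => ?_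
  refine iSup_mono fun t => iSup_mono fun ρ => iSup_le fun ht => ?_
  exact le_iSup_of_le (ht.trans h) le_rfl

/-- At scale δ, closed balls of radius 2δ centred in `A` lie in open balls of radius 3δ and have
mass at most (3δ)^{s'}. So some disjoint family has at least ν(A)/(3δ)^{s'} members, and its packing
sum, at least ν(A)(2δ)^s/(3δ)^{s'}, blows up as δ → 0. -/
theorem packingPre_eq_top {ν : Measure ℝ} [IsFiniteMeasure ν] {s : ℝ≥0} {s' : ℝ} (hs : s < s')
    {n : ℕ} {A : Set ℝ} (hA : A ⊆ ballUpperSet ν s' n) (hνA : ν A ≠ 0) :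
    packingPre s A = ∞ := by
  refine iInf_eq_top.2 fun δ₀ => iInf_eq_top.2 fun hδ₀ => top_le_iff.1 ?_
  have hlim : Tendsto (fun δ : ℝ => ENNReal.ofReal ((2 * δ) ^ (s : ℝ) / (3 * δ) ^ s') * ν A)
      (𝓝[>] 0) (𝓝 (⊤ * ν A)) := by
    refine ENNReal.Tendsto.mul_const (ENNReal.tendsto_ofReal_atTop.comp ?_) (Or.inr ?_)
    · have h1 : Tendsto (fun δ : ℝ => 2 ^ (s : ℝ) / 3 ^ s' * (δ⁻¹) ^ (s' - s)) (𝓝[>] 0) atTop :=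
        ((tendsto_rpow_atTop (sub_pos.2 hs)).comp tendsto_inv_nhdsGT_zero).const_mul_atTop
          (by positivity)
      refine h1.congr' ?_
      filter_upwards [self_mem_nhdsWithin] with δ hδ
      have hδ : 0 < δ := hδ
      rw [Real.mul_rpow (by norm_num) hδ.le, Real.mul_rpow (by norm_num) hδ.le,
        Real.inv_rpow hδ.le, Real.rpow_sub hδ]
      field_simp
    · exact measure_ne_top ν A
  rw [ENNReal.top_mul hνA] at hlim
  refine le_of_tendsto hlim ?_
  have hpos : (0 : ℝ) < min δ₀ (1 / (n + 1) / 3) := by positivity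
  filter_upwards [Ioo_mem_nhdsGT hpos] with δ hδ
  have hδ0 : 0 < δ := hδ.1
  have hδ1 : δ < δ₀ := hδ.2.trans_le (min_le_left _ _)
  have hδ2 : 3 * δ < 1 / (n + 1) := by
    have := hδ.2.trans_le (min_le_right _ _)
    linarith
  have h3 : 0 < (3 * δ) ^ s' := by positivity
  obtain ⟨t, ht1, ht2, ht3⟩ := exists_disjoint_closedBall_measure_le ν (Z := A) hδ0.le
    (c := ENNReal.ofReal ((3 * δ) ^ s')) (by simpa using h3) fun x hx =>
      (measure_mono (Metric.closedBall_subset_ball (by linarith))).trans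
        (hA hx (3 * δ) ⟨by linarith, hδ2⟩)
  calc ENNReal.ofReal ((2 * δ) ^ (s : ℝ) / (3 * δ) ^ s') * ν A ≤
        ENNReal.ofReal ((2 * δ) ^ (s : ℝ) / (3 * δ) ^ s') *
          (t.card * ENNReal.ofReal ((3 * δ) ^ s')) := by gcongr
    _ = t.card * ENNReal.ofReal ((2 * δ) ^ (s : ℝ)) := by
        rw [mul_left_comm, ← ENNReal.ofReal_mul (by positivity), div_mul_cancel₀ _ h3.ne']
    _ = ∑ x ∈ t, ENNReal.ofReal (2 * δ) ^ (s : ℝ) := by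
        rw [Finset.sum_const, nsmul_eq_mul, ENNReal.ofReal_rpow_of_pos (by linarith)]
    _ ≤ packingPreDelta s δ₀ A :=
        le_iSup_of_le t (le_iSup_of_le (fun _ => δ) (le_iSup_of_le ht1 (le_iSup_of_le
          (fun _ _ => ⟨hδ0, hδ1.le⟩) (le_iSup_of_le ht2 le_rfl))))

/-- In any countable cover, some piece meets the good part of `A` in positive outer measure and
already has infinite premeasure. -/
theorem le_dimPack_of_measure_ne_zero {ν : Measure ℝ} [IsFiniteMeasure ν] {s : ℝ≥0} {s' : ℝ}
    (hs : s < s') {n : ℕ} {A : Set ℝ} (hνA : ν (A ∩ ballUpperSet ν s' n) ≠ 0) :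
    (s : ℝ≥0∞) ≤ dimPack A := by
  refine le_iSup₂_of_le (f := fun (d : ℝ≥0) (_ : packingMeasure d A = ∞) => (d : ℝ≥0∞)) s ?_ le_rfl
  refine iInf_eq_top.2 fun t => iInf_eq_top.2 fun ht => ?_
  obtain ⟨m, hm⟩ : ∃ m, ν (t m ∩ (A ∩ ballUpperSet ν s' n)) ≠ 0 := by
    by_contra hcon
    push Not at hcon
    refine hνA (measure_mono_null ?_ (measure_iUnion_null hcon))
    rw [← iUnion_inter]
    exact subset_inter (inter_subset_left.trans ht) Subset.rfl
  refine ENNReal.tsum_eq_top_of_eq_top ⟨m, top_le_iff.1 ?_⟩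
  rw [← packingPre_eq_top hs (inter_subset_right.trans inter_subset_right) hm]
  exact packingPre_mono s inter_subset_left

/-- For disjoint balls centred in the set, ∑ ρ^s is at most the total mass 1; the surplus exponent
contributes a factor δ^{s'-s}, which tends to 0. -/
theorem packingPre_ballLowerSet {ν : Measure ℝ} [IsProbabilityMeasure ν] {s : ℝ} {s' : ℝ≥0}
    (hs : s < s') (n : ℕ) : packingPre s' (ballLowerSet ν s n) = 0 := by
  have hlim : Tendsto (fun δ : ℝ => ENNReal.ofReal (2 ^ (s' : ℝ) * δ ^ (s' - s))) (𝓝[>] 0)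
      (𝓝 (ENNReal.ofReal (2 ^ (s' : ℝ) * 0 ^ (s' - s)))) := by
    refine ENNReal.tendsto_ofReal (tendsto_const_nhds.mul ?_)
    exact ((Real.continuous_rpow_const (sub_pos.2 hs).le).tendsto 0).mono_left nhdsWithin_le_nhds
  rw [Real.zero_rpow (sub_pos.2 hs).ne', mul_zero, ENNReal.ofReal_zero] at hlim
  refine le_antisymm (ge_of_tendsto hlim ?_) zero_le
  have hpos : (0 : ℝ) < 1 / (n + 1) := by positivity
  filter_upwards [Ioo_mem_nhdsGT hpos] with δ hδ
  refine iInf₂_le_of_le δ hδ.1 ?_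
  refine iSup_le fun t => iSup_le fun ρ => iSup_le fun ht => iSup_le fun hρ => iSup_le fun hd => ?_
  have hterm : ∀ x ∈ t, ENNReal.ofReal (2 * ρ x) ^ (s' : ℝ) ≤
      ENNReal.ofReal (2 ^ (s' : ℝ) * δ ^ (s' - s)) * ν (Metric.closedBall x (ρ x)) := by
    intro x hx
    obtain ⟨h1, h2⟩ := hρ x hx
    calc ENNReal.ofReal (2 * ρ x) ^ (s' : ℝ) =
          ENNReal.ofReal (2 ^ (s' : ℝ) * ρ x ^ (s' - s) * ρ x ^ s) := by
          rw [ENNReal.ofReal_rpow_of_pos (by linarith), Real.mul_rpow (by norm_num) h1.le,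
            mul_assoc, ← Real.rpow_add h1, sub_add_cancel]
      _ ≤ ENNReal.ofReal (2 ^ (s' : ℝ) * δ ^ (s' - s) * ρ x ^ s) := by
          refine ENNReal.ofReal_le_ofReal ?_
          have := Real.rpow_le_rpow h1.le h2 (sub_pos.2 hs).le
          gcongr
      _ = ENNReal.ofReal (2 ^ (s' : ℝ) * δ ^ (s' - s)) * ENNReal.ofReal (ρ x ^ s) :=
          ENNReal.ofReal_mul (mul_nonneg (by positivity) (Real.rpow_nonneg hδ.1.le _))
      _ ≤ _ := by
          gcongr
          exact ht hx (ρ x) ⟨h1, h2.trans_lt hδ.2⟩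
  calc ∑ x ∈ t, ENNReal.ofReal (2 * ρ x) ^ (s' : ℝ) ≤
        ∑ x ∈ t, ENNReal.ofReal (2 ^ (s' : ℝ) * δ ^ (s' - s)) *
          ν (Metric.closedBall x (ρ x)) := Finset.sum_le_sum hterm
    _ = ENNReal.ofReal (2 ^ (s' : ℝ) * δ ^ (s' - s)) *
          ν (⋃ x ∈ t, Metric.closedBall x (ρ x)) := by
        rw [← Finset.mul_sum, measure_biUnion_finset hd
          fun x _ => Metric.isClosed_closedBall.measurableSet]
    _ ≤ ENNReal.ofReal (2 ^ (s' : ℝ) * δ ^ (s' - s)) := mul_le_of_le_one_right' prob_le_one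

theorem dimPack_le_of_subset_iUnion {ν : Measure ℝ} [IsProbabilityMeasure ν] {d : ℝ} {Y : Set ℝ}
    (hY : ∀ s, d < s → Y ⊆ ⋃ n, ballLowerSet ν s n) : dimPack Y ≤ ENNReal.ofReal d := by
  refine iSup₂_le fun d' hd' => ?_
  by_contra hcon
  have h1 : d < d' := by
    by_contra h
    refine hcon ?_
    rw [← ENNReal.ofReal_coe_nnreal]
    exact ENNReal.ofReal_le_ofReal (not_lt.1 h)
  obtain ⟨s, hs1, hs2⟩ := exists_between h1
  have h2 : packingMeasure d' Y ≤ 0 := by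
    refine iInf₂_le_of_le (fun n => ballLowerSet ν s n) (hY s hs1) ?_
    simp [packingPre_ballLowerSet hs2]
  rw [hd'] at h2
  simp at h2

/-- Disjoint balls of radius δ centred in the set number at most δ^{-s}. Doubling a maximal family
gives a cover by sets of diameter 4δ, so the s-dimensional Hausdorff measure is at most 4^s. -/
theorem dimH_ballLowerSet_le (ν : Measure ℝ) [IsProbabilityMeasure ν] (s : ℝ≥0) (n : ℕ) :
    dimH (ballLowerSet ν s n) ≤ s := by
  refine dimH_le_of_hausdorffMeasure_ne_top (ne_top_of_le_ne_top (b := ENNReal.ofReal (4 ^ (s : ℝ)))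
    ENNReal.ofReal_ne_top ?_)
  have hcov : ∀ m : ℕ, ∃ t : Finset ℝ,
      ballLowerSet ν s n ⊆ ⋃ x ∈ t, Metric.closedBall x (2 * (1 / (n + 1 + (m + 1)))) ∧
      t.card * ENNReal.ofReal ((1 / (n + 1 + (m + 1) : ℝ)) ^ (s : ℝ)) ≤ 1 := by
    intro m
    set δ : ℝ := 1 / (n + 1 + (m + 1)) with hδ
    have hδ0 : 0 < δ := by positivity
    have hδ1 : δ < 1 / (n + 1) := by
      rw [hδ]
      exact one_div_lt_one_div_of_lt (by positivity) (by linarith [(m.cast_nonneg : (0 : ℝ) ≤ m)])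
    have hcard : ∀ t : Finset ℝ, (t : Set ℝ) ⊆ ballLowerSet ν s n →
        ((t : Set ℝ).PairwiseDisjoint fun x => Metric.closedBall x δ) →
        t.card * ENNReal.ofReal (δ ^ (s : ℝ)) ≤ 1 := by
      intro t ht hd
      calc t.card * ENNReal.ofReal (δ ^ (s : ℝ)) = ∑ x ∈ t, ENNReal.ofReal (δ ^ (s : ℝ)) := by
            rw [Finset.sum_const, nsmul_eq_mul]
        _ ≤ ∑ x ∈ t, ν (Metric.closedBall x δ) :=
            Finset.sum_le_sum fun x hx => ht hx δ ⟨hδ0, hδ1⟩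
        _ = ν (⋃ x ∈ t, Metric.closedBall x δ) := (measure_biUnion_finset hd
            fun x _ => Metric.isClosed_closedBall.measurableSet).symm
        _ ≤ 1 := prob_le_one
    have hδs : ENNReal.ofReal (δ ^ (s : ℝ)) ≠ 0 := by
      simpa using Real.rpow_pos_of_pos hδ0 _
    obtain ⟨K, hK⟩ := ENNReal.exists_nat_gt (ENNReal.div_ne_top ENNReal.one_ne_top hδs)
    obtain ⟨t, h1, h2, h3⟩ := exists_maximal_disjoint_closedBall hδ0.le (Z := ballLowerSet ν s n)
      (K := K) fun t h1 h2 => by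
        have h4 : (t.card : ℝ≥0∞) ≤ 1 / ENNReal.ofReal (δ ^ (s : ℝ)) :=
          ENNReal.le_div_iff_mul_le (Or.inl hδs) (Or.inr ENNReal.one_ne_top) |>.2 (hcard t h1 h2)
        exact_mod_cast (h4.trans_lt hK).le
    exact ⟨t, h3, hcard t h1 h2⟩
  choose t ht1 ht2 using hcov
  have hdiam : ∀ (m : ℕ) (x : ℝ), Metric.ediam (Metric.closedBall x
      (2 * (1 / (n + 1 + (m + 1) : ℝ)))) ≤ ENNReal.ofReal (4 * (1 / (n + 1 + (m + 1) : ℝ))) := by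
    intro m x
    rw [Real.closedBall_eq_Icc, Real.ediam_Icc]
    exact ENNReal.ofReal_le_ofReal (by linarith)
  have hr : Tendsto (fun m : ℕ => ENNReal.ofReal (4 * (1 / (n + 1 + (m + 1) : ℝ)))) atTop
      (𝓝 0) := by
    rw [← ENNReal.ofReal_zero]
    refine ENNReal.tendsto_ofReal ?_
    have : Tendsto (fun m : ℕ => (n + 1 + (m + 1) : ℝ)) atTop atTop :=
      tendsto_atTop_add_const_left _ _
        (tendsto_atTop_add_const_right _ _ tendsto_natCast_atTop_atTop)
    simpa using (this.inv_tendsto_atTop.const_mul 4)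
  refine (Measure.hausdorffMeasure_le_liminf_sum (ι := fun m => t m) (s : ℝ)
    (ballLowerSet ν s n) _ hr
    (fun m x => Metric.closedBall (x : ℝ) (2 * (1 / (n + 1 + (m + 1) : ℝ))))
    (Eventually.of_forall fun m x => hdiam m x)
    (Eventually.of_forall fun m => by
      refine (ht1 m).trans ?_
      rw [iUnion_subtype])).trans ?_
  refine liminf_le_of_le (by isBoundedDefault) fun b hb => ?_
  obtain ⟨m, hm⟩ := hb.exists
  refine hm.trans ?_
  have h1 : (0 : ℝ) < 1 / (n + 1 + (m + 1) : ℝ) := by positivity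
  calc ∑ x : t m, Metric.ediam (Metric.closedBall (x : ℝ) (2 * (1 / (n + 1 + (m + 1) : ℝ)))) ^
        (s : ℝ) ≤ ∑ x : t m, ENNReal.ofReal (4 * (1 / (n + 1 + (m + 1) : ℝ))) ^ (s : ℝ) :=
        Finset.sum_le_sum fun x _ => ENNReal.rpow_le_rpow (hdiam m x) s.coe_nonneg
    _ = ENNReal.ofReal (4 ^ (s : ℝ)) *
          ((t m).card * ENNReal.ofReal ((1 / (n + 1 + (m + 1) : ℝ)) ^ (s : ℝ))) := by
        rw [Finset.sum_const, Finset.card_univ, Fintype.card_coe, nsmul_eq_mul,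
          ENNReal.ofReal_rpow_of_pos (by positivity), Real.mul_rpow (by norm_num) h1.le,
          ENNReal.ofReal_mul (by positivity)]
        ring
    _ ≤ ENNReal.ofReal (4 ^ (s : ℝ)) := mul_le_of_le_one_right' (ht2 m)

theorem dimH_le_of_subset_iUnion {ν : Measure ℝ} [IsProbabilityMeasure ν] {d : ℝ} (hd : 0 ≤ d)
    {Y : Set ℝ} (hY : ∀ s, d < s → Y ⊆ ⋃ n, ballLowerSet ν s n) :
    dimH Y ≤ ENNReal.ofReal d := by
  refine le_of_forall_gt_imp_ge_of_dense fun s hs => ?_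
  induction s with
  | top => exact le_top
  | coe s =>
    have h1 : d < s := by
      rwa [← ENNReal.ofReal_coe_nnreal, ENNReal.ofReal_lt_ofReal_iff_of_nonneg hd] at hs
    refine (dimH_mono (hY s h1)).trans ?_
    rw [dimH_iUnion]
    exact iSup_le fun n => dimH_ballLowerSet_le ν s n

/-- The mass distribution principle: ν restricted to the good part of `A` gives a small set at most
the s-th power of its diameter, so it is dominated by the Hausdorff measure. -/
theorem le_dimH_of_measure_ne_zero {ν : Measure ℝ} {s : ℝ≥0} {n : ℕ} {A : Set ℝ}
    (hA : MeasurableSet A) (hνA : ν (A ∩ ballUpperSet ν s n) ≠ 0) :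
    (s : ℝ≥0∞) ≤ dimH A := by
  rcases eq_or_ne s 0 with rfl | hs0
  · simp
  have hs : (0 : ℝ) < s := by positivity
  have hm := hA.inter (measurableSet_ballUpperSet ν s n)
  refine (le_dimH_of_hausdorffMeasure_ne_zero (s := A ∩ ballUpperSet ν s n) ?_).trans
    (dimH_mono inter_subset_left)
  have hpos : (0 : ℝ) < 1 / (n + 1) := by positivity
  have h := Measure.le_hausdorffMeasure (s : ℝ) (ν.restrict (A ∩ ballUpperSet ν s n))
    (ENNReal.ofReal (1 / (n + 1) / 2)) (by simpa using by positivity) fun B hB => ?_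
  · have h1 := h (A ∩ ballUpperSet ν s n)
    rw [Measure.restrict_apply_self] at h1
    exact (pos_iff_ne_zero.2 hνA |>.trans_le h1).ne'
  · rw [Measure.restrict_apply' hm]
    rcases (B ∩ (A ∩ ballUpperSet ν s n)).eq_empty_or_nonempty with h0 | ⟨y, hyB, -, hy⟩
    · rw [h0]; simp
    · have hBfin : Metric.ediam B ≠ ∞ := ne_top_of_le_ne_top ENNReal.ofReal_ne_top hB
      set D := (Metric.ediam B).toReal with hD
      have hD0 : 0 ≤ D := ENNReal.toReal_nonneg
      have hD1 : D < 1 / (n + 1) :=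
        (ENNReal.toReal_le_of_le_ofReal (by positivity) hB).trans_lt (half_lt_self hpos)
      have hsub : B ⊆ Metric.closedBall y D := fun z hz => by
        rw [Metric.mem_closedBall, dist_edist]
        exact ENNReal.toReal_mono hBfin (Metric.edist_le_ediam_of_mem hz hyB)
      -- The bound is available for open balls of radius ε > D; letting ε decrease to D also covers
      -- D = 0.
      have hlim : Tendsto (fun ε : ℝ => ENNReal.ofReal (ε ^ (s : ℝ))) (𝓝[>] D)
          (𝓝 (ENNReal.ofReal (D ^ (s : ℝ)))) :=
        ENNReal.tendsto_ofReal (((Real.continuous_rpow_const hs.le).tendsto D).mono_left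
          nhdsWithin_le_nhds)
      have hle : ν (B ∩ (A ∩ ballUpperSet ν s n)) ≤ ENNReal.ofReal (D ^ (s : ℝ)) := by
        refine ge_of_tendsto hlim ?_
        filter_upwards [Ioo_mem_nhdsGT hD1] with ε hε
        refine (measure_mono ?_).trans (hy ε ⟨hD0.trans_lt hε.1, hε.2⟩)
        exact inter_subset_left.trans (hsub.trans (Metric.closedBall_subset_ball hε.1))
      rwa [← ENNReal.ofReal_rpow_of_nonneg hD0 hs.le, hD, ENNReal.ofReal_toReal hBfin] at hle

/-- A probability measure with almost surely constant pointwise dimension has a Hausdorff and a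
packing dimension. -/
theorem hasDim_of_hasPointwiseDim {Ω : Type*} [MeasurableSpace Ω] {κ : Measure Ω}
    [IsProbabilityMeasure κ] {f : Ω → ℝ} (hf : Measurable f) {d : ℝ}
    (h : ∀ᵐ x ∂κ, HasPointwiseDim (κ.map f) (f x) d) :
    HasHausdorffDim (κ.map f) (ENNReal.ofReal d) ∧
      HasPackingDim (κ.map f) (ENNReal.ofReal d) := by
  have hprob : IsProbabilityMeasure (κ.map f) := Measure.isProbabilityMeasure_map hf.aemeasurable
  set ν := κ.map f with hν
  have hd : 0 ≤ d := by
    obtain ⟨x, hx⟩ := h.exists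
    exact hx.nonneg
  have hsupp : ∀ᵐ x ∂κ, f x ∈ ν.support := ae_of_ae_map hf.aemeasurable Measure.support_mem_ae
  have hup : ∀ s, s < d → ∀ᵐ y ∂ν, y ∈ ⋃ n, ballUpperSet ν s n := fun s hs => by
    refine (ae_map_iff hf.aemeasurable
      (MeasurableSet.iUnion fun n => measurableSet_ballUpperSet ν s n)).2 ?_
    filter_upwards [h] with x hx
    exact mem_iUnion.2 (hx.exists_mem_ballUpperSet hs)
  have hlow : ∀ s, d < s → ∀ᵐ y ∂ν, y ∈ ⋃ n, ballLowerSet ν s n := fun s hs => by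
    refine (ae_map_iff hf.aemeasurable
      (MeasurableSet.iUnion fun n => measurableSet_ballLowerSet ν s n)).2 ?_
    filter_upwards [h, hsupp] with x hx hx'
    exact mem_iUnion.2 (hx.exists_mem_ballLowerSet hx' hs)
  have hpos : ∀ Y, 0 < ν Y → ∀ s, s < d → ∃ n, ν (Y ∩ ballUpperSet ν s n) ≠ 0 := by
    intro Y hY s hs
    by_contra hcon
    push Not at hcon
    have h1 := measure_iUnion_null hcon
    rw [← inter_iUnion] at h1
    exact hY.ne' ((measure_inter_conull (hup s hs)).symm.trans h1)
  -- One set of full measure that works for all exponents above `d` attains all four infima.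
  let Y₀ : Set ℝ := ⋂ k : ℕ, ⋃ n, ballLowerSet ν (d + 1 / (k + 1)) n
  have hY₀m : MeasurableSet Y₀ :=
    .iInter fun k => .iUnion fun n => measurableSet_ballLowerSet ν _ n
  have hY₀ : ν Y₀ᶜ = 0 := by
    have : ∀ᵐ y ∂ν, ∀ k : ℕ, y ∈ ⋃ n, ballLowerSet ν (d + 1 / (k + 1)) n :=
      ae_all_iff.2 fun k => hlow _ (by have : (0 : ℝ) < 1 / (k + 1) := by positivity
                                       linarith)
    filter_upwards [this] with y hy
    exact mem_iInter.2 hy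
  have hY₀s : ∀ s, d < s → Y₀ ⊆ ⋃ n, ballLowerSet ν s n := by
    intro s hs y hy
    obtain ⟨k, hk⟩ := exists_nat_one_div_lt (sub_pos.2 hs)
    obtain ⟨n, hn⟩ := mem_iUnion.1 (mem_iInter.1 hy k)
    refine mem_iUnion.2 ⟨n, fun ε hε => (ENNReal.ofReal_le_ofReal ?_).trans (hn ε hε)⟩
    have h1 : ε ≤ 1 := hε.2.le.trans ((div_le_one (by positivity)).2 (by simp))
    exact Real.rpow_le_rpow_of_exponent_ge hε.1 h1 (by linarith)
  have hfull : ∀ Y, ν Yᶜ = 0 → 0 < ν Y := fun Y hY => by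
    rw [pos_iff_ne_zero]
    intro h0
    have h1 : ν univ ≤ ν Y + ν Yᶜ := by rw [← union_compl_self Y]; exact measure_union_le _ _
    rw [hY, h0, measure_univ] at h1
    simp at h1
  have key : ∀ D : Set ℝ → ℝ≥0∞, (∀ Y, MeasurableSet Y → 0 < ν Y → ENNReal.ofReal d ≤ D Y) →
      D Y₀ ≤ ENNReal.ofReal d → lowerDim D ν = ENNReal.ofReal d ∧
        upperDim D ν = ENNReal.ofReal d := by
    intro D h1 h2
    refine ⟨le_antisymm ?_ ?_, le_antisymm ?_ ?_⟩
    · exact iInf_le_of_le Y₀ (iInf₂_le_of_le hY₀m (hfull _ hY₀) h2)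
    · exact le_iInf fun Y => le_iInf₂ fun hYm hY => h1 Y hYm hY
    · exact iInf_le_of_le Y₀ (iInf₂_le_of_le hY₀m hY₀ h2)
    · exact le_iInf fun Y => le_iInf₂ fun hYm hY => h1 Y hYm (hfull _ hY)
  have hlt : ∀ s : ℝ≥0, (s : ℝ≥0∞) < ENNReal.ofReal d → (s : ℝ) < d := fun s hs => by
    rwa [← ENNReal.ofReal_coe_nnreal, ENNReal.ofReal_lt_ofReal_iff_of_nonneg s.coe_nonneg] at hs
  refine ⟨key dimH (fun Y hYm hY => ENNReal.le_of_forall_nnreal_lt fun s hs => ?_)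
    (dimH_le_of_subset_iUnion hd hY₀s), key dimPack
    (fun Y hYm hY => ENNReal.le_of_forall_nnreal_lt fun s hs => ?_)
    (dimPack_le_of_subset_iUnion hY₀s)⟩
  · obtain ⟨n, hn⟩ := hpos Y hY s (hlt s hs)
    exact le_dimH_of_measure_ne_zero hYm hn
  · obtain ⟨s', hs1, hs2⟩ := exists_between (hlt s hs)
    obtain ⟨n, hn⟩ := hpos Y hY s' hs2
    exact le_dimPack_of_measure_ne_zero hs1 hn

end Dimension

/-! ### A maximal inequality, and logarithmic ratios along sequences of radii -/

section Maximal

/-- Weak type inequality for ratios of measures of balls. -/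
theorem exists_measure_ratio_le : ∃ N : ℕ, ∀ (α β : Measure ℝ) (t : ℝ≥0∞) (R : ℝ),
    α {x | ∃ ρ, 0 < ρ ∧ ρ ≤ R ∧
      α (Metric.closedBall x ρ) ≤ t * β (Metric.closedBall x ρ)} ≤ N * (t * β univ) := by
  obtain ⟨N, τ, hτ, hN⟩ := HasBesicovitchCovering.no_satelliteConfig (α := ℝ)
  refine ⟨N, fun α β t R => ?_⟩
  set S : Set ℝ := {x | ∃ ρ, 0 < ρ ∧ ρ ≤ R ∧
      α (Metric.closedBall x ρ) ≤ t * β (Metric.closedBall x ρ)} with hS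
  choose! ρ hρ0 hρR hρ using fun x (hx : x ∈ S) => hx
  -- The balls selected cover `S` and split into `N` disjoint families, each contributing at most
  -- t·β(ℝ). `N` depends only on ℝ, whence the uniformity in the measures.
  obtain ⟨u, hu1, hu2⟩ := Besicovitch.exist_disjoint_covering_families hτ hN
    ({ c := fun x : S => (x : ℝ), r := fun x : S => ρ x, rpos := fun x => hρ0 x x.2,
       r_bound := R, r_le := fun x => hρR x x.2 } : Besicovitch.BallPackage S ℝ)
  simp only [Subtype.range_coe] at hu1 hu2
  have hcount : ∀ i, (u i).Countable := fun i =>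
    (hu1 i).countable_of_nonempty_interior fun j _ =>
      (Metric.nonempty_ball.2 (hρ0 j j.2)).mono Metric.ball_subset_interior_closedBall
  calc α S ≤ α (⋃ i, ⋃ j ∈ u i, Metric.closedBall (j : ℝ) (ρ j)) :=
        measure_mono (hu2.trans (iUnion_mono fun i => iUnion₂_mono fun j _ =>
          Metric.ball_subset_closedBall))
    _ ≤ ∑ i, α (⋃ j ∈ u i, Metric.closedBall (j : ℝ) (ρ j)) := measure_iUnion_fintype_le _ _
    _ ≤ ∑ _i : Fin N, t * β univ := by
        refine Finset.sum_le_sum fun i _ => ?_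
        have hm : ∀ j ∈ u i, MeasurableSet (Metric.closedBall (j : ℝ) (ρ j)) :=
          fun j _ => Metric.isClosed_closedBall.measurableSet
        calc α (⋃ j ∈ u i, Metric.closedBall (j : ℝ) (ρ j)) ≤
              ∑' j : u i, α (Metric.closedBall (j : ℝ) (ρ j)) :=
              measure_biUnion_le _ (hcount i) _
          _ ≤ ∑' j : u i, t * β (Metric.closedBall (j : ℝ) (ρ j)) :=
              ENNReal.tsum_le_tsum fun j => hρ j j.1.2
          _ = t * β (⋃ j ∈ u i, Metric.closedBall (j : ℝ) (ρ j)) := by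
              rw [ENNReal.tsum_mul_left, measure_biUnion (hcount i) (hu1 i) hm]
          _ ≤ t * β univ := by gcongr; exact subset_univ _
    _ = N * (t * β univ) := by simp

/-- A function with exponential tails is integrable. -/
theorem lintegral_ne_top_of_exp_tail {Ω : Type*} [MeasurableSpace Ω] {μ : Measure Ω}
    {G : Ω → ℝ≥0∞} (hG : Measurable G) {C : ℝ≥0∞} (hC : C ≠ ∞)
    (h : ∀ k : ℕ, μ {x | (k : ℝ≥0∞) < G x} ≤ C * ENNReal.ofReal (Real.exp (-1)) ^ k) :
    ∫⁻ x, G x ∂μ ≠ ∞ := by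
  have hm : ∀ k : ℕ, MeasurableSet {x | (k : ℝ≥0∞) < G x} := fun k =>
    measurableSet_lt measurable_const hG
  have h1 : ∀ x, G x ≤ ∑' k : ℕ, {x | (k : ℝ≥0∞) < G x}.indicator 1 x := by
    intro x
    refine le_of_forall_lt fun c hc => ?_
    obtain ⟨n, hn⟩ := ENNReal.exists_nat_gt hc.ne_top
    classical
    have hex : ∃ m : ℕ, c < m := ⟨n, hn⟩
    have hmin : c < (Nat.find hex : ℕ) := Nat.find_spec hex
    have h2 : ∀ k < Nat.find hex, (k : ℝ≥0∞) < G x := fun k hk =>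
      (not_lt.1 (Nat.find_min hex hk)).trans_lt hc
    calc c < (Nat.find hex : ℕ) := hmin
      _ = ∑ k ∈ Finset.range (Nat.find hex), {x | (k : ℝ≥0∞) < G x}.indicator 1 x := by
          have h3 : ∀ k ∈ Finset.range (Nat.find hex),
              {x | (k : ℝ≥0∞) < G x}.indicator (1 : Ω → ℝ≥0∞) x = 1 := fun k hk =>
            indicator_of_mem (s := {x | (k : ℝ≥0∞) < G x}) (h2 k (Finset.mem_range.1 hk)) 1
          rw [Finset.sum_congr rfl h3]
          simp
      _ ≤ _ := ENNReal.sum_le_tsum _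
  refine ne_top_of_le_ne_top ?_ (lintegral_mono h1)
  rw [lintegral_tsum fun k => (measurable_one.indicator (hm k)).aemeasurable]
  simp_rw [lintegral_indicator_one (hm _)]
  refine ne_top_of_le_ne_top ?_ (ENNReal.tsum_le_tsum h)
  rw [ENNReal.tsum_mul_left, ENNReal.tsum_geometric]
  refine ENNReal.mul_ne_top hC (ENNReal.inv_ne_top.2 (tsub_pos_of_lt ?_).ne')
  rw [← ENNReal.ofReal_one]
  exact (ENNReal.ofReal_lt_ofReal_iff one_pos).2 (Real.exp_lt_one_iff.2 (by norm_num))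

/-- Let N(ε) be the first index with ρ_n < ε. Then ε and F(ε) are squeezed between the values at
N(ε) and N(ε) - 1, and a shift of index by one does not affect limits after division by n. -/
theorem tendsto_log_div_log {ρ a : ℕ → ℝ} {F : ℝ → ℝ} {h χ : ℝ} (hχ : 0 < χ)
    (hρ0 : ∀ n, 0 < ρ n) (ha0 : ∀ n, 0 < a n)
    (hρ : Tendsto (fun n : ℕ => Real.log (ρ n) / n) atTop (𝓝 (-χ)))
    (ha : Tendsto (fun n : ℕ => Real.log (a n) / n) atTop (𝓝 (-h)))
    (hF1 : ∀ n ε, ρ n < ε → a n ≤ F ε) (hF2 : ∀ n ε, ε ≤ ρ n → F ε ≤ a n) :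
    Tendsto (fun ε => Real.log (F ε) / Real.log ε) (𝓝[>] 0) (𝓝 (h / χ)) := by
  have hρlim : Tendsto (fun n => Real.log (ρ n)) atTop atBot := by
    have h1 : Tendsto (fun n : ℕ => Real.log (ρ n) / n * n) atTop atBot :=
      hρ.neg_mul_atTop (neg_lt_zero.2 hχ) tendsto_natCast_atTop_atTop
    refine h1.congr' ?_
    filter_upwards [eventually_gt_atTop 0] with n hn
    have : (n : ℝ) ≠ 0 := by positivity
    field_simp
  have hex : ∀ ε > 0, ∃ n, ρ n < ε := by
    intro ε hε
    obtain ⟨n, hn⟩ := (hρlim.eventually (eventually_lt_atBot (Real.log ε))).exists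
    exact ⟨n, (Real.log_lt_log_iff (hρ0 n) hε).1 hn⟩
  let N : ℝ → ℕ := fun ε => sInf {n | ρ n < ε}
  have hN1 : ∀ ε > 0, ρ (N ε) < ε := fun ε hε => Nat.sInf_mem (s := {n | ρ n < ε}) (hex ε hε)
  have hN2 : ∀ ε n, n < N ε → ε ≤ ρ n := fun ε n hn => not_lt.1 (Nat.notMem_of_lt_sInf hn)
  have hNlim : Tendsto N (𝓝[>] 0) atTop := by
    refine tendsto_atTop.2 fun M => ?_
    have h1 : ∀ᶠ ε in 𝓝[>] (0 : ℝ), ∀ n ∈ Finset.range M, ε ≤ ρ n := by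
      rw [Finset.eventually_all]
      intro n _
      filter_upwards [Ioo_mem_nhdsGT (hρ0 n)] with ε hε using hε.2.le
    filter_upwards [h1, self_mem_nhdsWithin] with ε hε hε0
    by_contra hcon
    exact absurd (hε (N ε) (Finset.mem_range.2 (not_le.1 hcon))) (not_le.2 (hN1 ε hε0))
  have hpred : ∀ {u : ℕ → ℝ} {c : ℝ}, Tendsto (fun n : ℕ => u n / n) atTop (𝓝 c) →
      Tendsto (fun n : ℕ => u (n - 1) / n) atTop (𝓝 c) := by
    intro u c hu
    have h1 : Tendsto (fun n : ℕ => u (n - 1) / (n - 1 : ℕ) * (1 - 1 / (n : ℝ))) atTop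
        (𝓝 (c * (1 - 0))) :=
      (hu.comp (tendsto_sub_atTop_nat 1)).mul
        (tendsto_const_nhds.sub tendsto_one_div_atTop_nhds_zero_nat)
    rw [sub_zero, mul_one] at h1
    refine h1.congr' ?_
    filter_upwards [eventually_gt_atTop 1] with n hn
    have h2 : (1 : ℝ) < n := by exact_mod_cast hn
    have h3 : (n : ℝ) - 1 ≠ 0 := by linarith
    rw [Nat.cast_sub hn.le, Nat.cast_one]
    field_simp
  have hev : ∀ᶠ ε in 𝓝[>] (0 : ℝ), 0 < ε ∧ 0 < N ε := by
    filter_upwards [self_mem_nhdsWithin, hNlim.eventually (eventually_gt_atTop 0)] with ε h1 h2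
    exact ⟨h1, h2⟩
  have hFlim : Tendsto (fun ε => Real.log (F ε) / N ε) (𝓝[>] 0) (𝓝 (-h)) := by
    refine tendsto_of_tendsto_of_tendsto_of_le_of_le' (ha.comp hNlim) ((hpred ha).comp hNlim) ?_ ?_
    · filter_upwards [hev] with ε hε
      have h1 := hF1 (N ε) ε (hN1 ε hε.1)
      exact div_le_div_of_nonneg_right (Real.log_le_log (ha0 _) h1) (Nat.cast_nonneg _)
    · filter_upwards [hev] with ε hε
      have h1 := hF1 (N ε) ε (hN1 ε hε.1)
      have h2 := hF2 (N ε - 1) ε (hN2 ε _ (Nat.sub_lt hε.2 one_pos))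
      exact div_le_div_of_nonneg_right (Real.log_le_log ((ha0 _).trans_le h1) h2)
        (Nat.cast_nonneg _)
  have hεlim : Tendsto (fun ε => Real.log ε / N ε) (𝓝[>] 0) (𝓝 (-χ)) := by
    refine tendsto_of_tendsto_of_tendsto_of_le_of_le' (hρ.comp hNlim) ((hpred hρ).comp hNlim) ?_ ?_
    · filter_upwards [hev] with ε hε
      exact div_le_div_of_nonneg_right (Real.log_le_log (hρ0 _) (hN1 ε hε.1).le)
        (Nat.cast_nonneg _)
    · filter_upwards [hev] with ε hε
      exact div_le_div_of_nonneg_right (Real.log_le_log hε.1 (hN2 ε _ (Nat.sub_lt hε.2 one_pos)))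
        (Nat.cast_nonneg _)
  have := hFlim.div hεlim (neg_ne_zero.2 hχ.ne')
  rw [neg_div_neg_eq] at this
  refine this.congr' ?_
  filter_upwards [hev] with ε hε
  have h1 : (N ε : ℝ) ≠ 0 := by exact_mod_cast hε.2.ne'
  simp only [Pi.div_apply]
  rw [div_div_div_cancel_right₀ h1]

end Maximal

/-! ### Conditional probabilities given the value of a fibred random variable -/

section Fibre

variable {Λ Ω : Type*} [MeasurableSpace Λ] [MeasurableSpace Ω] (ν : Measure Ω)
  (p : Λ → Ω → ℝ) (R : ℕ → Λ → ℝ)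

/-- The law of `p l` restricted to the event `A`. -/
def fibreLaw (A : Set Ω) (l : Λ) : Measure ℝ := (ν.restrict A).map (p l)

/-- The conditional probability of `A` given that `p l` is within `R n l` of `y`. -/
def ballRatio (A : Set Ω) (n : ℕ) (l : Λ) (y : ℝ) : ℝ≥0∞ :=
  fibreLaw ν p A l (Metric.closedBall y (R n l)) /
    fibreLaw ν p univ l (Metric.closedBall y (R n l))

/-- The conditional probability of `A` given `l` and the value `y` of `p l`. -/
@[irreducible] def condDensity (A : Set Ω) (l : Λ) (y : ℝ) : ℝ≥0∞ :=
  limsup (fun n => ballRatio ν p R A n l y) atTop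

theorem fibreLaw_univ (l : Λ) : fibreLaw ν p univ l = ν.map (p l) := by
  rw [fibreLaw, Measure.restrict_univ]

instance [IsFiniteMeasure ν] (A : Set Ω) (l : Λ) : IsFiniteMeasure (fibreLaw ν p A l) := by
  unfold fibreLaw; infer_instance

variable {p} (hp : Measurable fun x : Λ × Ω => p x.1 x.2)

include hp

theorem measurable_fibre (l : Λ) : Measurable (p l) := hp.comp measurable_prodMk_left

theorem isProbabilityMeasure_fibreLaw_univ [IsProbabilityMeasure ν] (l : Λ) :
    IsProbabilityMeasure (fibreLaw ν p univ l) := by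
  rw [fibreLaw_univ]
  exact Measure.isProbabilityMeasure_map (measurable_fibre hp l).aemeasurable

theorem fibreLaw_apply {A : Set Ω} (l : Λ) {B : Set ℝ} (hB : MeasurableSet B) :
    fibreLaw ν p A l B = ν (p l ⁻¹' B ∩ A) := by
  rw [fibreLaw, Measure.map_apply (measurable_fibre hp l) hB,
    Measure.restrict_apply (measurable_fibre hp l hB)]

theorem fibreLaw_le (A : Set Ω) (l : Λ) : fibreLaw ν p A l ≤ fibreLaw ν p univ l :=
  Measure.map_mono (Measure.restrict_mono (subset_univ A) le_rfl) (measurable_fibre hp l)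

theorem measurable_fibreLaw_closedBall [SFinite ν] {A : Set Ω} (hA : MeasurableSet A) {ρ : Λ → ℝ}
    (hρ : Measurable ρ) :
    Measurable fun z : Λ × ℝ => fibreLaw ν p A z.1 (Metric.closedBall z.2 (ρ z.1)) := by
  have hs : MeasurableSet {z : (Λ × ℝ) × Ω | |p z.1.1 z.2 - z.1.2| ≤ ρ z.1.1 ∧ z.2 ∈ A} := by
    refine MeasurableSet.inter (measurableSet_le ?_ (hρ.comp (measurable_fst.comp measurable_fst))) (measurable_snd hA)
    exact ((hp.comp ((measurable_fst.comp measurable_fst).prodMk measurable_snd)).sub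
      (measurable_snd.comp measurable_fst)).abs
  have h : (fun z : Λ × ℝ => fibreLaw ν p A z.1 (Metric.closedBall z.2 (ρ z.1))) = fun z =>
      ν (Prod.mk z ⁻¹' {z : (Λ × ℝ) × Ω | |p z.1.1 z.2 - z.1.2| ≤ ρ z.1.1 ∧ z.2 ∈ A}) := by
    funext z
    rw [fibreLaw_apply ν hp _ Metric.isClosed_closedBall.measurableSet]
    rfl
  rw [h]
  exact measurable_measure_prodMk_left hs

theorem ballRatio_le_one (A : Set Ω) (n : ℕ) (l : Λ) (y : ℝ) : ballRatio ν p R A n l y ≤ 1 :=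
  ENNReal.div_le_of_le_mul (by rw [one_mul]; exact fibreLaw_le ν hp A l _)

theorem condDensity_le_one (A : Set Ω) (l : Λ) (y : ℝ) : condDensity ν p R A l y ≤ 1 := by
  rw [condDensity]
  exact limsup_le_of_le (by isBoundedDefault)
    (Eventually.of_forall fun n => ballRatio_le_one ν R hp A n l y)

variable {R} (hR : ∀ n, Measurable (R n))

include hR

theorem measurable_ballRatio [SFinite ν] {A : Set Ω} (hA : MeasurableSet A) (n : ℕ) :
    Measurable fun z : Λ × ℝ => ballRatio ν p R A n z.1 z.2 :=
  (measurable_fibreLaw_closedBall ν hp hA (hR n)).div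
    (measurable_fibreLaw_closedBall ν hp .univ (hR n))

/-- Joint measurability is what the definition by a limsup of ball ratios provides; Radon–Nikodym
derivatives chosen separately for each `l` would not give it. -/
theorem measurable_condDensity [SFinite ν] {A : Set Ω} (hA : MeasurableSet A) :
    Measurable fun z : Λ × ℝ => condDensity ν p R A z.1 z.2 := by
  simp only [condDensity]
  exact Measurable.limsup fun n => measurable_ballRatio ν hp hR hA n

theorem measurable_ballRatio_comp [SFinite ν] {A : Set Ω} (hA : MeasurableSet A) (n : ℕ) :
    Measurable fun x : Λ × Ω => ballRatio ν p R A n x.1 (p x.1 x.2) :=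
  (measurable_ballRatio ν hp hR hA n).comp
    (g := fun z : Λ × ℝ => ballRatio ν p R A n z.1 z.2) (measurable_fst.prodMk hp)

theorem measurable_condDensity_comp [SFinite ν] {A : Set Ω} (hA : MeasurableSet A) :
    Measurable fun x : Λ × Ω => condDensity ν p R A x.1 (p x.1 x.2) :=
  (measurable_condDensity ν hp hR hA).comp
    (g := fun z : Λ × ℝ => condDensity ν p R A z.1 z.2) (measurable_fst.prodMk hp)

variable (hR0 : ∀ n l, 0 < R n l) (hRlim : ∀ l, Tendsto (fun n => R n l) atTop (𝓝 0))

omit hR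

include hR0 hRlim

theorem ae_tendsto_ballRatio [IsFiniteMeasure ν] (A : Set Ω) (l : Λ) :
    ∀ᵐ y ∂fibreLaw ν p univ l, Tendsto (fun n => ballRatio ν p R A n l y) atTop
      (𝓝 (condDensity ν p R A l y)) ∧ condDensity ν p R A l y =
        (fibreLaw ν p A l).rnDeriv (fibreLaw ν p univ l) y := by
  filter_upwards [Besicovitch.ae_tendsto_rnDeriv (fibreLaw ν p A l) (fibreLaw ν p univ l)]
    with y hy
  have h1 : Tendsto (fun n => ballRatio ν p R A n l y) atTop
      (𝓝 ((fibreLaw ν p A l).rnDeriv (fibreLaw ν p univ l) y)) :=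
    hy.comp (tendsto_nhdsWithin_iff.2 ⟨hRlim l, Eventually.of_forall fun n => hR0 n l⟩)
  have h2 := h1.limsup_eq
  rw [condDensity, h2]
  exact ⟨h1, rfl⟩

theorem setLIntegral_condDensity [IsFiniteMeasure ν] (A : Set Ω) (l : Λ) (S : Set ℝ) :
    ∫⁻ y in S, condDensity ν p R A l y ∂fibreLaw ν p univ l = fibreLaw ν p A l S := by
  rw [← Measure.setLIntegral_rnDeriv (fibreLaw_le ν hp A l).absolutelyContinuous S]
  refine lintegral_congr_ae (ae_restrict_of_ae ?_)
  filter_upwards [ae_tendsto_ballRatio ν hp hR0 hRlim A l] with y hy using hy.2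

include hR

theorem ae_tendsto_ballRatio_prod [IsFiniteMeasure ν] (m : Measure Λ) [SFinite m] {A : Set Ω}
    (hA : MeasurableSet A) :
    ∀ᵐ x ∂m.prod ν, Tendsto (fun n => ballRatio ν p R A n x.1 (p x.1 x.2)) atTop
      (𝓝 (condDensity ν p R A x.1 (p x.1 x.2))) := by
  refine (Measure.ae_prod_iff_ae_ae (measurableSet_tendsto_fun
    (fun n => measurable_ballRatio_comp ν hp hR hA n)
    (measurable_condDensity_comp ν hp hR hA))).2 (ae_of_all _ fun l => ?_)
  have h := ae_tendsto_ballRatio ν hp hR0 hRlim A l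
  rw [fibreLaw_univ] at h
  filter_upwards [ae_of_ae_map (measurable_fibre hp l).aemeasurable h] with ω hω using hω.1

/-- A density is positive almost everywhere for the measure that it defines, here the law restricted
to `A`. -/
theorem ae_condDensity_pos [IsFiniteMeasure ν] (m : Measure Λ) [SFinite m] {A : Set Ω}
    (hA : MeasurableSet A) :
    ∀ᵐ x ∂m.prod ν, x.2 ∈ A → 0 < condDensity ν p R A x.1 (p x.1 x.2) := by
  have hm : MeasurableSet {x : Λ × Ω | x.2 ∈ A → 0 < condDensity ν p R A x.1 (p x.1 x.2)} := by
    have h1 : MeasurableSet {x : Λ × Ω | 0 < condDensity ν p R A x.1 (p x.1 x.2)} :=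
      measurableSet_lt measurable_const (measurable_condDensity_comp ν hp hR hA)
    have h2 : MeasurableSet {x : Λ × Ω | x.2 ∈ A} := measurable_snd hA
    convert h2.compl.union h1 using 1
    ext x
    simp only [mem_ofPred_eq, mem_union, mem_compl_iff, imp_iff_not_or]
  refine (Measure.ae_prod_iff_ae_ae hm).2 (ae_of_all _ fun l => ?_)
  have hac := (fibreLaw_le ν hp A l).absolutelyContinuous
  have h : ∀ᵐ y ∂fibreLaw ν p A l, 0 < condDensity ν p R A l y := by
    filter_upwards [hac.ae_le (ae_tendsto_ballRatio ν hp hR0 hRlim A l), Measure.rnDeriv_pos hac]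
      with y h1 h2
    rw [h1.2]
    exact h2
  have h' := ae_of_ae_map (measurable_fibre hp l).aemeasurable h
  exact (ae_restrict_iff' hA).1 h'

/-- `condDensity` is a version of the conditional expectation. -/
theorem condDensity_ae_eq_condExp [IsProbabilityMeasure ν] (m : Measure Λ)
    [IsProbabilityMeasure m] {A : Set Ω} (hA : MeasurableSet A) :
    (fun x : Λ × Ω => (condDensity ν p R A x.1 (p x.1 x.2)).toReal) =ᵐ[m.prod ν]
      (m.prod ν)[(Prod.snd ⁻¹' A).indicator (fun _ => (1 : ℝ)) |
        MeasurableSpace.comap (Prod.fst : Λ × Ω → Λ) inferInstance ⊔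
          MeasurableSpace.comap (fun x : Λ × Ω => p x.1 x.2) (borel ℝ)] := by
  have hg : Measurable fun x : Λ × Ω => (x.1, p x.1 x.2) := measurable_fst.prodMk hp
  have hcomap : MeasurableSpace.comap (Prod.fst : Λ × Ω → Λ) inferInstance ⊔
      MeasurableSpace.comap (fun x : Λ × Ω => p x.1 x.2) (borel ℝ) =
      MeasurableSpace.comap (fun x : Λ × Ω => (x.1, p x.1 x.2)) inferInstance := by
    rw [← BorelSpace.measurable_eq (α := ℝ)]
    exact (MeasurableSpace.comap_prodMk _ _).symm
  rw [hcomap]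
  have hle : MeasurableSpace.comap (fun x : Λ × Ω => (x.1, p x.1 x.2)) inferInstance ≤
      (inferInstance : MeasurableSpace (Λ × Ω)) := hg.comap_le
  have hAm : MeasurableSet (Prod.snd ⁻¹' A : Set (Λ × Ω)) := measurable_snd hA
  have hdm := measurable_condDensity_comp ν hp hR hA
  have hle1 : ∀ x : Λ × Ω, condDensity ν p R A x.1 (p x.1 x.2) ≤ 1 := fun x =>
    condDensity_le_one ν R hp A _ _
  have hint : Integrable (fun x : Λ × Ω => (condDensity ν p R A x.1 (p x.1 x.2)).toReal)
      (m.prod ν) := by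
    refine Integrable.mono' (integrable_const (1 : ℝ)) hdm.ennreal_toReal.aestronglyMeasurable
      (ae_of_all _ fun x => ?_)
    rw [Real.norm_eq_abs, abs_of_nonneg ENNReal.toReal_nonneg]
    exact ENNReal.toReal_le_of_le_ofReal zero_le_one (by simpa using hle1 x)
  refine ae_eq_condExp_of_forall_setIntegral_eq hle
    ((integrable_const _).indicator hAm) (fun s _ _ => hint.integrableOn) ?_ ?_
  · rintro _ ⟨S, hS, rfl⟩ -
    have hSm : MeasurableSet ((fun x : Λ × Ω => (x.1, p x.1 x.2)) ⁻¹' S) := hg hS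
    -- By Fubini this reduces to each fibre, where it is the defining property of the density.
    have h1 : ∫⁻ x in (fun x : Λ × Ω => (x.1, p x.1 x.2)) ⁻¹' S,
        condDensity ν p R A x.1 (p x.1 x.2) ∂m.prod ν =
        (m.prod ν) ((fun x : Λ × Ω => (x.1, p x.1 x.2)) ⁻¹' S ∩ Prod.snd ⁻¹' A) := by
      rw [← lintegral_indicator hSm, lintegral_prod _ (hdm.indicator hSm).aemeasurable,
        Measure.prod_apply (hSm.inter hAm)]
      refine lintegral_congr fun l => ?_
      have hSl : MeasurableSet (Prod.mk l ⁻¹' S) := measurable_prodMk_left hS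
      have hpl := measurable_fibre hp l
      have hdl : Measurable fun y => condDensity ν p R A l y :=
        (measurable_condDensity ν hp hR hA).comp measurable_prodMk_left
      have h2 := setLIntegral_condDensity ν hp hR0 hRlim A l (Prod.mk l ⁻¹' S)
      rw [fibreLaw_univ, ← lintegral_indicator hSl,
        lintegral_map (hdl.indicator hSl) hpl, fibreLaw_apply ν hp l hSl] at h2
      exact h2
    have h3 : ∫ x in (fun x : Λ × Ω => (x.1, p x.1 x.2)) ⁻¹' S,
        (Prod.snd ⁻¹' A).indicator (fun _ => (1 : ℝ)) x ∂m.prod ν =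
        ((m.prod ν).restrict ((fun x : Λ × Ω => (x.1, p x.1 x.2)) ⁻¹' S)).real (Prod.snd ⁻¹' A) :=
      integral_indicator_one hAm
    rw [integral_toReal hdm.aemeasurable.restrict
      (ae_of_all _ fun x => (hle1 x).trans_lt ENNReal.one_lt_top), h3,
      measureReal_def, Measure.restrict_apply hAm, inter_comm, h1]
  · refine Measurable.aestronglyMeasurable ?_
    exact (measurable_condDensity ν hp hR hA).ennreal_toReal.comp
      (g := fun z : Λ × ℝ => (condDensity ν p R A z.1 z.2).toReal) (comap_measurable _)

omit hR hRlim

/-- Tails of the supremum over `n` of the information of `A` in the balls of radius `R n l`. -/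
theorem exists_measure_ballRatio_le : ∃ C : ℝ≥0∞, C ≠ ∞ ∧ ∀ (ν : Measure Ω)
    [IsProbabilityMeasure ν] {R₀ : ℝ} (_ : ∀ n l, R n l ≤ R₀) (A : Set Ω) (l : Λ) (t : ℝ≥0∞),
    ν {ω | ω ∈ A ∧ ∃ n, ballRatio ν p R A n l (p l ω) ≤ t} ≤ C * t := by
  obtain ⟨N, hN⟩ := exists_measure_ratio_le
  refine ⟨N, ENNReal.natCast_ne_top N, fun ν _ R₀ hR₀ A l t => ?_⟩
  have := isProbabilityMeasure_fibreLaw_univ ν hp l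
  have h := hN (fibreLaw ν p A l) (fibreLaw ν p univ l) t R₀
  rw [measure_univ, mul_one] at h
  refine le_trans ?_ h
  refine le_trans ?_ ((Measure.le_restrict_apply _ _).trans
    (Measure.le_map_apply (measurable_fibre hp l).aemeasurable _))
  refine measure_mono ?_
  rintro ω ⟨hω, n, hn⟩
  refine ⟨⟨R n l, hR0 n l, hR₀ n l, ?_⟩, hω⟩
  set B := Metric.closedBall (p l ω) (R n l) with hB
  rcases eq_or_ne (fibreLaw ν p univ l B) 0 with h0 | h0
  · exact ((fibreLaw_le ν hp A l B).trans h0.le).trans zero_le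
  · rwa [ballRatio, ENNReal.div_le_iff_le_mul (Or.inl h0) (Or.inl (measure_ne_top _ _))] at hn

end Fibre

/-! ### The information of the first letter -/

section Information

theorem measurable_apply_of_countable {Ω ι β : Type*} [MeasurableSpace Ω] [MeasurableSpace ι]
    [MeasurableSpace β] [Countable ι] [MeasurableSingletonClass ι] {g : Ω → ι} (hg : Measurable g)
    {F : ι → Ω → β} (hF : ∀ i, Measurable (F i)) : Measurable fun x => F (g x) x := by
  intro s hs
  have : (fun x => F (g x) x) ⁻¹' s = ⋃ i, g ⁻¹' {i} ∩ F i ⁻¹' s := by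
    ext x; simp
  rw [this]
  exact .iUnion fun i => (hg (measurableSet_singleton i)).inter (hF i hs)

variable {Λ E : Type*} [MeasurableSpace Λ] [Fintype E] [MeasurableSpace E]
  [MeasurableSingletonClass E] (ν : Measure (ℕ → E)) (p : Λ → (ℕ → E) → ℝ) (R : ℕ → Λ → ℝ)

/-- The sequences with first letter `e`. -/
def headSet (e : E) : Set (ℕ → E) := {ω | ω 0 = e}

theorem measurableSet_headSet (e : E) : MeasurableSet (headSet e) :=
  measurable_pi_apply (X := fun _ : ℕ => E) 0 (measurableSet_singleton e)

/-- The information of the first letter given the ball of radius `R n l` around `p l ω`. -/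
def ballInfo (n : ℕ) (x : Λ × (ℕ → E)) : ℝ :=
  -Real.log (ballRatio ν p R (headSet (x.2 0)) n x.1 (p x.1 x.2)).toReal

/-- The information of the first letter given `l` and `p l ω`. -/
def condInfo (x : Λ × (ℕ → E)) : ℝ :=
  -Real.log (condDensity ν p R (headSet (x.2 0)) x.1 (p x.1 x.2)).toReal

variable {p R} (hp : Measurable fun x : Λ × (ℕ → E) => p x.1 x.2)
  (hR : ∀ n, Measurable (R n)) (hR0 : ∀ n l, 0 < R n l)
  (hRlim : ∀ l, Tendsto (fun n => R n l) atTop (𝓝 0))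

theorem measurable_head : Measurable fun x : Λ × (ℕ → E) => x.2 0 :=
  (measurable_pi_apply 0).comp measurable_snd

include hp

theorem ballInfo_nonneg (n : ℕ) (x : Λ × (ℕ → E)) : 0 ≤ ballInfo ν p R n x :=
  neg_nonneg.2 (Real.log_nonpos ENNReal.toReal_nonneg
    (ENNReal.toReal_le_of_le_ofReal zero_le_one
      (by simpa using ballRatio_le_one ν R hp (headSet (x.2 0)) n x.1 (p x.1 x.2))))

theorem condInfo_nonneg (x : Λ × (ℕ → E)) : 0 ≤ condInfo ν p R x :=
  neg_nonneg.2 (Real.log_nonpos ENNReal.toReal_nonneg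
    (ENNReal.toReal_le_of_le_ofReal zero_le_one
      (by simpa using condDensity_le_one ν R hp (headSet (x.2 0)) x.1 (p x.1 x.2))))

include hR

theorem measurable_ballInfo [SFinite ν] (n : ℕ) : Measurable (ballInfo ν p R n) :=
  measurable_apply_of_countable measurable_head
    (F := fun e x => -Real.log (ballRatio ν p R (headSet e) n x.1 (p x.1 x.2)).toReal)
    fun e => (measurable_ballRatio_comp ν hp hR (measurableSet_headSet e) n).ennreal_toReal.log.neg

theorem measurable_condInfo [SFinite ν] : Measurable (condInfo ν p R) :=
  measurable_apply_of_countable measurable_head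
    (F := fun e x => -Real.log (condDensity ν p R (headSet e) x.1 (p x.1 x.2)).toReal)
    fun e => (measurable_condDensity_comp ν hp hR (measurableSet_headSet e)).ennreal_toReal.log.neg

include hR0

/-- The supremum over `n` exceeds k only if some ball ratio of the observed letter is at most
e^{-k}. The weak type inequality bounds this by C e^{-k} for each letter, uniformly in `l`, so the
tails are exponential. -/
theorem exists_integrable_ballInfo_le [IsProbabilityMeasure ν] (m : Measure Λ)
    [IsProbabilityMeasure m] {R₀ : ℝ} (hR₀ : ∀ n l, R n l ≤ R₀) :
    ∃ G : Λ × (ℕ → E) → ℝ, Integrable G (m.prod ν) ∧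
      ∀ᵐ x ∂m.prod ν, ∀ n, |ballInfo ν p R n x| ≤ G x := by
  set G : Λ × (ℕ → E) → ℝ≥0∞ := fun x => ⨆ n, ENNReal.ofReal (ballInfo ν p R n x) with hG
  have hGm : Measurable G :=
    Measurable.iSup fun n => (measurable_ballInfo ν hp hR n).ennreal_ofReal
  obtain ⟨C, hC, hC'⟩ := exists_measure_ballRatio_le (Ω := ℕ → E) hp hR0
  have hint : ∫⁻ x, G x ∂m.prod ν ≠ ∞ := by
    refine lintegral_ne_top_of_exp_tail hGm
      (C := Fintype.card E * C) (ENNReal.mul_ne_top (ENNReal.natCast_ne_top _) hC) fun k => ?_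
    rw [Measure.prod_apply (measurableSet_lt measurable_const hGm)]
    have hslice : ∀ l, ν (Prod.mk l ⁻¹' {x | (k : ℝ≥0∞) < G x}) ≤
        Fintype.card E * C * ENNReal.ofReal (Real.exp (-1)) ^ k := by
      intro l
      set t := ENNReal.ofReal (Real.exp (-1)) ^ k with ht
      have hsub : Prod.mk l ⁻¹' {x | (k : ℝ≥0∞) < G x} ⊆
          ⋃ e, {ω | ω ∈ headSet e ∧ ∃ n, ballRatio ν p R (headSet e) n l (p l ω) ≤ t} := by
        intro ω hω
        obtain ⟨n, hn⟩ := lt_iSup_iff.1 (show (k : ℝ≥0∞) < G (l, ω) from hω)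
        refine mem_iUnion.2 ⟨ω 0, rfl, n, ?_⟩
        rw [← ENNReal.ofReal_natCast, ENNReal.ofReal_lt_ofReal_iff_of_nonneg k.cast_nonneg] at hn
        have hn' : (k : ℝ) <
          -Real.log (ballRatio ν p R (headSet (ω 0)) n l (p l ω)).toReal := hn
        set q := ballRatio ν p R (headSet (ω 0)) n l (p l ω) with hq
        have hq1 : q ≠ ∞ := ne_top_of_le_ne_top ENNReal.one_ne_top
          (ballRatio_le_one ν R hp _ n l _)
        rw [← ENNReal.ofReal_toReal hq1, ht, ← ENNReal.ofReal_pow (Real.exp_pos _).le,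
          ← Real.exp_nat_mul]
        refine ENNReal.ofReal_le_ofReal ?_
        rcases (ENNReal.toReal_nonneg (a := q)).eq_or_lt with h0 | h0
        · rw [← h0]; exact (Real.exp_pos _).le
        · rw [← Real.log_le_iff_le_exp h0]
          linarith
      calc ν (Prod.mk l ⁻¹' {x | (k : ℝ≥0∞) < G x}) ≤ ∑ e : E,
            ν {ω | ω ∈ headSet e ∧ ∃ n, ballRatio ν p R (headSet e) n l (p l ω) ≤ t} :=
            (measure_mono hsub).trans (measure_iUnion_fintype_le _ _)
        _ ≤ ∑ _e : E, C * t := Finset.sum_le_sum fun e _ => hC' ν hR₀ (headSet e) l t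
        _ = Fintype.card E * C * t := by simp [mul_assoc]
    calc ∫⁻ l, ν (Prod.mk l ⁻¹' {x | (k : ℝ≥0∞) < G x}) ∂m ≤
          ∫⁻ _l, Fintype.card E * C * ENNReal.ofReal (Real.exp (-1)) ^ k ∂m :=
          lintegral_mono hslice
      _ = _ := by simp
  refine ⟨fun x => (G x).toReal, integrable_toReal_of_lintegral_ne_top hGm.aemeasurable hint, ?_⟩
  filter_upwards [ae_lt_top hGm hint] with x hx n
  rw [abs_of_nonneg (ballInfo_nonneg ν hp n x)]
  exact (ENNReal.ofReal_le_iff_le_toReal hx.ne).1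
    (le_iSup (fun n => ENNReal.ofReal (ballInfo ν p R n x)) n)

include hRlim

/-- Positivity of the limiting density at the observed letter lets the logarithm pass to the limit.
-/
theorem ae_tendsto_ballInfo [IsProbabilityMeasure ν] (m : Measure Λ) [IsProbabilityMeasure m] :
    ∀ᵐ x ∂m.prod ν, Tendsto (fun n => ballInfo ν p R n x) atTop (𝓝 (condInfo ν p R x)) := by
  filter_upwards [ae_all_iff.2 fun e : E =>
      ae_tendsto_ballRatio_prod ν hp hR hR0 hRlim m (measurableSet_headSet e),
    ae_all_iff.2 fun e : E =>
      ae_condDensity_pos ν hp hR hR0 hRlim m (measurableSet_headSet e)] with x h1 h2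
  have h3 := h2 (x.2 0) rfl
  have h4 : condDensity ν p R (headSet (x.2 0)) x.1 (p x.1 x.2) ≠ ∞ :=
    ne_top_of_le_ne_top ENNReal.one_ne_top (condDensity_le_one ν R hp _ _ _)
  exact (((ENNReal.tendsto_toReal h4).comp (h1 (x.2 0))).log
    (ENNReal.toReal_pos h3.ne' h4).ne').neg

theorem condPartitionEntropy_eq_integral_condInfo [IsProbabilityMeasure ν] (m : Measure Λ)
    [IsProbabilityMeasure m] :
    condPartitionEntropy (m.prod ν) (fun x => x.2 0)
      (MeasurableSpace.comap (Prod.fst : Λ × (ℕ → E) → Λ) inferInstance ⊔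
        MeasurableSpace.comap (fun x : Λ × (ℕ → E) => p x.1 x.2) (borel ℝ)) =
      ∫ x, condInfo ν p R x ∂m.prod ν := by
  refine integral_congr_ae ?_
  filter_upwards [ae_all_iff.2 fun e : E =>
    condDensity_ae_eq_condExp ν hp hR hR0 hRlim m (measurableSet_headSet e)] with x hx
  rw [condInfo, Finset.sum_eq_single (x.2 0), hx (x.2 0)]
  · exact congrArg Neg.neg (indicator_of_mem
      (s := (fun y : Λ × (ℕ → E) => y.2 0) ⁻¹' {x.2 0}) (mem_singleton _) _)
  · intro e _ he
    exact indicator_of_notMem (s := (fun y : Λ × (ℕ → E) => y.2 0) ⁻¹' {e})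
      (fun h => he (mem_singleton_iff.1 h).symm) _
  · simp

/-- Convergence of the information gained along the orbit. -/
theorem ae_tendsto_sum_ballInfo [IsProbabilityMeasure ν] (m : Measure Λ) [IsProbabilityMeasure m]
    {T : Λ × (ℕ → E) → Λ × (ℕ → E)} (hT : Ergodic T (m.prod ν)) {R₀ : ℝ}
    (hR₀ : ∀ n l, R n l ≤ R₀) :
    ∀ᵐ x ∂m.prod ν, Tendsto
      (fun n : ℕ => (∑ k ∈ Finset.range n, ballInfo ν p R (n - k) (T^[k] x)) / n) atTop
      (𝓝 (∫ y, condInfo ν p R y ∂m.prod ν)) := by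
  obtain ⟨G, hG, hb⟩ := exists_integrable_ballInfo_le ν hp hR hR0 m hR₀
  exact tendsto_maker hT (measurable_ballInfo ν hp hR) (measurable_condInfo ν hp hR) hG hb
    (ae_tendsto_ballInfo ν hp hR hR0 hRlim m)

end Information

/-! ### The coding map -/

section Coding

variable {Λ E : Type*} {θ : Λ → Λ} {φ : Λ → E → ℝ → ℝ} {X : Set ℝ} {s : ℝ≥0}

theorem codingMap_mem_image (hs : s < 1) (hX : IsCompact X) (hne : X.Nonempty)
    (hm : ∀ l e, MapsTo (φ l e) X X) (hl : ∀ l e, LipschitzOnWith s (φ l e) X)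
    (n : ℕ) (l : Λ) (ω : ℕ → E) :
    codingMap θ φ X l ω ∈ cylinderMap θ φ n l ω '' X := by
  have h : codingMap θ φ X l ω ∈ ⋂ n : ℕ, cylinderMap θ φ (n + 1) l ω '' X := by
    rw [iInter_eq_singleton_codingMap hs hX hne hm hl]
    exact mem_singleton _
  exact cylinderMap_succ_subset hm n l ω (mem_iInter.1 h n)

theorem codingMap_mem (hs : s < 1) (hX : IsCompact X) (hne : X.Nonempty)
    (hm : ∀ l e, MapsTo (φ l e) X X) (hl : ∀ l e, LipschitzOnWith s (φ l e) X)
    (l : Λ) (ω : ℕ → E) : codingMap θ φ X l ω ∈ X := by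
  simpa [cylinderMap] using codingMap_mem_image (θ := θ) hs hX hne hm hl 0 l ω

theorem codingMap_eq (hs : s < 1) (hX : IsCompact X) (hne : X.Nonempty)
    (hm : ∀ l e, MapsTo (φ l e) X X) (hl : ∀ l e, LipschitzOnWith s (φ l e) X)
    (l : Λ) (ω : ℕ → E) :
    codingMap θ φ X l ω = φ l (ω 0) (codingMap θ φ X (θ l) (shiftN ω)) := by
  have h : φ l (ω 0) (codingMap θ φ X (θ l) (shiftN ω)) ∈
      ⋂ n : ℕ, cylinderMap θ φ (n + 1) l ω '' X := by
    refine mem_iInter.2 fun n => ?_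
    obtain ⟨y, hy, hyx⟩ := codingMap_mem_image (θ := θ) hs hX hne hm hl n (θ l) (shiftN ω)
    exact ⟨y, hy, congrArg (φ l (ω 0)) hyx⟩
  rw [iInter_eq_singleton_codingMap hs hX hne hm hl] at h
  exact (mem_singleton_iff.1 h).symm

theorem measurable_shiftN [MeasurableSpace E] : Measurable (shiftN : (ℕ → E) → ℕ → E) :=
  measurable_pi_lambda _ fun n => measurable_pi_apply (n + 1)

theorem measurable_cylinderMap [MeasurableSpace Λ] [MeasurableSpace E] (hθ : Measurable θ)
    (hφ : Measurable fun z : Λ × E × ℝ => φ z.1 z.2.1 z.2.2) (c : ℝ) (n : ℕ) :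
    Measurable fun x : Λ × (ℕ → E) => cylinderMap θ φ n x.1 x.2 c := by
  induction n with
  | zero => exact measurable_const
  | succ n ih =>
    have h2 : Measurable fun x : Λ × (ℕ → E) =>
        cylinderMap θ φ n (θ x.1) (shiftN x.2) c :=
      ih.comp ((hθ.comp measurable_fst).prodMk (measurable_shiftN.comp measurable_snd))
    exact hφ.comp (measurable_fst.prodMk
      (((measurable_pi_apply 0).comp measurable_snd).prodMk h2))

/-- Uniform contraction makes it the pointwise limit of finite compositions applied to one fixed
point. -/
theorem measurable_codingMap [MeasurableSpace Λ] [MeasurableSpace E] (hs : s < 1)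
    (hX : IsCompact X) (hne : X.Nonempty)
    (hm : ∀ l e, MapsTo (φ l e) X X) (hl : ∀ l e, LipschitzOnWith s (φ l e) X)
    (hθ : Measurable θ) (hφ : Measurable fun z : Λ × E × ℝ => φ z.1 z.2.1 z.2.2) :
    Measurable fun x : Λ × (ℕ → E) => codingMap θ φ X x.1 x.2 := by
  obtain ⟨c, hc⟩ := hne
  refine measurable_of_tendsto_metrizable (f := fun n (x : Λ × (ℕ → E)) =>
    cylinderMap θ φ n x.1 x.2 c) (measurable_cylinderMap hθ hφ c) ?_
  refine tendsto_pi_nhds.2 fun x => tendsto_iff_dist_tendsto_zero.2 ?_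
  have ht : Tendsto (fun n : ℕ => (s : ℝ) ^ n * Metric.diam X) atTop (𝓝 0) := by
    simpa using (tendsto_pow_atTop_nhds_zero_of_lt_one s.coe_nonneg
      (by exact_mod_cast hs)).mul_const (Metric.diam X)
  refine squeeze_zero (fun _ => dist_nonneg) (fun n => ?_) ht
  obtain ⟨y, hy, hyx⟩ := codingMap_mem_image (θ := θ) hs hX ⟨c, hc⟩ hm hl n x.1 x.2
  rw [← hyx]
  refine ((lipschitzOnWith_cylinderMap hm hl n x.1 x.2).dist_le_mul c hc y hy).trans ?_
  push_cast
  gcongr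
  exact Metric.dist_le_diam_of_mem hX.isBounded hc hy

end Coding

/-! ### Independence of the first letter and the rest -/

section Independence

variable {Λ E : Type*} [MeasurableSpace Λ] [Fintype E] [MeasurableSpace E]
  [MeasurableSingletonClass E] (m : Measure Λ) [IsProbabilityMeasure m] (Q : PMF E)

theorem bernoulliMeasure_head_inter (A : Set E) {B : Set (ℕ → E)} (hB : MeasurableSet B) :
    bernoulliMeasure ℕ Q ({ω | ω 0 ∈ A} ∩ shiftN ⁻¹' B) =
      Q.toMeasure A * bernoulliMeasure ℕ Q B := by
  have hA : MeasurableSet A := A.toFinite.measurableSet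
  have h : Measurable fun ω : ℕ → E => (ω 0, shiftN ω) :=
    (measurable_pi_apply 0).prodMk measurable_shiftN
  rw [← Measure.prod_prod, ← map_head_shiftN_bernoulliMeasure, Measure.map_apply h (hA.prod hB)]
  rfl

theorem indepFun_head_tail :
    IndepFun (fun x : Λ × (ℕ → E) => x.2 0) (fun x : Λ × (ℕ → E) => (x.1, shiftN x.2))
      (m.prod (bernoulliMeasure ℕ Q)) := by
  have hg : Measurable fun x : Λ × (ℕ → E) => (x.1, shiftN x.2) :=
    measurable_fst.prodMk (measurable_shiftN.comp measurable_snd)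
  have key : ∀ (A : Set E) (B : Set (Λ × (ℕ → E))), MeasurableSet B →
      m.prod (bernoulliMeasure ℕ Q)
        ((fun x : Λ × (ℕ → E) => x.2 0) ⁻¹' A ∩ (fun x => (x.1, shiftN x.2)) ⁻¹' B) =
      Q.toMeasure A * m.prod (bernoulliMeasure ℕ Q) B := by
    intro A B hB
    rw [Measure.prod_apply ((measurable_head A.toFinite.measurableSet).inter (hg hB)),
      Measure.prod_apply hB, ← lintegral_const_mul _ (measurable_measure_prodMk_left hB)]
    exact lintegral_congr fun l =>
      bernoulliMeasure_head_inter Q A (measurable_prodMk_left (x := l) hB)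
  refine indepFun_iff_measure_inter_preimage_eq_mul.2 fun A B hA hB => ?_
  have h1 := key A univ .univ
  have h2 := key univ B hB
  simp only [preimage_univ, inter_univ, univ_inter, measure_univ, mul_one, one_mul] at h1 h2
  rw [key A B hB, h1, h2]

end Independence

/-! ### Conditional entropy of an independent first letter -/

theorem condPartitionEntropy_of_indep {Ω ι : Type*} [Fintype ι] [MeasurableSpace ι]
    [MeasurableSingletonClass ι] {𝒢 : MeasurableSpace Ω} [mΩ : MeasurableSpace Ω]
    (μ : Measure Ω) [IsProbabilityMeasure μ] {f : Ω → ι} (hf : Measurable f) (h𝒢 : 𝒢 ≤ mΩ)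
    (hind : Indep (MeasurableSpace.comap f inferInstance) 𝒢 μ) :
    condPartitionEntropy μ f 𝒢 = partitionEntropy μ f := by
  have hce : ∀ i : ι, μ[(f ⁻¹' {i}).indicator (fun _ => (1 : ℝ)) | 𝒢] =ᵐ[μ]
      fun _ => μ.real (f ⁻¹' {i}) := by
    intro i
    refine (condExp_indep_eq hf.comap_le h𝒢
      (stronglyMeasurable_const.indicator ⟨{i}, measurableSet_singleton i, rfl⟩) hind).trans ?_
    refine Eventually.of_forall fun _ => ?_
    exact integral_indicator_one (hf (measurableSet_singleton i))
  rw [partitionEntropy_eq_integral μ hf]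
  refine integral_congr_ae ?_
  filter_upwards [ae_all_iff.2 hce] with x hx
  rw [Finset.sum_eq_single (f x)]
  · rw [indicator_of_mem (mem_preimage.2 (mem_singleton _)), hx]
  · intro e _ he
    exact indicator_of_notMem (s := f ⁻¹' {e}) (fun h => he (mem_singleton_iff.1 h).symm) _
  · simp

section FirstLetter

variable {Λ : Type*} [MeasurableSpace Λ] (m : Measure Λ) [IsProbabilityMeasure m] {d : ℕ}
  (Q : PMF (Fin d))

theorem integral_head (g : Fin d → ℝ) :
    ∫ x, g (x.2 0) ∂m.prod (bernoulliMeasure ℕ Q) = ∑ e, (Q e).toReal * g e := by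
  rw [integral_fun_snd (μ := m) (ν := bernoulliMeasure ℕ Q) fun ω => g (ω 0),
    integral_eval_bernoulliMeasure]
  simp

theorem integrable_head (g : Fin d → ℝ) :
    Integrable (fun x : Λ × (ℕ → Fin d) => g (x.2 0)) (m.prod (bernoulliMeasure ℕ Q)) :=
  (integrable_eval_bernoulliMeasure Q 0 g).comp_snd m

/-- The conditioning σ-algebra is contained in that of `(x.1, shiftN x.2)`, which is independent of
the first letter. This evaluates the first term of `projEntropy`. -/
theorem condPartitionEntropy_head_tail {k : Λ × (ℕ → Fin d) → ℝ} (hk : Measurable k) :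
    condPartitionEntropy (m.prod (bernoulliMeasure ℕ Q)) (fun x => x.2 0)
      (MeasurableSpace.comap (Prod.fst : Λ × (ℕ → Fin d) → Λ) inferInstance ⊔
        MeasurableSpace.comap (fun x : Λ × (ℕ → Fin d) => k (x.1, shiftN x.2)) (borel ℝ)) =
      ∑ e, Real.negMulLog (Q e).toReal := by
  have hg : Measurable fun x : Λ × (ℕ → Fin d) => (x.1, shiftN x.2) :=
    measurable_fst.prodMk (measurable_shiftN.comp measurable_snd)
  have hle : MeasurableSpace.comap (Prod.fst : Λ × (ℕ → Fin d) → Λ) inferInstance ⊔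
      MeasurableSpace.comap (fun x : Λ × (ℕ → Fin d) => k (x.1, shiftN x.2)) (borel ℝ) ≤
      MeasurableSpace.comap (fun x : Λ × (ℕ → Fin d) => (x.1, shiftN x.2)) inferInstance := by
    rw [← BorelSpace.measurable_eq (α := ℝ)]
    refine sup_le ?_ ?_
    · exact (measurable_fst.comp (comap_measurable
        (fun x : Λ × (ℕ → Fin d) => (x.1, shiftN x.2)))).comap_le
    · exact (hk.comp (comap_measurable
        (fun x : Λ × (ℕ → Fin d) => (x.1, shiftN x.2)))).comap_le
  rw [condPartitionEntropy_of_indep _ measurable_head (hle.trans hg.comap_le)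
    (indep_of_indep_of_le_right (indepFun_head_tail m Q) hle), partitionEntropy_eq_integral _
    measurable_head]
  have hreal : ∀ e, (m.prod (bernoulliMeasure ℕ Q)).real
      ((fun x : Λ × (ℕ → Fin d) => x.2 0) ⁻¹' {e}) = (Q e).toReal := by
    intro e
    rw [← measureReal_eval_bernoulliMeasure Q (0 : ℕ) e]
    exact measurePreserving_snd.measureReal_preimage
      (measurable_pi_apply 0 (measurableSet_singleton e)).nullMeasurableSet
  simp_rw [hreal]
  rw [integral_head m Q fun e => -Real.log (Q e).toReal]
  exact Finset.sum_congr rfl fun e _ => by rw [Real.negMulLog]; ring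

end FirstLetter

/-! ### The affine system -/

section Affine

variable {r : Fin 2 → ℝ} {a b : ℝ}

theorem exists_contraction (hr : ∀ i, r i ∈ Ioo (0 : ℝ) 1) : ∃ s : ℝ≥0, s < 1 ∧ ∀ i, r i ≤ s := by
  refine ⟨Real.toNNReal (max (r 0) (r 1)), ?_, ?_⟩
  · rw [Real.toNNReal_lt_one]
    exact max_lt (hr 0).2 (hr 1).2
  · rw [Fin.forall_fin_two, Real.coe_toNNReal _ (le_max_of_le_left (hr 0).1.le)]
    exact ⟨le_max_left _ _, le_max_right _ _⟩

theorem lipschitzOnWith_affineMap (hr : ∀ i, r i ∈ Ioo (0 : ℝ) 1) {s : ℝ≥0} (hs : ∀ i, r i ≤ s)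
    (l : ℤ → Fin 2) (e : Fin 2) (X : Set ℝ) : LipschitzOnWith s (affineMap r l e) X := by
  refine LipschitzOnWith.of_dist_le_mul fun x _ y _ => ?_
  rw [Real.dist_eq, Real.dist_eq, affineMap, affineMap, add_sub_add_right_eq_sub, ← mul_sub,
    abs_mul, abs_of_pos (hr _).1]
  exact mul_le_mul_of_nonneg_right (hs _) (abs_nonneg _)

theorem measurable_shiftZ {A : Type*} [MeasurableSpace A] :
    Measurable (shiftZ : (ℤ → A) → ℤ → A) :=
  measurable_pi_lambda _ fun n => measurable_pi_apply (n + 1)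

theorem measurable_affineMap (r : Fin 2 → ℝ) :
    Measurable fun z : (ℤ → Fin 2) × Fin 2 × ℝ => affineMap r z.1 z.2.1 z.2.2 := by
  have h1 : Measurable fun z : (ℤ → Fin 2) × Fin 2 × ℝ => r (z.1 0) :=
    (Measurable.of_discrete (f := r)).comp ((measurable_pi_apply 0).comp measurable_fst)
  have h2 : Measurable fun z : (ℤ → Fin 2) × Fin 2 × ℝ => (if z.2.1 = 0 then (1 : ℝ) else -1) :=
    (Measurable.of_discrete (f := fun e : Fin 2 => if e = 0 then (1 : ℝ) else -1)).comp
      (measurable_fst.comp measurable_snd)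
  exact (h1.mul (measurable_snd.comp measurable_snd)).add h2

theorem deriv_affineMap (r : Fin 2 → ℝ) (l : ℤ → Fin 2) (e : Fin 2) (x : ℝ) :
    deriv (affineMap r l e) x = r (l 0) := by
  have h : HasDerivAt (affineMap r l e) (r (l 0) * 1) x :=
    ((hasDerivAt_id x).const_mul (r (l 0))).add_const _
  simpa using h.deriv

/-- The coding map of the affine system on `[a, b]`. -/
abbrev affineCoding (r : Fin 2 → ℝ) (a b : ℝ) : (ℤ → Fin 2) → (ℕ → Fin 2) → ℝ :=
  codingMap shiftZ (affineMap r) (Icc a b)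

section Coding

variable (hr : ∀ i, r i ∈ Ioo (0 : ℝ) 1) (hab : a < b)
  (hX : ∀ (l : ℤ → Fin 2) (e : Fin 2), MapsTo (affineMap r l e) (Icc a b) (Icc a b))

include hr hab hX

theorem affineCoding_mem (l : ℤ → Fin 2) (ω : ℕ → Fin 2) : affineCoding r a b l ω ∈ Icc a b := by
  obtain ⟨s, hs1, hs⟩ := exists_contraction hr
  exact codingMap_mem hs1 isCompact_Icc (nonempty_Icc.2 hab.le) hX
    (fun l e => lipschitzOnWith_affineMap hr hs l e _) l ω

theorem affineCoding_eq (l : ℤ → Fin 2) (ω : ℕ → Fin 2) :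
    affineCoding r a b l ω =
      r (l 0) * affineCoding r a b (shiftZ l) (shiftN ω) + if ω 0 = 0 then 1 else -1 := by
  obtain ⟨s, hs1, hs⟩ := exists_contraction hr
  exact codingMap_eq hs1 isCompact_Icc (nonempty_Icc.2 hab.le) hX
    (fun l e => lipschitzOnWith_affineMap hr hs l e _) l ω

theorem measurable_affineCoding :
    Measurable fun x : (ℤ → Fin 2) × (ℕ → Fin 2) => affineCoding r a b x.1 x.2 := by
  obtain ⟨s, hs1, hs⟩ := exists_contraction hr
  exact measurable_codingMap hs1 isCompact_Icc (nonempty_Icc.2 hab.le) hX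
    (fun l e => lipschitzOnWith_affineMap hr hs l e _) measurable_shiftZ (measurable_affineMap r)

end Coding

/-- `c` times the contraction ratio of the cylinders of order `n` at the parameter `l`. -/
def radius (r : Fin 2 → ℝ) (c : ℝ) : ℕ → (ℤ → Fin 2) → ℝ
  | 0, _ => c
  | n + 1, l => r (l 0) * radius r c n (shiftZ l)

theorem measurable_radius (r : Fin 2 → ℝ) (c : ℝ) (n : ℕ) : Measurable (radius r c n) := by
  induction n with
  | zero => exact measurable_const
  | succ n ih =>
    exact ((Measurable.of_discrete (f := r)).comp (measurable_pi_apply 0)).mul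
      (ih.comp measurable_shiftZ)

theorem radius_pos (hr : ∀ i, r i ∈ Ioo (0 : ℝ) 1) {c : ℝ} (hc : 0 < c) (n : ℕ)
    (l : ℤ → Fin 2) : 0 < radius r c n l := by
  induction n generalizing l with
  | zero => exact hc
  | succ n ih => exact mul_pos (hr _).1 (ih _)

theorem radius_le_pow (hr : ∀ i, r i ∈ Ioo (0 : ℝ) 1) {c : ℝ} (hc : 0 < c) {s : ℝ≥0}
    (hs : ∀ i, r i ≤ s) (n : ℕ) (l : ℤ → Fin 2) : radius r c n l ≤ s ^ n * c := by
  induction n generalizing l with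
  | zero => simp [radius]
  | succ n ih =>
    rw [pow_succ', mul_assoc]
    exact mul_le_mul (hs _) (ih _) (radius_pos hr hc _ _).le s.coe_nonneg

theorem radius_le (hr : ∀ i, r i ∈ Ioo (0 : ℝ) 1) {c : ℝ} (hc : 0 < c) (n : ℕ)
    (l : ℤ → Fin 2) : radius r c n l ≤ c := by
  simpa using radius_le_pow hr hc (s := 1) (fun i => (hr i).2.le) n l

theorem tendsto_radius (hr : ∀ i, r i ∈ Ioo (0 : ℝ) 1) {c : ℝ} (hc : 0 < c) (l : ℤ → Fin 2) :
    Tendsto (fun n => radius r c n l) atTop (𝓝 0) := by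
  obtain ⟨s, hs1, hs⟩ := exists_contraction hr
  refine squeeze_zero (fun n => (radius_pos hr hc n l).le)
    (fun n => radius_le_pow hr hc hs n l) ?_
  simpa using (tendsto_pow_atTop_nhds_zero_of_lt_one s.coe_nonneg
    (by exact_mod_cast hs1)).mul_const c

theorem log_radius (hr : ∀ i, r i ∈ Ioo (0 : ℝ) 1) {c : ℝ} (hc : 0 < c) (n : ℕ)
    (x : (ℤ → Fin 2) × (ℕ → Fin 2)) :
    Real.log (radius r c n x.1) = Real.log c +
      birkhoffSum (Prod.map shiftZ shiftN) (fun y => Real.log (r (y.1 0))) n x := by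
  induction n generalizing x with
  | zero => simp [radius]
  | succ n ih =>
    rw [radius, Real.log_mul (hr _).1.ne' (radius_pos hr hc _ _).ne', birkhoffSum_succ']
    have := ih (Prod.map shiftZ shiftN x)
    rw [Prod.map_fst] at this
    rw [this]
    ring

/-- The mass of the ball of radius `R n l` around `p l ω` under the law of `p l`. -/
def ballMass {Λ Ω : Type*} [MeasurableSpace Ω] (ν : Measure Ω) (p : Λ → Ω → ℝ) (R : ℕ → Λ → ℝ)
    (n : ℕ) (x : Λ × Ω) : ℝ :=
  (ν.map (p x.1)).real (Metric.closedBall (p x.1 x.2) (R n x.1))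

/-! ### Self-similarity of the masses of balls -/

section Mass

variable (hr : ∀ i, r i ∈ Ioo (0 : ℝ) 1) (hab : a < b)
  (hX : ∀ (l : ℤ → Fin 2) (e : Fin 2), MapsTo (affineMap r l e) (Icc a b) (Icc a b))
  (Q : PMF (Fin 2))

include hr hab hX

/-- Two sequences with a common first letter have coding points at distance r_{l_0} times that of
their tails, the same factor that relates the two radii. Independence of head and tail supplies the
weight `Q (ω 0)`. -/
theorem fibreLaw_headSet_closedBall {c : ℝ} (n : ℕ) (l : ℤ → Fin 2) (ω : ℕ → Fin 2) :
    fibreLaw (bernoulliMeasure ℕ Q) (affineCoding r a b) (headSet (ω 0)) l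
        (Metric.closedBall (affineCoding r a b l ω) (radius r c (n + 1) l)) =
      Q (ω 0) * fibreLaw (bernoulliMeasure ℕ Q) (affineCoding r a b) univ (shiftZ l)
        (Metric.closedBall (affineCoding r a b (shiftZ l) (shiftN ω))
          (radius r c n (shiftZ l))) := by
  have hp := measurable_affineCoding hr hab hX
  rw [fibreLaw_apply _ hp _ measurableSet_closedBall, fibreLaw_apply _ hp _ measurableSet_closedBall,
    inter_univ, ← PMF.toMeasure_apply_singleton Q (ω 0) (measurableSet_singleton _),
    ← bernoulliMeasure_head_inter Q _ (measurable_fibre hp _ measurableSet_closedBall)]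
  congr 1
  ext ω'
  have key : ω' 0 = ω 0 → (affineCoding r a b l ω' ∈
      Metric.closedBall (affineCoding r a b l ω) (radius r c (n + 1) l) ↔
      affineCoding r a b (shiftZ l) (shiftN ω') ∈ Metric.closedBall
        (affineCoding r a b (shiftZ l) (shiftN ω)) (radius r c n (shiftZ l))) := by
    intro h
    rw [Metric.mem_closedBall, Metric.mem_closedBall, Real.dist_eq, Real.dist_eq,
      affineCoding_eq hr hab hX l ω', affineCoding_eq hr hab hX l ω, h, add_sub_add_right_eq_sub,
      ← mul_sub, abs_mul, abs_of_pos (hr _).1, radius, mul_le_mul_iff_right₀ (hr _).1]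
  constructor
  · rintro ⟨h1, h2⟩
    exact ⟨h2, (key h2).1 h1⟩
  · rintro ⟨h1, h2⟩
    exact ⟨(key h1).2 h2, h1⟩

/-- The constant b - a is the length of the phase interval, so the initial ball contains every
coding point. -/
theorem ballMass_zero (x : (ℤ → Fin 2) × (ℕ → Fin 2)) :
    ballMass (bernoulliMeasure ℕ Q) (affineCoding r a b) (radius r (b - a)) 0 x = 1 := by
  have hp := measurable_affineCoding hr hab hX
  rw [ballMass, map_measureReal_apply (measurable_fibre hp _) measurableSet_closedBall]
  convert probReal_univ (μ := bernoulliMeasure ℕ Q)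
  refine eq_univ_of_forall fun ω => ?_
  have h1 := affineCoding_mem hr hab hX x.1 ω
  have h2 := affineCoding_mem hr hab hX x.1 x.2
  rw [mem_preimage, Metric.mem_closedBall, Real.dist_eq]
  exact abs_sub_le_of_le_of_le h1.1 h1.2 h2.1 h2.2

/-- The ball ratio of order n + 1 is q_{ω_1} N'/N, where N is the mass of the ball and N' that of
the ball of order n at T x. Taking logarithms and iterating telescopes, ending at mass 1; the
information of order 0 never enters. -/
theorem log_ballMass (n : ℕ) (x : (ℤ → Fin 2) × (ℕ → Fin 2))
    (hx : ∀ k, 0 < (Q (x.2 k)).toReal) :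
    0 < ballMass (bernoulliMeasure ℕ Q) (affineCoding r a b) (radius r (b - a)) n x ∧
    Real.log (ballMass (bernoulliMeasure ℕ Q) (affineCoding r a b) (radius r (b - a)) n x) =
      ∑ k ∈ Finset.range n, ballInfo (bernoulliMeasure ℕ Q) (affineCoding r a b)
        (radius r (b - a)) (n - k) ((Prod.map shiftZ shiftN)^[k] x) +
      birkhoffSum (Prod.map shiftZ shiftN) (fun y => Real.log (Q (y.2 0)).toReal) n x := by
  have hp := measurable_affineCoding hr hab hX
  induction n generalizing x with
  | zero => simp [ballMass_zero hr hab hX]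
  | succ n ih =>
    obtain ⟨ih1, ih2⟩ := ih (Prod.map shiftZ shiftN x) fun k => hx (k + 1)
    set N := ballMass (bernoulliMeasure ℕ Q) (affineCoding r a b) (radius r (b - a)) (n + 1) x
      with hN
    set N' := ballMass (bernoulliMeasure ℕ Q) (affineCoding r a b) (radius r (b - a)) n
      (Prod.map shiftZ shiftN x) with hN'
    have hid : (fibreLaw (bernoulliMeasure ℕ Q) (affineCoding r a b) (headSet (x.2 0)) x.1).real
        (Metric.closedBall (affineCoding r a b x.1 x.2) (radius r (b - a) (n + 1) x.1)) =
        (Q (x.2 0)).toReal * N' := by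
      rw [measureReal_def, fibreLaw_headSet_closedBall hr hab hX, ENNReal.toReal_mul, hN',
        fibreLaw_univ]
      rfl
    have hle : (Q (x.2 0)).toReal * N' ≤ N := by
      rw [← hid, hN, ballMass, ← fibreLaw_univ]
      exact ENNReal.toReal_mono (measure_ne_top _ _) (fibreLaw_le _ hp _ _ _)
    have hpos : 0 < (Q (x.2 0)).toReal * N' := mul_pos (hx 0) ih1
    have hinfo : ballInfo (bernoulliMeasure ℕ Q) (affineCoding r a b) (radius r (b - a)) (n + 1) x =
        Real.log N - (Real.log (Q (x.2 0)).toReal + Real.log N') := by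
      rw [ballInfo, ballRatio, ENNReal.toReal_div, ← measureReal_def, hid, fibreLaw_univ,
        ← Real.log_mul (hx 0).ne' ih1.ne',
        Real.log_div hpos.ne' (show ((bernoulliMeasure ℕ Q).map _ _).toReal ≠ 0 from
          (hpos.trans_le hle).ne')]
      simp only [neg_sub]
      rfl
    refine ⟨hpos.trans_le hle, ?_⟩
    rw [Finset.sum_range_succ', birkhoffSum_succ']
    simp only [Function.iterate_succ_apply, Nat.succ_sub_succ_eq_sub, Nat.sub_zero,
      Function.iterate_zero, id]
    rw [hinfo]
    linarith

end Mass

end Affine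

/-! ### The dimension of the projection measures -/

section Dimension

variable {r : Fin 2 → ℝ} {a b : ℝ} (hr : ∀ i, r i ∈ Ioo (0 : ℝ) 1) (hab : a < b)
  (hX : ∀ (l : ℤ → Fin 2) (e : Fin 2), MapsTo (affineMap r l e) (Icc a b) (Icc a b))
  (P Q : PMF (Fin 2))

theorem integral_fst_eval (g : Fin 2 → ℝ) :
    ∫ x, g (x.1 0) ∂(bernoulliMeasure ℤ P).prod (bernoulliMeasure ℕ Q) =
      ∑ i, (P i).toReal * g i := by
  rw [integral_fun_fst (μ := bernoulliMeasure ℤ P) (ν := bernoulliMeasure ℕ Q) fun l => g (l 0),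
    integral_eval_bernoulliMeasure]
  simp

theorem integrable_fst_eval (g : Fin 2 → ℝ) :
    Integrable (fun x => g (x.1 0)) ((bernoulliMeasure ℤ P).prod (bernoulliMeasure ℕ Q)) :=
  (integrable_eval_bernoulliMeasure P 0 g).comp_fst _

theorem lyapunovExponent_affineMap :
    lyapunovExponent shiftZ (affineMap r) (Icc a b)
      ((bernoulliMeasure ℤ P).prod (bernoulliMeasure ℕ Q)) =
      ∑ i, (P i).toReal * -Real.log |r i| := by
  rw [lyapunovExponent]
  simp_rw [deriv_affineMap]
  exact integral_fst_eval P Q fun i => -Real.log |r i|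

include hr in
theorem sum_mul_neg_log_pos : 0 < ∑ i, (P i).toReal * -Real.log |r i| := by
  have h : ∀ i, 0 < -Real.log |r i| := fun i => by
    rw [Real.log_abs]
    exact neg_pos.2 (Real.log_neg (hr i).1 (hr i).2)
  obtain ⟨i, hi⟩ := P.support_nonempty
  exact Finset.sum_pos' (fun i _ => mul_nonneg ENNReal.toReal_nonneg (h i).le)
    ⟨i, Finset.mem_univ i, mul_pos (ENNReal.toReal_pos ((P.mem_support_iff i).1 hi)
      (P.apply_ne_top i)) (h i)⟩

theorem measurable_coding_shiftZ {p : (ℤ → Fin 2) → (ℕ → Fin 2) → ℝ}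
    (hp : Measurable fun x : (ℤ → Fin 2) × (ℕ → Fin 2) => p x.1 x.2) :
    Measurable fun x : (ℤ → Fin 2) × (ℕ → Fin 2) => p (shiftZ x.1) x.2 :=
  hp.comp ((measurable_shiftZ.comp measurable_fst).prodMk measurable_snd)

include hr hab hX

theorem projEntropy_affineMap :
    projEntropy shiftZ (affineMap r) (Icc a b)
      ((bernoulliMeasure ℤ P).prod (bernoulliMeasure ℕ Q)) =
      ∑ i, Real.negMulLog (Q i).toReal -
        ∫ x, condInfo (bernoulliMeasure ℕ Q) (affineCoding r a b) (radius r (b - a)) x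
          ∂(bernoulliMeasure ℤ P).prod (bernoulliMeasure ℕ Q) := by
  have hp := measurable_affineCoding hr hab hX
  have hc : 0 < b - a := sub_pos.2 hab
  have h1 := condPartitionEntropy_head_tail (bernoulliMeasure ℤ P) Q
    (measurable_coding_shiftZ hp)
  have h2 := condPartitionEntropy_eq_integral_condInfo (bernoulliMeasure ℕ Q) hp
    (measurable_radius r (b - a)) (radius_pos hr hc) (tendsto_radius hr hc)
    (bernoulliMeasure ℤ P)
  rw [projEntropy, ← h1, ← h2]

/-- Maker's theorem handles the information sum and Birkhoff's theorem the sums of log q and log r,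
giving the rates -h and -χ of mass and radius. -/
theorem ae_hasPointwiseDim_map :
    ∀ᵐ x ∂(bernoulliMeasure ℤ P).prod (bernoulliMeasure ℕ Q),
      HasPointwiseDim ((bernoulliMeasure ℕ Q).map (affineCoding r a b x.1))
        (affineCoding r a b x.1 x.2)
        (projEntropy shiftZ (affineMap r) (Icc a b)
            ((bernoulliMeasure ℤ P).prod (bernoulliMeasure ℕ Q)) /
          lyapunovExponent shiftZ (affineMap r) (Icc a b)
            ((bernoulliMeasure ℤ P).prod (bernoulliMeasure ℕ Q))) := by
  have hp := measurable_affineCoding hr hab hX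
  have hc : 0 < b - a := sub_pos.2 hab
  have hT := ergodic_shiftZ_prod_shiftN P Q
  have hq : ∀ᵐ x ∂(bernoulliMeasure ℤ P).prod (bernoulliMeasure ℕ Q),
      ∀ k, 0 < (Q (x.2 k)).toReal :=
    measurePreserving_snd.quasiMeasurePreserving.ae
      (ae_all_iff.2 fun k => ae_bernoulliMeasure_pos Q k)
  have hlogr : Measurable fun x : (ℤ → Fin 2) × (ℕ → Fin 2) => Real.log (r (x.1 0)) :=
    (Measurable.of_discrete (f := fun i => Real.log (r i))).comp
      ((measurable_pi_apply 0).comp measurable_fst)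
  have hlogq : Measurable fun x : (ℤ → Fin 2) × (ℕ → Fin 2) => Real.log (Q (x.2 0)).toReal :=
    (Measurable.of_discrete (f := fun i => Real.log (Q i).toReal)).comp measurable_head
  filter_upwards [hq,
    ae_tendsto_sum_ballInfo (bernoulliMeasure ℕ Q) hp (measurable_radius r (b - a))
      (radius_pos hr hc) (tendsto_radius hr hc) (bernoulliMeasure ℤ P) hT (radius_le hr hc),
    tendsto_birkhoffSum_div hT hlogr (integrable_fst_eval P Q fun i => Real.log (r i)),
    tendsto_birkhoffSum_div hT hlogq
      (integrable_head (bernoulliMeasure ℤ P) Q fun i => Real.log (Q i).toReal)]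
    with x hx h1 h2 h3
  rw [integral_fst_eval P Q fun i => Real.log (r i)] at h2
  rw [integral_head (bernoulliMeasure ℤ P) Q fun i => Real.log (Q i).toReal] at h3
  have : IsProbabilityMeasure ((bernoulliMeasure ℕ Q).map (affineCoding r a b x.1)) :=
    Measure.isProbabilityMeasure_map (measurable_fibre hp _).aemeasurable
  refine tendsto_log_div_log
    (ρ := fun n => radius r (b - a) n x.1)
    (a := fun n => ballMass (bernoulliMeasure ℕ Q) (affineCoding r a b) (radius r (b - a)) n x)
    (F := fun ε => ((bernoulliMeasure ℕ Q).map (affineCoding r a b x.1)).real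
      (Metric.ball (affineCoding r a b x.1 x.2) ε)) ?_
    (fun n => radius_pos hr hc n _) (fun n => (log_ballMass hr hab hX Q n x hx).1) ?_ ?_ ?_ ?_
  · rw [lyapunovExponent_affineMap]
    exact sum_mul_neg_log_pos hr P
  · have hlim : Tendsto (fun n : ℕ => Real.log (b - a) / n) atTop (𝓝 0) :=
      tendsto_const_div_atTop_nhds_zero_nat _
    have h := hlim.add h2
    rw [lyapunovExponent_affineMap]
    convert h using 2 with n
    · rw [log_radius hr hc, add_div]
    · simp [Real.log_abs]
  · have h := h1.add h3
    rw [projEntropy_affineMap hr hab hX P Q]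
    convert h using 2 with n
    · rw [(log_ballMass hr hab hX Q n x hx).2, add_div]
    · simp only [Real.negMulLog, neg_mul, Finset.sum_neg_distrib]
      ring
  · intro n ε h
    exact measureReal_mono (Metric.closedBall_subset_ball h)
  · intro n ε h
    exact measureReal_mono (Metric.ball_subset_closedBall.trans (Metric.closedBall_subset_closedBall h))

end Dimension

/-! ### The disintegration of a product measure -/

theorem ae_condKernel_prod {Λ Ω : Type*} [MeasurableSpace Λ] [MeasurableSpace Ω]
    [StandardBorelSpace Ω] [Nonempty Ω] (m : Measure Λ) [IsProbabilityMeasure m] (ν : Measure Ω)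
    [IsProbabilityMeasure ν] : ∀ᵐ l ∂m, (m.prod ν).condKernel l = ν := by
  have h := eq_condKernel_of_measure_eq_compProd (ρ := m.prod ν) (Kernel.const Λ ν)
    (by rw [Measure.fst_prod, Measure.compProd_const])
  rw [Measure.fst_prod] at h
  filter_upwards [h] with l hl
  rw [← hl, Kernel.const_apply]

end RandomIFS

end

theorem mainTheorem6 (r : Fin 2 → ℝ) (hr : ∀ i, r i ∈ Set.Ioo (0 : ℝ) 1)
    (P Q : PMF (Fin 2)) (a b : ℝ) (hab : a < b)
    (hX : ∀ (l : ℤ → Fin 2) (e : Fin 2),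
      Set.MapsTo (RandomIFS.affineMap r l e) (Set.Icc a b) (Set.Icc a b)) :
    let m : Measure (ℤ → Fin 2) := RandomIFS.bernoulliMeasure ℤ P
    let ν : Measure (ℕ → Fin 2) := RandomIFS.bernoulliMeasure ℕ Q
    let μ : Measure ((ℤ → Fin 2) × (ℕ → Fin 2)) := m.prod ν
    let p : Fin 2 → ℝ := fun i => (P i).toReal
    let q : Fin 2 → ℝ := fun i => (Q i).toReal
    let π : (ℤ → Fin 2) → (ℕ → Fin 2) → ℝ :=
      RandomIFS.codingMap RandomIFS.shiftZ (RandomIFS.affineMap r) (Set.Icc a b)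
    let proj : (ℤ → Fin 2) → Measure ℝ :=
      RandomIFS.projMeasure RandomIFS.shiftZ (RandomIFS.affineMap r) (Set.Icc a b) μ
    let h : ℝ := RandomIFS.projEntropy RandomIFS.shiftZ (RandomIFS.affineMap r) (Set.Icc a b) μ
    let χ : ℝ :=
      RandomIFS.lyapunovExponent RandomIFS.shiftZ (RandomIFS.affineMap r) (Set.Icc a b) μ
    let hm : ℝ≥0∞ := RandomIFS.ksEntropy m RandomIFS.shiftZ
    let hν : ℝ≥0∞ := RandomIFS.ksEntropy ν RandomIFS.shiftN
    (∀ᵐ x ∂μ, RandomIFS.HasPointwiseDim (proj x.1) (π x.1 x.2) (h / χ)) ∧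
    (∀ᵐ l ∂m, RandomIFS.HasHausdorffDim (proj l) (ENNReal.ofReal (h / χ)) ∧
      RandomIFS.HasPackingDim (proj l) (ENNReal.ofReal (h / χ))) ∧
    hm ≠ ∞ ∧ hν ≠ ∞ ∧
    h / χ ≤ (hm.toReal + hν.toReal) / (-p 0 * Real.log (r 0) - p 1 * Real.log (r 1)) ∧
    (hm.toReal + hν.toReal) / (-p 0 * Real.log (r 0) - p 1 * Real.log (r 1)) =
      (p 0 * Real.log (p 0) + p 1 * Real.log (p 1) +
        q 0 * Real.log (q 0) + q 1 * Real.log (q 1)) /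
        (p 0 * Real.log (r 0) + p 1 * Real.log (r 1)) := by
  intro m ν μ p q π proj h χ hm hν
  have hp : Measurable fun x : (ℤ → Fin 2) × (ℕ → Fin 2) => π x.1 x.2 :=
    RandomIFS.measurable_affineCoding hr hab hX
  have hproj : ∀ᵐ l ∂m, proj l = ν.map (π l) := by
    filter_upwards [RandomIFS.ae_condKernel_prod m ν] with l hl
    change (μ.condKernel l).map _ = _
    rw [hl]
  have hpt : ∀ᵐ x ∂μ, RandomIFS.HasPointwiseDim (ν.map (π x.1)) (π x.1 x.2) (h / χ) :=
    RandomIFS.ae_hasPointwiseDim_map hr hab hX P Q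
  have hχ : χ = -p 0 * Real.log (r 0) - p 1 * Real.log (r 1) := by
    refine (RandomIFS.lyapunovExponent_affineMap P Q).trans ?_
    rw [Fin.sum_univ_two, Real.log_abs, Real.log_abs]
    ring
  have hχ0 : 0 < -p 0 * Real.log (r 0) - p 1 * Real.log (r 1) := by
    rw [← hχ]
    exact (RandomIFS.sum_mul_neg_log_pos hr P).trans_eq
      (RandomIFS.lyapunovExponent_affineMap (a := a) (b := b) P Q).symm
  have hH : ∀ S : PMF (Fin 2), 0 ≤ ∑ i, Real.negMulLog (S i).toReal := fun S =>
    Finset.sum_nonneg fun i _ => Real.negMulLog_nonneg ENNReal.toReal_nonneg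
      (ENNReal.toReal_mono ENNReal.one_ne_top (S.coe_le_one i))
  have hhm : hm = ENNReal.ofReal (∑ i, Real.negMulLog (p i)) := RandomIFS.ksEntropy_shiftZ P
  have hhν : hν = ENNReal.ofReal (∑ i, Real.negMulLog (q i)) := RandomIFS.ksEntropy_shiftN Q
  have hhm' : hm.toReal = ∑ i, Real.negMulLog (p i) := by
    rw [hhm, ENNReal.toReal_ofReal (hH P)]
  have hhν' : hν.toReal = ∑ i, Real.negMulLog (q i) := by
    rw [hhν, ENNReal.toReal_ofReal (hH Q)]
  refine ⟨?_, ?_, ?_, ?_, ?_, ?_⟩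
  · filter_upwards [hpt, Measure.quasiMeasurePreserving_fst.ae hproj] with x h1 h2
    rwa [h2]
  · filter_upwards [hproj, Measure.ae_ae_of_ae_prod hpt] with l h1 h2
    rw [h1]
    exact RandomIFS.hasDim_of_hasPointwiseDim (RandomIFS.measurable_fibre hp l) h2
  · rw [hhm]
    exact ENNReal.ofReal_ne_top
  · rw [hhν]
    exact ENNReal.ofReal_ne_top
  · rw [← hχ] at hχ0 ⊢
    refine div_le_div_of_nonneg_right ?_ hχ0.le
    rw [hhm', hhν']
    have h1 : h = _ := RandomIFS.projEntropy_affineMap hr hab hX P Q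
    -- Dropping this conditional entropy already gives h ≤ H(Q); the term H(P) is added for free.
    have h2 : 0 ≤ ∫ x, RandomIFS.condInfo ν π (RandomIFS.radius r (b - a)) x ∂μ :=
      integral_nonneg (RandomIFS.condInfo_nonneg ν hp)
    have h3 : 0 ≤ ∑ i, Real.negMulLog (p i) := hH P
    linarith
  · rw [hhm', hhν', ← neg_div_neg_eq]
    simp only [Fin.sum_univ_two, Real.negMulLog]
    congr 1 <;> ring
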